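/- Let $2\le k\le n-1$, let $\Sigma^k$ be a smooth compact $k$-dimensional manifold with boundary and let $x:\Sigma\to\mathbb R^n$ be a smooth immersion with $|x|\le 1$ on $\Sigma$, making $\Sigma$ an immersed free boundary minimal submanifold of the unit ball $\mathbb B^n$: its mean curvature vector vanishes, $|x|=1$ on $\partial\Sigma$, and $\Sigma$ meets the unit sphere orthogonally, i.e. the outward unit conormal of $\partial\Sigma$ in $\Sigma$ is $\nu=x$. Integrals over $\Sigma$ and $\partial\Sigma$ are with respect to the $k$- and $(k-1)$-dimensional volumes of the induced metric. Let $D$ be the derivative of $\mathbb R^n$, let $\top$ and $\perp$ denote the orthogonal projections onto the tangent and the normal spaces of $\Sigma$, and put $\sigma(X,Y)=(D_XY)^\perp$ for tangent fields $X,Y$ and $D^\perp_XW=(D_XW)^\perp$ for normal fields $W$. For smooth normal fields $U,W$ (smooth up to the boundary) let $$Q(U,W)=\int_\Sigma\Big(\sum_{i}(D^\perp_{e_i}U,D^\perp_{e_i}W)-\sum_{i,j}(\sigma(e_i,e_j),U)(\sigma(e_i,e_j),W)\Big)-\int_{\partial\Sigma}(U,W),\qquad Q(U)=Q(U,U),$$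 $$JW=-\sum_i D^\perp_{e_i}D^\perp_{e_i}W+\sum_i D^\perp_{(D_{e_i}e_i)^\top}W-\sum_{i,j}(\sigma(e_i,e_j),W)\,\sigma(e_i,e_j),$$ where $(e_i)_{i=1}^k$ is a local orthonormal basis of $T\Sigma$. For $v\in\mathbb R^n$ let $v^\perp$ be the normal field $p\mapsto v^\perp(p)$. Then for every $v\in\mathbb R^n$ and every smooth normal field $W$, $$Q(v^\perp,W)=-k\int_\Sigma(v^\perp,W)+\int_\Sigma\Big(JW,\,(v,x)\,x+\tfrac12(1-|x|^2)\,v\Big),$$ and in particular, for every $v\in\mathbb R^n$, $$Q(v^\perp)=-k\int_\Sigma|v^\perp|^2 .$$ -/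

import Mathlib

open scoped Manifold ContDiff RealInnerProductSpace

noncomputable section

namespace FreeBoundary

/-- Euclidean space `ℝⁿ` with its standard inner product. -/
abbrev E (n : ℕ) := EuclideanSpace ℝ (Fin n)

section Geometry

/-! Throughout, `M` is a manifold with boundary of dimension `k`, modelled on the closed half-space
`{y ∈ ℝᵏ : 0 ≤ y 0}`, and `x : M → ℝⁿ` is an immersion. Fields along the immersion are maps
`M → ℝⁿ`, and the tangent space `T_pΣ` is regarded as a linear subspace of `ℝⁿ`. -/

variable (k : ℕ) {n : ℕ} [NeZero k] {M : Type*} [TopologicalSpace M]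
  [ChartedSpace (EuclideanHalfSpace k) M]

/-- The differential `df_p` of `f : M → ℝⁿ`; the abstract tangent space of `M` at `p` is identified
with `ℝᵏ` by the preferred chart at `p`, as everywhere in Mathlib. -/
def differential (f : M → E n) (p : M) : E k →L[ℝ] E n :=
  mfderiv (𝓡∂ k) 𝓘(ℝ, E n) f p

/-- The tangent space `T_pΣ = dx_p(T_pM) ⊆ ℝⁿ`. -/
def tangentPlane (x : M → E n) (p : M) : Submodule ℝ (E n) :=
  LinearMap.range (differential k x p : E k →ₗ[ℝ] E n)

/-- The orthogonal projection `Y^⊤` of a vector onto `T_pΣ`. -/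
def tangentPart (x : M → E n) (p : M) (Y : E n) : E n :=
  (tangentPlane k x p).starProjection Y

/-- The orthogonal projection `Y^⊥` of a vector onto the normal space `(T_pΣ)^⊥`. -/
def normalPart (x : M → E n) (p : M) (Y : E n) : E n :=
  (tangentPlane k x p)ᗮ.starProjection Y

/-- The derivative `D_Y f (p)` in `ℝⁿ` of a map `f : M → ℝⁿ` in the direction of a tangent vector
`Y ∈ T_pΣ`: it is `df_p(u)`, where `u` is the abstract tangent vector with `dx_p(u) = Y`.
(For arbitrary `Y ∈ ℝⁿ`, the tangential part of `Y` is used.) -/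
def dirDeriv (x : M → E n) (f : M → E n) (p : M) (Y : E n) : E n :=
  differential k f p
    ((differential k x p : E k →ₗ[ℝ] E n).leftInverse (tangentPart k x p Y))

/-- The covariant derivative `D^⊥_Y W (p) = (D_Y W)^⊥ (p)` of the normal bundle. -/
def normalDeriv (x : M → E n) (W : M → E n) (p : M) (Y : E n) : E n :=
  normalPart k x p (dirDeriv k x W p Y)

/-- An orthonormal basis `(e_i)` of `T_pΣ`. -/
def frame (x : M → E n) (p : M) (i : Fin (Module.finrank ℝ (tangentPlane k x p))) : E n :=
  (stdOrthonormalBasis ℝ (tangentPlane k x p) i : E n)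

/-- The second fundamental form `σ(X, Y) = (D_X Y)^⊥` at `p`, for `X, Y ∈ T_pΣ`: the vector `Y` is
extended to the tangent vector field `q ↦ Y^⊤(q)`; the value does not depend on the extension. -/
def secondFF (x : M → E n) (p : M) (X Y : E n) : E n :=
  normalPart k x p (dirDeriv k x (fun q => tangentPart k x q Y) p X)

/-- `Σ` is minimal: the mean curvature vector `∑ᵢ σ(e_i, e_i)` vanishes identically. -/
def IsMinimal (x : M → E n) : Prop :=
  ∀ p, ∑ i, secondFF k x p (frame k x p i) (frame k x p i) = 0

/-- The (nonnegative) Laplacian of the normal bundle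
`Δ^⊥ W = - ∑ᵢ D^⊥_{e_i} D^⊥_{e_i} W + ∑ᵢ D^⊥_{(D_{e_i} e_i)^⊤} W` at `p`. The orthonormal basis
`(e_i)` of `T_pΣ` is extended to the tangent vector fields `q ↦ e_i^⊤(q)`; the expression
`D^⊥_X D^⊥_X W - D^⊥_{(D_X X)^⊤} W` at `p` depends only on the value of the tangent field `X` at
`p`, so that the result does not depend on the extension. -/
def normalLaplacian (x : M → E n) (W : M → E n) (p : M) : E n :=
  - ∑ i, normalDeriv k x
        (fun q => normalDeriv k x W q (tangentPart k x q (frame k x p i))) p (frame k x p i)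
  + ∑ i, normalDeriv k x W p
        (tangentPart k x p
          (dirDeriv k x (fun q => tangentPart k x q (frame k x p i)) p (frame k x p i)))

/-- Simons' operator `S(W) = ∑ᵢⱼ (σ(e_i, e_j), W) σ(e_i, e_j)`. -/
def simons (x : M → E n) (W : M → E n) (p : M) : E n :=
  ∑ i, ∑ j, ⟪secondFF k x p (frame k x p i) (frame k x p j), W p⟫ •
    secondFF k x p (frame k x p i) (frame k x p j)

/-- The stability (Jacobi) operator `J W = Δ^⊥ W - S(W)`. -/
def jacobi (x : M → E n) (W : M → E n) (p : M) : E n :=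
  normalLaplacian k x W p - simons k x W p

/-- `ν` is the outward unit conormal of `∂Σ` in `Σ` at the boundary point `p`: it is the unit vector
`ν = dx_p(u) ∈ T_pΣ` orthogonal to `T_p∂Σ = dx_p({w : w 0 = 0})` with `u` pointing out of the
half-space, that is `u 0 < 0`. -/
def IsOutwardConormal (x : M → E n) (p : M) (ν : E n) : Prop :=
  ‖ν‖ = 1 ∧ (∀ w : E k, w 0 = 0 → ⟪differential k x p w, ν⟫ = 0) ∧
    ∃ u : E k, u 0 < 0 ∧ differential k x p u = ν

/-- `x : M → ℝⁿ` is a smooth immersed free boundary minimal submanifold of the closed unit ball: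
a minimal immersion into the ball, mapping `∂M` to the unit sphere and meeting the sphere
orthogonally, i.e. the outward conormal along `∂M` is the position vector. -/
structure IsFreeBoundaryMinimal (x : M → E n) : Prop where
  smooth : ContMDiff (𝓡∂ k) 𝓘(ℝ, E n) ∞ x
  immersion : ∀ p, Function.Injective (differential k x p)
  mem_ball : ∀ p, ‖x p‖ ≤ 1
  boundary_mem_sphere : ∀ p ∈ (𝓡∂ k).boundary M, ‖x p‖ = 1
  minimal : IsMinimal k x
  orthogonal : ∀ p ∈ (𝓡∂ k).boundary M, IsOutwardConormal k x p (x p)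

/-- `W` is a smooth section of the normal bundle of `x`. -/
structure IsNormalField (x : M → E n) (W : M → E n) : Prop where
  smooth : ContMDiff (𝓡∂ k) 𝓘(ℝ, E n) ∞ W
  normal : ∀ p, W p ∈ (tangentPlane k x p)ᗮ

end Geometry

section Volume

/-- The volume `√(det (⟪uᵢ, uⱼ⟫)ᵢⱼ)` of the parallelepiped spanned by a family of vectors. -/
def areaElement {ι : Type*} [Fintype ι] [DecidableEq ι] {n : ℕ} (u : ι → E n) : ℝ :=
  Real.sqrt (Matrix.gram ℝ u).det

variable (k : ℕ) {n : ℕ} [NeZero k] {M : Type*} [TopologicalSpace M]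
  [ChartedSpace (EuclideanHalfSpace k) M]

/-- The immersion read in the preferred chart at `p`: a map on (an open part of) the half-space. -/
def localParam (x : M → E n) (p : M) : E k → E n :=
  x ∘ (extChartAt (𝓡∂ k) p).symm

/-- The partial derivatives of the immersion read in the chart at `p`. -/
def partialDeriv (x : M → E n) (p : M) (y : E k) (i : Fin k) : E n :=
  fderivWithin ℝ (localParam k x p) (Set.range (𝓡∂ k)) y (EuclideanSpace.single i 1)

/-- The inclusion `z ↦ (0, z)` of `ℝᵏ⁻¹` as the boundary hyperplane `{y 0 = 0}` of the half-space;
the coordinates of `ℝᵏ⁻¹` are indexed by the nonzero elements of `Fin k`. -/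
def boundaryIncl (z : EuclideanSpace ℝ {i : Fin k // i ≠ 0}) : E k :=
  WithLp.toLp 2 fun i => if h : i = 0 then 0 else z ⟨i, h⟩

variable [MeasurableSpace M]

/-- The Riemannian volume `√(det g) dy` of the induced metric on the domain of the chart at `p`,
as a measure on `M` which vanishes outside this domain. -/
def chartVolume (x : M → E n) (p : M) : MeasureTheory.Measure M :=
  ((MeasureTheory.volume.restrict (extChartAt (𝓡∂ k) p).target).withDensity
      fun y => ENNReal.ofReal (areaElement (partialDeriv k x p y))).map
    (extChartAt (𝓡∂ k) p).symm

/-- The Riemannian volume `dvol` of the induced metric on `M`. The chart volumes agree on the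
overlaps of chart domains, and `dvol` is the measure whose restriction to each chart domain is the
chart volume; equivalently, it is the smallest measure which dominates all of them. -/
def vol (x : M → E n) : MeasureTheory.Measure M :=
  ⨆ p : M, chartVolume k x p

/-- The `(k-1)`-dimensional Riemannian volume of the induced metric on the part of `∂M` in the
domain of the chart at `p`, as a measure on `M` which vanishes outside this part. -/
def chartBoundaryVolume (x : M → E n) (p : M) : MeasureTheory.Measure M :=
  ((MeasureTheory.volume.restrict (boundaryIncl k ⁻¹' (extChartAt (𝓡∂ k) p).target)).withDensity
      fun z => ENNReal.ofReal (areaElement fun i : {i : Fin k // i ≠ 0} =>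
        partialDeriv k x p (boundaryIncl k z) i)).map
    fun z => (extChartAt (𝓡∂ k) p).symm (boundaryIncl k z)

/-- The `(k-1)`-dimensional Riemannian volume of the induced metric on `∂M`, as a measure on `M`
carried by `∂M`; it is glued from the charts in the same way as `vol`. -/
def boundaryVol (x : M → E n) : MeasureTheory.Measure M :=
  ⨆ p : M, chartBoundaryVolume k x p

/-- The index form (the symmetric bilinear form of the second variation of area)
`Q(U, W) = ∫_Σ (∑ᵢ (D^⊥_{e_i} U, D^⊥_{e_i} W) - ∑ᵢⱼ (σ(e_i, e_j), U) (σ(e_i, e_j), W))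
  - ∫_{∂Σ} (U, W)`. -/
def indexForm (x : M → E n) (U W : M → E n) : ℝ :=
  (∫ p, (∑ i, ⟪normalDeriv k x U p (frame k x p i), normalDeriv k x W p (frame k x p i)⟫
      - ∑ i, ∑ j, ⟪secondFF k x p (frame k x p i) (frame k x p j), U p⟫ *
          ⟪secondFF k x p (frame k x p i) (frame k x p j), W p⟫) ∂(vol k x))
  - ∫ p, ⟪U p, W p⟫ ∂(boundaryVol k x)

end Volume

end FreeBoundary

end

/-!
The identity is an integrated divergence identity. Write `Z = (v, x) x + ½ (1 - |x|²) v` for the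
conformal Killing field of the ball attached to `v`, so that
`D_Y Z = (v, Y) x + (v, x) Y - (x, Y) v` for tangent vectors `Y`. To a normal field `W` one attaches
the tangent field `X` (`fluxField`) determined by
`(X, Y) = (D_Y W, v^⊤ - 2 Z^⊤ + Z) + (W, v) (x, Y) - (W, x) (v, Y)`.

*In the interior* (`divergence_fluxField`), `div X` is the integrand of `Q(v^⊥, W)` plus
`k (v^⊥, W) - (J W, Z)`. The computation is carried out with the tangential projection
`P : Σ → End(ℝⁿ)` and its first two derivatives. On tangent vectors `DP` is the second fundamental
form, traces over a tangent frame become traces over the standard basis of `ℝⁿ` (`sum_frame_eq`),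
and the one second-order term that is left, `∑ₐ (P (v - Z), D²P (e_a, e_a) W)`, vanishes because of
the contracted Codazzi equation for minimal submanifolds (`codazzi`).

*On the boundary* (`inner_fluxField_boundary`), `Z = (v, x) x` and the outward conormal is `x`.
Differentiating `x^⊤ = x` along `∂Σ` shows that `σ(x, u) = 0` for `u` tangent to `∂Σ`
(`ambDeriv_tangProj_boundary`), and `(X, x) = (v^⊥, W)` follows.

The first assertion is therefore the divergence theorem `∫_Σ div X = ∫_{∂Σ} (X, x)`
(`integral_divergence`) for smooth tangent fields. By a partition of unity the field may be assumed
to be supported in a chart. There the volumes are given by area densities, since the chart volumes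
agree on overlaps (`vol_restrict`, `boundaryVol_restrict`). Jacobi's formula for the derivative of
the area density `J` gives `J div X = ∑ᵢ ∂ᵢ (J ξⁱ)` for the components `ξ` of `X`
(`sum_fderivWithin_eq`), and the density of `∂Σ` is `J` divided by the height over the boundary
hyperplane (`areaElement_eq_of_conormal`). What remains is the divergence theorem in the half-space
(`integral_divergence_halfSpace`), which is Mathlib's theorem for a box.

The second assertion is the case `W = v^⊥`, for which `J W = 0` (`jacobi_normalPart`): translations
preserve minimality.
-/

noncomputable section

namespace FreeBoundary

/-! ### The pseudo-inverse of an injective linear map -/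

section PseudoInverse

variable {V U : Type*} [NormedAddCommGroup V] [InnerProductSpace ℝ V] [FiniteDimensional ℝ V]
  [NormedAddCommGroup U] [InnerProductSpace ℝ U] [FiniteDimensional ℝ U]

/-- The Moore–Penrose inverse `(L†L)⁻¹L†` of an injective linear map `L`; as a formula in `L` it is
smooth, which is what makes the projection onto the range of `L` depend smoothly on `L`. -/
def pinv (L : V →L[ℝ] U) : U →L[ℝ] V :=
  Ring.inverse (L.adjoint ∘L L) ∘L L.adjoint

lemma isUnit_adjoint_comp_self {L : V →L[ℝ] U} (hL : Function.Injective L) :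
    IsUnit (L.adjoint ∘L L) := by
  rw [ContinuousLinearMap.isUnit_iff_bijective]
  have hinj : Function.Injective (L.adjoint ∘L L) := by
    rw [injective_iff_map_eq_zero]
    intro v hv
    have h : ⟪L v, L v⟫ = 0 := by
      rw [← ContinuousLinearMap.adjoint_inner_left]
      have : L.adjoint (L v) = 0 := hv
      rw [this, inner_zero_left]
    exact (injective_iff_map_eq_zero L).1 hL v (inner_self_eq_zero.1 h)
  exact ⟨hinj, LinearMap.injective_iff_surjective (f := ((L.adjoint ∘L L : V →L[ℝ] V) : V →ₗ[ℝ] V))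
    |>.1 hinj⟩

lemma pinv_apply_self {L : V →L[ℝ] U} (hL : Function.Injective L) (u : V) : pinv L (L u) = u := by
  have h := Ring.inverse_mul_cancel _ (isUnit_adjoint_comp_self hL)
  exact congrArg (fun T : V →L[ℝ] V => T u) h

lemma adjoint_apply_pinv {L : V →L[ℝ] U} (hL : Function.Injective L) (Y : U) :
    L.adjoint (L (pinv L Y)) = L.adjoint Y := by
  have h := Ring.mul_inverse_cancel _ (isUnit_adjoint_comp_self hL)
  exact congrArg (fun T : V →L[ℝ] V => T (L.adjoint Y)) h

lemma apply_pinv {L : V →L[ℝ] U} (hL : Function.Injective L) (Y : U) :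
    L (pinv L Y) = (LinearMap.range (L : V →ₗ[ℝ] U)).starProjection Y := by
  symm
  apply Submodule.eq_starProjection_of_mem_of_inner_eq_zero
  · exact ⟨pinv L Y, rfl⟩
  · rintro _ ⟨w, rfl⟩
    change ⟪Y - L (pinv L Y), L w⟫ = 0
    rw [← ContinuousLinearMap.adjoint_inner_left, map_sub, adjoint_apply_pinv hL, sub_self,
      inner_zero_left]

lemma pinv_eq_of_apply_eq {L : V →L[ℝ] U} (hL : Function.Injective L) {Y : U} {w : V}
    (h : L w = (LinearMap.range (L : V →ₗ[ℝ] U)).starProjection Y) : pinv L Y = w :=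
  hL ((apply_pinv hL Y).trans h.symm)

lemma pinv_comp_of_surjective {V' : Type*} [NormedAddCommGroup V'] [InnerProductSpace ℝ V']
    [FiniteDimensional ℝ V'] {L : V →L[ℝ] U} (hL : Function.Injective L) (S : V' →L[ℝ] V)
    (hS : Function.Bijective S) (Y : U) : S (pinv (L ∘L S) Y) = pinv L Y := by
  symm
  apply pinv_eq_of_apply_eq hL
  have h := apply_pinv (L := L ∘L S) (hL.comp hS.1) Y
  have hr : LinearMap.range ((L ∘L S : V' →L[ℝ] U) : V' →ₗ[ℝ] U)
      = LinearMap.range (L : V →ₗ[ℝ] U) := by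
    ext z
    constructor
    · rintro ⟨w, rfl⟩; exact ⟨S w, rfl⟩
    · rintro ⟨w, rfl⟩
      obtain ⟨w', rfl⟩ := hS.2 w
      exact ⟨w', rfl⟩
  calc L (S (pinv (L ∘L S) Y))
      = (LinearMap.range ((L ∘L S : V' →L[ℝ] U) : V' →ₗ[ℝ] U)).starProjection Y := h
    _ = (LinearMap.range (L : V →ₗ[ℝ] U)).starProjection Y := by simp only [hr]

lemma contDiff_adjoint {m : WithTop ℕ∞} :
    ContDiff ℝ m (fun L : V →L[ℝ] U => L.adjoint) := by
  let A : (V →L[ℝ] U) →ₗ[ℝ] (U →L[ℝ] V) :=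
    { toFun := fun L => L.adjoint
      map_add' := fun a b => map_add _ a b
      map_smul' := fun c a => by simp }
  exact (LinearMap.toContinuousLinearMap A).contDiff

lemma contDiffAt_pinv {L : V →L[ℝ] U} (hL : Function.Injective L) {m : WithTop ℕ∞} :
    ContDiffAt ℝ m (pinv : (V →L[ℝ] U) → (U →L[ℝ] V)) L := by
  have h1 : ContDiffAt ℝ m (fun L : V →L[ℝ] U => L.adjoint ∘L L) L :=
    (contDiff_adjoint.contDiffAt).clm_comp contDiffAt_id
  obtain ⟨u, hu⟩ := isUnit_adjoint_comp_self hL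
  have h2 : ContDiffAt ℝ m (Ring.inverse : (V →L[ℝ] V) → (V →L[ℝ] V)) (L.adjoint ∘L L) := by
    rw [← hu]; exact contDiffAt_ringInverse ℝ u
  exact (ContDiffAt.comp (g := Ring.inverse) (f := fun L : V →L[ℝ] U => L.adjoint ∘L L) L h2
    h1).clm_comp contDiff_adjoint.contDiffAt

end PseudoInverse

/-! ### Differentiation along an immersion -/

section AmbientDerivative

variable (k : ℕ) {n : ℕ} [NeZero k] {M : Type*} [TopologicalSpace M]
  [ChartedSpace (EuclideanHalfSpace k) M]
  {F F' F'' : Type*} [NormedAddCommGroup F] [NormedSpace ℝ F] [NormedAddCommGroup F']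
  [NormedSpace ℝ F'] [NormedAddCommGroup F''] [NormedSpace ℝ F'']

/-- The differential of a map into a normed space, as a linear map on the model space `ℝᵏ`. -/
def mdiff (f : M → F) (p : M) : E k →L[ℝ] F :=
  mfderiv (𝓡∂ k) 𝓘(ℝ, F) f p

/-- The derivative `Y ↦ D_{Y^⊤} f (p)` of a map `f` on `M` along the immersion `x`, as a linear map
on the ambient space that vanishes on normal vectors. -/
def ambDeriv (x : M → E n) (f : M → F) (p : M) : E n →L[ℝ] F :=
  mdiff k f p ∘L pinv (differential k x p)

/-- A smooth immersion into Euclidean space. -/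
structure IsSmoothImmersion (x : M → E n) : Prop where
  smooth : ContMDiff (𝓡∂ k) 𝓘(ℝ, E n) ∞ x
  immersion : ∀ p, Function.Injective (differential k x p)

/-- The coordinate representation of `f` in the preferred chart at `p`. -/
abbrev chartRep (f : M → F) (p : M) : E k → F := f ∘ (extChartAt (𝓡∂ k) p).symm

/-- The derivative of the coordinate representation of `f` in the preferred chart at `p`. -/
abbrev chartDeriv (f : M → F) (p : M) (y : E k) : E k →L[ℝ] F :=
  fderivWithin ℝ (chartRep k f p) (Set.range (𝓡∂ k)) y

variable {k}

lemma dirDeriv_eq_ambDeriv {x : M → E n} {p : M} (hx : Function.Injective (differential k x p))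
    (f : M → E n) (Y : E n) : dirDeriv k x f p Y = ambDeriv k x f p Y := by
  have h : (differential k x p : E k →ₗ[ℝ] E n).leftInverse (tangentPart k x p Y)
      = pinv (differential k x p) Y := by
    unfold tangentPart tangentPlane
    rw [← apply_pinv hx]
    exact LinearMap.leftInverse_apply_of_inj (LinearMap.ker_eq_bot.2 hx) _
  unfold dirDeriv
  rw [h]
  rfl

variable (k) in
lemma range_mem_iff {y : E k} : y ∈ Set.range (𝓡∂ k) ↔ 0 ≤ y 0 := by
  rw [range_modelWithCornersEuclideanHalfSpace]; rfl

variable {x : M → E n}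

lemma ambDeriv_const (c : F) (p : M) : ambDeriv k x (fun _ => c) p = 0 := by
  unfold ambDeriv mdiff
  rw [mfderiv_const]
  rfl

lemma ambDeriv_comp {g : F → F'} {f : M → F} {p : M} (hg : DifferentiableAt ℝ g (f p))
    (hf : MDifferentiableAt (𝓡∂ k) 𝓘(ℝ, F) f p) (Y : E n) :
    ambDeriv k x (fun q => g (f q)) p Y = fderiv ℝ g (f p) (ambDeriv k x f p Y) := by
  have h := mfderiv_comp (I := 𝓡∂ k) (I' := 𝓘(ℝ, F)) (I'' := 𝓘(ℝ, F')) p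
    hg.mdifferentiableAt hf
  rw [mfderiv_eq_fderiv] at h
  exact congrArg (fun T : E k →L[ℝ] F' => T (pinv (differential k x p) Y)) h

lemma ambDeriv_clm (B : F →L[ℝ] F') {f : M → F} {p : M}
    (hf : MDifferentiableAt (𝓡∂ k) 𝓘(ℝ, F) f p) (Y : E n) :
    ambDeriv k x (fun q => B (f q)) p Y = B (ambDeriv k x f p Y) := by
  rw [ambDeriv_comp B.differentiableAt hf, B.fderiv]

lemma ambDeriv_bilin (B : F →L[ℝ] F' →L[ℝ] F'') {f : M → F} {g : M → F'} {p : M}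
    (hf : MDifferentiableAt (𝓡∂ k) 𝓘(ℝ, F) f p) (hg : MDifferentiableAt (𝓡∂ k) 𝓘(ℝ, F') g p)
    (Y : E n) : ambDeriv k x (fun q => B (f q) (g q)) p Y
      = B (ambDeriv k x f p Y) (g p) + B (f p) (ambDeriv k x g p Y) := by
  have hfg := hf.prodMk_space hg
  have hB : DifferentiableAt ℝ (fun z : F × F' => B z.1 z.2) (f p, g p) :=
    B.isBoundedBilinearMap.differentiableAt _
  have h := ambDeriv_comp (x := x) (f := fun q => (f q, g q)) hB hfg Y
  have h1 : (ambDeriv k x (fun q => (f q, g q)) p Y).1 = ambDeriv k x f p Y :=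
    (ambDeriv_clm (x := x) (ContinuousLinearMap.fst ℝ F F') hfg Y).symm
  have h2 : (ambDeriv k x (fun q => (f q, g q)) p Y).2 = ambDeriv k x g p Y :=
    (ambDeriv_clm (x := x) (ContinuousLinearMap.snd ℝ F F') hfg Y).symm
  rw [h, B.isBoundedBilinearMap.fderiv]
  change B (f p) (ambDeriv k x (fun q => (f q, g q)) p Y).2
    + B (ambDeriv k x (fun q => (f q, g q)) p Y).1 (g p) = _
  rw [h1, h2, add_comm]

lemma ambDeriv_add {f g : M → F} {p : M} (hf : MDifferentiableAt (𝓡∂ k) 𝓘(ℝ, F) f p)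
    (hg : MDifferentiableAt (𝓡∂ k) 𝓘(ℝ, F) g p) (Y : E n) :
    ambDeriv k x (fun q => f q + g q) p Y = ambDeriv k x f p Y + ambDeriv k x g p Y := by
  have h := mfderiv_add hf hg
  exact congrArg (fun T : E k →L[ℝ] F => T (pinv (differential k x p) Y)) h

lemma ambDeriv_sub {f g : M → F} {p : M} (hf : MDifferentiableAt (𝓡∂ k) 𝓘(ℝ, F) f p)
    (hg : MDifferentiableAt (𝓡∂ k) 𝓘(ℝ, F) g p) (Y : E n) :
    ambDeriv k x (fun q => f q - g q) p Y = ambDeriv k x f p Y - ambDeriv k x g p Y := by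
  have h := mfderiv_sub hf hg
  exact congrArg (fun T : E k →L[ℝ] F => T (pinv (differential k x p) Y)) h

lemma chartDeriv_eq_target (f : M → F) (p : M) {y : E k}
    (hy : y ∈ (extChartAt (𝓡∂ k) p).target) :
    chartDeriv k f p y = fderivWithin ℝ (chartRep k f p) (extChartAt (𝓡∂ k) p).target y := by
  exact (fderivWithin_congr_set (extChartAt_target_eventuallyEq_of_mem hy)).symm

variable [IsManifold (𝓡∂ k) ∞ M]

variable (k) in
/-- The derivative of the inverse of the preferred chart at `p`, at a point `y` of its range. -/
def symmDeriv (p : M) (y : E k) : E k →L[ℝ] E k :=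
  mfderivWithin 𝓘(ℝ, E k) (𝓡∂ k) (extChartAt (𝓡∂ k) p).symm (Set.range (𝓡∂ k)) y

lemma symmDeriv_bijective (p : M) {y : E k} (hy : y ∈ (extChartAt (𝓡∂ k) p).target) :
    Function.Bijective (symmDeriv k p y) := by
  have : IsManifold (𝓡∂ k) 1 M := IsManifold.of_le (n := ∞) (by norm_num)
  exact (isInvertible_mfderivWithin_extChartAt_symm hy).bijective

lemma chartDeriv_eq_comp (p : M) {y : E k} (hy : y ∈ (extChartAt (𝓡∂ k) p).target) {f : M → F}
    (hf : MDifferentiableAt (𝓡∂ k) 𝓘(ℝ, F) f ((extChartAt (𝓡∂ k) p).symm y)) :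
    chartDeriv k f p y = mdiff k f ((extChartAt (𝓡∂ k) p).symm y) ∘L symmDeriv k p y := by
  have : IsManifold (𝓡∂ k) 1 M := IsManifold.of_le (n := ∞) (by norm_num)
  have hyr : y ∈ Set.range (𝓡∂ k) := extChartAt_target_subset_range p hy
  have h := mfderiv_comp_mfderivWithin (I := 𝓘(ℝ, E k)) (I' := 𝓡∂ k) (I'' := 𝓘(ℝ, F)) y hf
    ((mdifferentiableWithinAt_extChartAt_symm hy))
    (by
      rw [uniqueMDiffWithinAt_iff_uniqueDiffWithinAt]
      exact (𝓡∂ k).uniqueDiffOn y hyr)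
  rw [mfderivWithin_eq_fderivWithin] at h
  exact h

lemma IsSmoothImmersion.chartDeriv_injective (hx : IsSmoothImmersion k x) (p : M) {y : E k}
    (hy : y ∈ (extChartAt (𝓡∂ k) p).target) : Function.Injective (chartDeriv k x p y) := by
  rw [chartDeriv_eq_comp p hy (hx.smooth.mdifferentiableAt (by simp))]
  exact (hx.immersion _).comp (symmDeriv_bijective p hy).1

/-- The ambient derivative can be computed in any chart. -/
lemma IsSmoothImmersion.ambDeriv_eq (hx : IsSmoothImmersion k x) (p : M) {y : E k}
    (hy : y ∈ (extChartAt (𝓡∂ k) p).target) {f : M → F}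
    (hf : MDifferentiableAt (𝓡∂ k) 𝓘(ℝ, F) f ((extChartAt (𝓡∂ k) p).symm y)) :
    ambDeriv k x f ((extChartAt (𝓡∂ k) p).symm y)
      = chartDeriv k f p y ∘L pinv (chartDeriv k x p y) := by
  rw [chartDeriv_eq_comp p hy (hx.smooth.mdifferentiableAt (by simp)), chartDeriv_eq_comp p hy hf]
  ext Y
  have := pinv_comp_of_surjective (hx.immersion ((extChartAt (𝓡∂ k) p).symm y)) (symmDeriv k p y)
    (symmDeriv_bijective p hy) Y
  change mdiff k f _ (pinv _ Y) = mdiff k f _ (symmDeriv k p y (pinv _ Y))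
  rw [← this]
  rfl

lemma contDiffOn_chartRep {f : M → F} (hf : ContMDiff (𝓡∂ k) 𝓘(ℝ, F) ∞ f) (p : M) :
    ContDiffOn ℝ ∞ (chartRep k f p) (extChartAt (𝓡∂ k) p).target := by
  rw [← contMDiffOn_iff_contDiffOn]
  exact hf.comp_contMDiffOn (contMDiffOn_extChartAt_symm p)

lemma contDiffOn_chartDeriv {f : M → F} (hf : ContMDiff (𝓡∂ k) 𝓘(ℝ, F) ∞ f) (p : M) :
    ContDiffOn ℝ ∞ (chartDeriv k f p) (extChartAt (𝓡∂ k) p).target :=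
  ((contDiffOn_chartRep hf p).fderivWithin (uniqueDiffOn_extChartAt_target p)
    (m := ∞) (by simp)).congr fun _ hy => chartDeriv_eq_target f p hy

lemma IsSmoothImmersion.contDiffOn_pinv (hx : IsSmoothImmersion k x) (p : M) :
    ContDiffOn ℝ ∞ (fun y => pinv (chartDeriv k x p y)) (extChartAt (𝓡∂ k) p).target := by
  intro y hy
  exact (contDiffAt_pinv (hx.chartDeriv_injective p hy)).comp_contDiffWithinAt y
    (contDiffOn_chartDeriv hx.smooth p y hy)

lemma IsSmoothImmersion.contMDiff_ambDeriv (hx : IsSmoothImmersion k x) {f : M → F}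
    (hf : ContMDiff (𝓡∂ k) 𝓘(ℝ, F) ∞ f) :
    ContMDiff (𝓡∂ k) 𝓘(ℝ, E n →L[ℝ] F) ∞ (ambDeriv k x f) := by
  intro p
  have h1 : ContDiffOn ℝ ∞ (fun y => chartDeriv k f p y ∘L pinv (chartDeriv k x p y))
      (extChartAt (𝓡∂ k) p).target :=
    (contDiffOn_chartDeriv hf p).clm_comp (hx.contDiffOn_pinv p)
  have h2 : ContMDiffOn (𝓡∂ k) 𝓘(ℝ, E n →L[ℝ] F) ∞
      ((fun y => chartDeriv k f p y ∘L pinv (chartDeriv k x p y)) ∘ extChartAt (𝓡∂ k) p)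
      (chartAt (EuclideanHalfSpace k) p).source :=
    (contMDiffOn_iff_contDiffOn.2 h1).comp contMDiffOn_extChartAt (by
      intro q hq
      exact (extChartAt (𝓡∂ k) p).map_source (by rwa [extChartAt_source]))
  have h3 := h2.contMDiffAt ((chartAt (EuclideanHalfSpace k) p).open_source.mem_nhds
    (mem_chart_source _ p))
  refine h3.congr_of_eventuallyEq ?_
  filter_upwards [(chartAt (EuclideanHalfSpace k) p).open_source.mem_nhds
    (mem_chart_source _ p)] with q hq
  have hq' : q ∈ (extChartAt (𝓡∂ k) p).source := by rwa [extChartAt_source]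
  have h := hx.ambDeriv_eq p ((extChartAt (𝓡∂ k) p).map_source hq') (f := f)
    (hf.mdifferentiableAt (by simp))
  rw [(extChartAt (𝓡∂ k) p).left_inv hq'] at h
  exact h

end AmbientDerivative

/-! ### The tangential projection and commutation of derivatives -/

section TangentProjection

variable (k : ℕ) {n : ℕ} [NeZero k] {M : Type*} [TopologicalSpace M]
  [ChartedSpace (EuclideanHalfSpace k) M]
  {F : Type*} [NormedAddCommGroup F] [NormedSpace ℝ F]

/-- The field of tangential projections: it is the derivative of the immersion along itself, hence
smooth. -/
def tangProj (x : M → E n) : M → E n →L[ℝ] E n := ambDeriv k x x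

variable {k} {x : M → E n}

lemma tangProj_apply {p : M} (hx : Function.Injective (differential k x p)) (Y : E n) :
    tangProj k x p Y = tangentPart k x p Y :=
  apply_pinv hx Y

lemma tangProj_mem {p : M} (hx : Function.Injective (differential k x p)) (Y : E n) :
    tangProj k x p Y ∈ tangentPlane k x p := by
  rw [tangProj_apply hx]
  exact Submodule.starProjection_apply_mem _ _

lemma tangProj_eq_self {p : M} (hx : Function.Injective (differential k x p)) {Y : E n}
    (hY : Y ∈ tangentPlane k x p) : tangProj k x p Y = Y := by
  rw [tangProj_apply hx]
  exact Submodule.starProjection_eq_self_iff.2 hY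

lemma tangProj_idem {p : M} (hx : Function.Injective (differential k x p)) (Y : E n) :
    tangProj k x p (tangProj k x p Y) = tangProj k x p Y :=
  tangProj_eq_self hx (tangProj_mem hx Y)

lemma inner_tangProj {p : M} (hx : Function.Injective (differential k x p)) (Y Z : E n) :
    ⟪tangProj k x p Y, Z⟫ = ⟪Y, tangProj k x p Z⟫ := by
  rw [tangProj_apply hx, tangProj_apply hx]
  exact Submodule.inner_starProjection_left_eq_right _ _ _

lemma normalPart_eq {p : M} (hx : Function.Injective (differential k x p)) (Y : E n) :
    normalPart k x p Y = Y - tangProj k x p Y := by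
  rw [tangProj_apply hx]
  unfold normalPart tangentPart
  exact congrArg (fun T : E n →L[ℝ] E n => T Y) (Submodule.starProjection_orthogonal _)

lemma tangProj_eq_zero {p : M} (hx : Function.Injective (differential k x p)) {Y : E n}
    (hY : Y ∈ (tangentPlane k x p)ᗮ) : tangProj k x p Y = 0 := by
  rw [tangProj_apply hx]
  exact (Submodule.starProjection_apply_eq_zero_iff _).2 hY

lemma ambDeriv_tangProj {p : M} (hx : Function.Injective (differential k x p)) (f : M → F)
    (Y : E n) : ambDeriv k x f p (tangProj k x p Y) = ambDeriv k x f p Y := by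
  have : pinv (differential k x p) (differential k x p (pinv (differential k x p) Y))
      = pinv (differential k x p) Y := pinv_apply_self hx _
  exact congrArg (mdiff k f p) this

variable [IsManifold (𝓡∂ k) ∞ M]

lemma IsSmoothImmersion.contMDiff_tangProj (hx : IsSmoothImmersion k x) :
    ContMDiff (𝓡∂ k) 𝓘(ℝ, E n →L[ℝ] E n) ∞ (tangProj k x) :=
  hx.contMDiff_ambDeriv hx.smooth

/-- The second derivative along the immersion in a chart. -/
lemma IsSmoothImmersion.ambDeriv_ambDeriv_eq (hx : IsSmoothImmersion k x) {f : M → F}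
    (hf : ContMDiff (𝓡∂ k) 𝓘(ℝ, F) ∞ f) (p : M) {y : E k}
    (hy : y ∈ (extChartAt (𝓡∂ k) p).target) (Y₁ Y₂ : E n) :
    ambDeriv k x (ambDeriv k x f) ((extChartAt (𝓡∂ k) p).symm y) Y₁ Y₂ =
      fderivWithin ℝ (chartDeriv k f p) (extChartAt (𝓡∂ k) p).target y
          (pinv (chartDeriv k x p y) Y₁) (pinv (chartDeriv k x p y) Y₂)
      + chartDeriv k f p y
          (fderivWithin ℝ (fun z => pinv (chartDeriv k x p z)) (extChartAt (𝓡∂ k) p).target y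
            (pinv (chartDeriv k x p y) Y₁) Y₂) := by
  have hu := uniqueDiffOn_extChartAt_target (I := 𝓡∂ k) p y hy
  rw [hx.ambDeriv_eq p hy ((hx.contMDiff_ambDeriv hf).mdifferentiableAt (by simp)),
    ContinuousLinearMap.comp_apply, chartDeriv_eq_target _ p hy]
  have hc : fderivWithin ℝ (chartRep k (ambDeriv k x f) p) (extChartAt (𝓡∂ k) p).target y
      = fderivWithin ℝ (fun z => chartDeriv k f p z ∘L pinv (chartDeriv k x p z))
          (extChartAt (𝓡∂ k) p).target y :=
    fderivWithin_congr (fun z hz => hx.ambDeriv_eq p hz (hf.mdifferentiableAt (by simp)))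
      (hx.ambDeriv_eq p hy (hf.mdifferentiableAt (by simp)))
  rw [hc, fderivWithin_clm_comp hu ((contDiffOn_chartDeriv hf p).differentiableOn (by simp) y hy)
    ((hx.contDiffOn_pinv p).differentiableOn (by simp) y hy)]
  exact add_comm _ _

lemma fderivWithin_chartDeriv_symm {f : M → F} (hf : ContMDiff (𝓡∂ k) 𝓘(ℝ, F) ∞ f) (p : M)
    {y : E k} (hy : y ∈ (extChartAt (𝓡∂ k) p).target) (u w : E k) :
    fderivWithin ℝ (chartDeriv k f p) (extChartAt (𝓡∂ k) p).target y u w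
      = fderivWithin ℝ (chartDeriv k f p) (extChartAt (𝓡∂ k) p).target y w u := by
  have h := (contDiffOn_chartRep hf p y hy).isSymmSndFDerivWithinAt
    (by simpa using WithTop.coe_le_coe.2 (OrderTop.le_top (2 : ℕ∞)))
    (uniqueDiffOn_extChartAt_target p) (extChartAt_target_subset_closure_interior hy) hy
  have hc : fderivWithin ℝ (chartDeriv k f p) (extChartAt (𝓡∂ k) p).target y
      = fderivWithin ℝ (fun z => fderivWithin ℝ (chartRep k f p) (extChartAt (𝓡∂ k) p).target z)
          (extChartAt (𝓡∂ k) p).target y :=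
    fderivWithin_congr (fun z hz => chartDeriv_eq_target f p hz) (chartDeriv_eq_target f p hy)
  rw [hc]
  exact h u w

/-- The two orders of differentiation along constant vectors `Y₁`, `Y₂` differ by the derivative
along the Lie bracket of the tangent fields `Y₁^⊤`, `Y₂^⊤`. -/
lemma IsSmoothImmersion.ambDeriv_comm (hx : IsSmoothImmersion k x) {f : M → F}
    (hf : ContMDiff (𝓡∂ k) 𝓘(ℝ, F) ∞ f) (p : M) (Y₁ Y₂ : E n) :
    ambDeriv k x (ambDeriv k x f) p Y₁ Y₂ - ambDeriv k x (ambDeriv k x f) p Y₂ Y₁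
      = ambDeriv k x f p (ambDeriv k x (tangProj k x) p Y₁ Y₂
          - ambDeriv k x (tangProj k x) p Y₂ Y₁) := by
  have hy := mem_extChartAt_target (I := 𝓡∂ k) p
  have hp : (extChartAt (𝓡∂ k) p).symm (extChartAt (𝓡∂ k) p p) = p :=
    extChartAt_to_inv (I := 𝓡∂ k) p
  have h1 := hx.ambDeriv_ambDeriv_eq hf p hy Y₁ Y₂
  have h2 := hx.ambDeriv_ambDeriv_eq hf p hy Y₂ Y₁
  have h3 := hx.ambDeriv_ambDeriv_eq hx.smooth p hy Y₁ Y₂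
  have h4 := hx.ambDeriv_ambDeriv_eq hx.smooth p hy Y₂ Y₁
  have h5 := hx.ambDeriv_eq p hy (f := f) (hf.mdifferentiableAt (by simp))
  rw [hp] at h1 h2 h3 h4 h5
  unfold tangProj
  rw [h1, h2, h3, h4, h5, fderivWithin_chartDeriv_symm hf p hy,
    fderivWithin_chartDeriv_symm hx.smooth p hy, add_sub_add_left_eq_sub, add_sub_add_left_eq_sub,
    ← map_sub, ← map_sub, ContinuousLinearMap.comp_apply,
    pinv_apply_self (hx.chartDeriv_injective p hy)]

end TangentProjection

/-! ### The second fundamental form in terms of the tangential projection -/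

section Pointwise

variable {k : ℕ} {n : ℕ} [NeZero k] {M : Type*} [TopologicalSpace M]
  [ChartedSpace (EuclideanHalfSpace k) M]
  {F F' : Type*} [NormedAddCommGroup F] [NormedSpace ℝ F] [NormedAddCommGroup F'] [NormedSpace ℝ F']
  {x : M → E n}

lemma ambDeriv_clm_apply {A : M → F →L[ℝ] F'} {f : M → F} {p : M}
    (hA : MDifferentiableAt (𝓡∂ k) 𝓘(ℝ, F →L[ℝ] F') A p)
    (hf : MDifferentiableAt (𝓡∂ k) 𝓘(ℝ, F) f p) (Y : E n) :
    ambDeriv k x (fun q => A q (f q)) p Y = ambDeriv k x A p Y (f p) + A p (ambDeriv k x f p Y) :=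
  ambDeriv_bilin (ContinuousLinearMap.id ℝ (F →L[ℝ] F')) hA hf Y

lemma ambDeriv_clm_apply_const {A : M → F →L[ℝ] F'} {p : M}
    (hA : MDifferentiableAt (𝓡∂ k) 𝓘(ℝ, F →L[ℝ] F') A p) (z : F) (Y : E n) :
    ambDeriv k x (fun q => A q z) p Y = ambDeriv k x A p Y z :=
  ambDeriv_clm (ContinuousLinearMap.apply ℝ F' z) hA Y

lemma ambDeriv_inner {f g : M → E n} {p : M} (hf : MDifferentiableAt (𝓡∂ k) 𝓘(ℝ, E n) f p)
    (hg : MDifferentiableAt (𝓡∂ k) 𝓘(ℝ, E n) g p) (Y : E n) :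
    ambDeriv k x (fun q => ⟪f q, g q⟫) p Y
      = ⟪ambDeriv k x f p Y, g p⟫ + ⟪f p, ambDeriv k x g p Y⟫ :=
  ambDeriv_bilin (innerSL ℝ) hf hg Y

lemma ambDeriv_smul {f : M → ℝ} {g : M → F} {p : M} (hf : MDifferentiableAt (𝓡∂ k) 𝓘(ℝ, ℝ) f p)
    (hg : MDifferentiableAt (𝓡∂ k) 𝓘(ℝ, F) g p) (Y : E n) :
    ambDeriv k x (fun q => f q • g q) p Y = ambDeriv k x f p Y • g p + f p • ambDeriv k x g p Y :=
  ambDeriv_bilin (ContinuousLinearMap.lsmul ℝ ℝ) hf hg Y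

lemma mdiffAt_add {f g : M → F} {p : M} (hf : MDifferentiableAt (𝓡∂ k) 𝓘(ℝ, F) f p)
    (hg : MDifferentiableAt (𝓡∂ k) 𝓘(ℝ, F) g p) :
    MDifferentiableAt (𝓡∂ k) 𝓘(ℝ, F) (fun q => f q + g q) p := hf.add hg

lemma mdiffAt_sub {f g : M → F} {p : M} (hf : MDifferentiableAt (𝓡∂ k) 𝓘(ℝ, F) f p)
    (hg : MDifferentiableAt (𝓡∂ k) 𝓘(ℝ, F) g p) :
    MDifferentiableAt (𝓡∂ k) 𝓘(ℝ, F) (fun q => f q - g q) p := hf.sub hg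

lemma mdiffAt_smul {f : M → ℝ} {g : M → F} {p : M} (hf : MDifferentiableAt (𝓡∂ k) 𝓘(ℝ, ℝ) f p)
    (hg : MDifferentiableAt (𝓡∂ k) 𝓘(ℝ, F) g p) :
    MDifferentiableAt (𝓡∂ k) 𝓘(ℝ, F) (fun q => f q • g q) p := hf.smul hg

/-- The standard basis of `ℝⁿ`. -/
abbrev stdBasis (n : ℕ) (a : Fin n) : E n := EuclideanSpace.basisFun (Fin n) ℝ a

lemma sum_inner_smul_frame (p : M) (hx : Function.Injective (differential k x p)) (Y : E n) :
    ∑ i, ⟪frame k x p i, Y⟫ • frame k x p i = tangProj k x p Y := by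
  have h := (stdOrthonormalBasis ℝ (tangentPlane k x p)).sum_repr'
    ((tangentPlane k x p).orthogonalProjectionOnto Y)
  have h2 := congrArg (Submodule.subtype _) h
  rw [map_sum] at h2
  rw [tangProj_apply hx]
  refine Eq.trans (Finset.sum_congr rfl fun i _ => ?_) h2
  rw [map_smul]
  congr 1
  exact ((tangentPlane k x p).inner_orthogonalProjectionOnto_eq_of_mem_left
    (stdOrthonormalBasis ℝ (tangentPlane k x p) i) Y).symm

lemma frame_mem (p : M) (i : Fin (Module.finrank ℝ (tangentPlane k x p))) :
    frame k x p i ∈ tangentPlane k x p :=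
  (stdOrthonormalBasis ℝ (tangentPlane k x p) i).2

/-- A bilinear expression whose first slot only sees the tangential part has the same trace over an
orthonormal frame of the tangent space and over the standard basis of the ambient space. -/
lemma sum_frame_eq (p : M) (hx : Function.Injective (differential k x p))
    (B : E n →ₗ[ℝ] E n →ₗ[ℝ] F) (hB : ∀ Y Z, B (tangProj k x p Y) Z = B Y Z) :
    ∑ i, B (frame k x p i) (frame k x p i) = ∑ a, B (stdBasis n a) (stdBasis n a) := by
  have h : ∀ i, B (frame k x p i) (frame k x p i)
      = ∑ a, ⟪stdBasis n a, frame k x p i⟫ • B (frame k x p i) (stdBasis n a) := by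
    intro i
    conv_lhs => arg 2; rw [← (EuclideanSpace.basisFun (Fin n) ℝ).sum_repr' (frame k x p i)]
    rw [map_sum]
    exact Finset.sum_congr rfl fun a _ => by rw [map_smul]
  simp_rw [h]
  rw [Finset.sum_comm]
  refine Finset.sum_congr rfl fun a _ => ?_
  rw [← hB, ← sum_inner_smul_frame p hx, map_sum, LinearMap.sum_apply]
  exact Finset.sum_congr rfl fun i _ => by
    rw [map_smul, LinearMap.smul_apply, real_inner_comm]

variable [IsManifold (𝓡∂ k) ∞ M]

section Projection

variable (hx : IsSmoothImmersion k x) (p : M)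
include hx

lemma IsSmoothImmersion.mdiff_tangProj :
    MDifferentiableAt (𝓡∂ k) 𝓘(ℝ, E n →L[ℝ] E n) (tangProj k x) p :=
  hx.contMDiff_tangProj.mdifferentiableAt (by simp)

lemma IsSmoothImmersion.mdiff_dtangProj :
    MDifferentiableAt (𝓡∂ k) 𝓘(ℝ, E n →L[ℝ] E n →L[ℝ] E n) (ambDeriv k x (tangProj k x)) p :=
  (hx.contMDiff_ambDeriv hx.contMDiff_tangProj).mdifferentiableAt (by simp)

/-- The derivative of the identity `P P = P` for the tangential projection `P`. It says that
the derivative of `P` exchanges tangent and normal vectors. -/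
lemma IsSmoothImmersion.dtangProj_add (Y Z : E n) :
    ambDeriv k x (tangProj k x) p Y (tangProj k x p Z)
      + tangProj k x p (ambDeriv k x (tangProj k x) p Y Z)
      = ambDeriv k x (tangProj k x) p Y Z := by
  have hP := hx.mdiff_tangProj p
  have h := ambDeriv_clm_apply (x := x) hP
    (hP.clm_apply (mdifferentiableAt_const (c := Z))) Y
  rw [ambDeriv_clm_apply_const hP] at h
  rw [← h, ← ambDeriv_clm_apply_const hP]
  congr 2
  funext q
  exact tangProj_idem (hx.immersion q) Z

lemma IsSmoothImmersion.tangProj_dtangProj_tangProj (Y Z : E n) :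
    tangProj k x p (ambDeriv k x (tangProj k x) p Y (tangProj k x p Z)) = 0 := by
  have h := hx.dtangProj_add p Y (tangProj k x p Z)
  rw [tangProj_idem (hx.immersion p)] at h
  exact add_eq_left.1 h

lemma IsSmoothImmersion.inner_dtangProj (Y Z₁ Z₂ : E n) :
    ⟪ambDeriv k x (tangProj k x) p Y Z₁, Z₂⟫ = ⟪Z₁, ambDeriv k x (tangProj k x) p Y Z₂⟫ := by
  have hP := hx.mdiff_tangProj p
  have hc : ∀ Z : E n, MDifferentiableAt (𝓡∂ k) 𝓘(ℝ, E n) (fun _ : M => Z) p :=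
    fun Z => mdifferentiableAt_const
  have h1 := ambDeriv_inner (x := x) (hP.clm_apply (hc Z₁)) (hc Z₂) Y
  have h2 := ambDeriv_inner (x := x) (hc Z₁) (hP.clm_apply (hc Z₂)) Y
  rw [ambDeriv_clm_apply_const hP, ambDeriv_const] at h1 h2
  simp only [zero_apply, inner_zero_left, inner_zero_right, add_zero,
    zero_add] at h1 h2
  rw [← h1, ← h2]
  congr 2
  funext q
  exact inner_tangProj (hx.immersion q) _ _

lemma IsSmoothImmersion.inner_ddtangProj (Y₁ Y₂ Z₁ Z₂ : E n) :
    ⟪ambDeriv k x (ambDeriv k x (tangProj k x)) p Y₁ Y₂ Z₁, Z₂⟫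
      = ⟪Z₁, ambDeriv k x (ambDeriv k x (tangProj k x)) p Y₁ Y₂ Z₂⟫ := by
  have hc : ∀ Z : E n, MDifferentiableAt (𝓡∂ k) 𝓘(ℝ, E n) (fun _ : M => Z) p :=
    fun Z => mdifferentiableAt_const
  have hDP := (hx.mdiff_dtangProj p).clm_apply (hc Y₂)
  have h1 := ambDeriv_inner (x := x) (hDP.clm_apply (hc Z₁)) (hc Z₂) Y₁
  have h2 := ambDeriv_inner (x := x) (hc Z₁) (hDP.clm_apply (hc Z₂)) Y₁
  rw [ambDeriv_clm_apply_const hDP, ambDeriv_clm_apply_const (hx.mdiff_dtangProj p),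
    ambDeriv_const] at h1 h2
  simp only [zero_apply, inner_zero_left, inner_zero_right, add_zero, zero_add] at h1 h2
  rw [← h1, ← h2]
  congr 2
  funext q
  exact hx.inner_dtangProj q _ _ _

/-- The Lie bracket of the tangent fields `Y₁^⊤` and `Y₂^⊤` is tangential. -/
lemma IsSmoothImmersion.tangProj_bracket (Y₁ Y₂ : E n) :
    tangProj k x p (ambDeriv k x (tangProj k x) p Y₁ Y₂ - ambDeriv k x (tangProj k x) p Y₂ Y₁)
      = ambDeriv k x (tangProj k x) p Y₁ Y₂ - ambDeriv k x (tangProj k x) p Y₂ Y₁ :=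
  (hx.ambDeriv_comm hx.smooth p Y₁ Y₂).symm

lemma IsSmoothImmersion.dtangProj_tangProj (Y Z : E n) :
    ambDeriv k x (tangProj k x) p Y (tangProj k x p Z)
      = ambDeriv k x (tangProj k x) p Y Z
        - tangProj k x p (ambDeriv k x (tangProj k x) p Y Z) :=
  eq_sub_of_add_eq (hx.dtangProj_add p Y Z)

/-- The symmetry of the second fundamental form. -/
lemma IsSmoothImmersion.dtangProj_symm (Y₁ Y₂ : E n) :
    ambDeriv k x (tangProj k x) p Y₁ (tangProj k x p Y₂)
      = ambDeriv k x (tangProj k x) p Y₂ (tangProj k x p Y₁) := by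
  have h := hx.tangProj_bracket p Y₁ Y₂
  rw [map_sub] at h
  rw [hx.dtangProj_tangProj, hx.dtangProj_tangProj]
  exact sub_eq_sub_iff_sub_eq_sub.2 h.symm

omit [IsManifold (𝓡∂ k) ∞ M] in
lemma IsSmoothImmersion.dtangProj_tang_left (Y Z : E n) :
    ambDeriv k x (tangProj k x) p (tangProj k x p Y) Z = ambDeriv k x (tangProj k x) p Y Z := by
  rw [ambDeriv_tangProj (hx.immersion p)]

lemma IsSmoothImmersion.tangProj_dtangProj_normal (Y : E n) {Z : E n}
    (hZ : tangProj k x p Z = 0) :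
    tangProj k x p (ambDeriv k x (tangProj k x) p Y Z) = ambDeriv k x (tangProj k x) p Y Z := by
  have h := hx.dtangProj_add p Y Z
  rwa [hZ, map_zero, zero_add] at h

/-- On tangent vectors, the derivative of the tangential projection is the second fundamental form.
-/
lemma IsSmoothImmersion.secondFF_eq (Y : E n) {Z : E n} (hZ : Z ∈ tangentPlane k x p) :
    secondFF k x p Y Z = ambDeriv k x (tangProj k x) p Y Z := by
  unfold secondFF
  rw [dirDeriv_eq_ambDeriv (hx.immersion p), normalPart_eq (hx.immersion p)]
  have h : (fun q => tangentPart k x q Z) = fun q => tangProj k x q Z := by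
    funext q; exact (tangProj_apply (hx.immersion q) Z).symm
  rw [h, ambDeriv_clm_apply_const (hx.mdiff_tangProj p), ← hx.dtangProj_tangProj,
    tangProj_eq_self (hx.immersion p) hZ]

omit [IsManifold (𝓡∂ k) ∞ M] in
lemma IsSmoothImmersion.tangProj_frame (i : Fin (Module.finrank ℝ (tangentPlane k x p))) :
    tangProj k x p (frame k x p i) = frame k x p i :=
  tangProj_eq_self (hx.immersion p) (frame_mem p i)

/-- Minimality, as the vanishing of the divergence of the tangential projection. -/
lemma IsSmoothImmersion.sum_dtangProj (hmin : IsMinimal k x) :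
    ∑ a, ambDeriv k x (tangProj k x) p (stdBasis n a) (stdBasis n a) = 0 := by
  let B : E n →ₗ[ℝ] E n →ₗ[ℝ] E n :=
    LinearMap.mk₂ ℝ (fun Y Z => ambDeriv k x (tangProj k x) p Y Z)
      (by simp) (by simp) (by simp) (by simp)
  have h := sum_frame_eq p (hx.immersion p) B (fun Y Z => hx.dtangProj_tang_left p Y Z)
  refine Eq.trans h.symm (Eq.trans (Finset.sum_congr rfl fun i _ => ?_) (hmin p))
  exact (hx.secondFF_eq p _ (frame_mem p i)).symm

/-- The contracted Codazzi equation of a minimal immersion: the Laplacian of the tangential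
projection maps tangent vectors to tangent vectors. -/
lemma IsSmoothImmersion.codazzi (hmin : IsMinimal k x) {y : E n} (hy : tangProj k x p y = y) :
    tangProj k x p (∑ a, ambDeriv k x (ambDeriv k x (tangProj k x)) p (stdBasis n a)
        (stdBasis n a) y)
      = ∑ a, ambDeriv k x (ambDeriv k x (tangProj k x)) p (stdBasis n a) (stdBasis n a) y := by
  have hP := hx.mdiff_tangProj p
  have hDP := hx.mdiff_dtangProj p
  set P := tangProj k x p with hPdef
  set P' := ambDeriv k x (tangProj k x) p with hP'def
  set P'' := ambDeriv k x (ambDeriv k x (tangProj k x)) p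
  have hc : ∀ Z : E n, MDifferentiableAt (𝓡∂ k) 𝓘(ℝ, E n) (fun _ : M => Z) p :=
    fun Z => mdifferentiableAt_const
  -- `T a` is the bracket of the fields `a^⊤` and `y^⊤`.
  let T : E n → E n := fun a => P' a y - P' y a
  have hT : ∀ a, P (T a) = T a := fun a => hx.tangProj_bracket p a y
  have hdT : ∀ a, P'' a a y - P'' a y a
      = P' a (T a) + P (P'' a a y - P'' a y a) := by
    intro a
    have hTd : MDifferentiableAt (𝓡∂ k) 𝓘(ℝ, E n)
        (fun q => ambDeriv k x (tangProj k x) q a y - ambDeriv k x (tangProj k x) q y a) p :=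
      ((hDP.clm_apply (hc a)).clm_apply (hc y)).sub ((hDP.clm_apply (hc y)).clm_apply (hc a))
    have hd : ambDeriv k x (fun q => ambDeriv k x (tangProj k x) q a y
        - ambDeriv k x (tangProj k x) q y a) p a = P'' a a y - P'' a y a := by
      rw [ambDeriv_sub ((hDP.clm_apply (hc a)).clm_apply (hc y))
        ((hDP.clm_apply (hc y)).clm_apply (hc a)),
        ambDeriv_clm_apply_const (hDP.clm_apply (hc a)),
        ambDeriv_clm_apply_const (hDP.clm_apply (hc y)), ambDeriv_clm_apply_const hDP,
        ambDeriv_clm_apply_const hDP]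
    have h := ambDeriv_clm_apply (x := x) hP hTd a
    rw [hd] at h
    rw [← h, ← hd]
    congr 2
    funext q
    exact (hx.tangProj_bracket q a y).symm
  have hcomm : ∀ a, P'' a y a - P'' y a a = P' (T a) a := by
    intro a
    have h := hx.ambDeriv_comm hx.contMDiff_tangProj p a y
    have := congrArg (fun L : E n →L[ℝ] E n => L a) h
    exact this
  have hmin' : ∑ a, P'' y (stdBasis n a) (stdBasis n a) = 0 := by
    have h0 : ambDeriv k x (fun q => ∑ a, ambDeriv k x (tangProj k x) q (stdBasis n a)
        (stdBasis n a)) p y = 0 := by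
      have : (fun q => ∑ a, ambDeriv k x (tangProj k x) q (stdBasis n a)
        (stdBasis n a)) = fun _ => 0 := by
        funext q; exact hx.sum_dtangProj q hmin
      rw [this, ambDeriv_const]; rfl
    have h1 := ambDeriv_clm (x := x) (∑ a, (ContinuousLinearMap.apply ℝ (E n) (stdBasis n a)) ∘L
      (ContinuousLinearMap.apply ℝ (E n →L[ℝ] E n) (stdBasis n a))) hDP y
    simp only [sum_apply, ContinuousLinearMap.comp_apply,
      ContinuousLinearMap.apply_apply] at h1
    rw [← h1]; exact h0
  -- the normal part of each summand
  have hN : ∀ a, P'' a a y - P (P'' a a y)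
      = (P'' y a a - P (P'' y a a)) + (2 : ℝ) • P' a (T a) := by
    intro a
    have e1 := hdT a
    have e2 := hcomm a
    have e3 : P' (T a) a - P (P' (T a) a) = P' a (T a) := by
      rw [← hx.dtangProj_tangProj p (T a) a, hx.dtangProj_symm, hT a]
    have e4 : P'' a y a = P'' y a a + P' (T a) a := by rw [← e2]; abel
    rw [e4] at e1
    simp only [map_sub, map_add] at e1
    rw [two_smul]
    nth_rewrite 1 [← e3]
    have e5 : P'' a a y = (P'' y a a + P' (T a) a) + (P' a (T a)
      + (P (P'' a a y) - (P (P'' y a a) + P (P' (T a) a)))) := by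
      rw [← e1]; abel
    nth_rewrite 1 [e5]
    abel
  -- over a tangent frame the summands vanish: `T a = 0` for tangent vectors `a`, by the symmetry of
  -- the second fundamental form
  have hzero : ∑ a, P' (stdBasis n a) (T (stdBasis n a)) = 0 := by
    let B : E n →ₗ[ℝ] E n →ₗ[ℝ] E n :=
      LinearMap.mk₂ ℝ (fun Y Z => P' Y (P' Z y - P' y Z))
        (by simp) (by simp)
        (fun Y Z₁ Z₂ => by
          rw [← map_add]; congr 1; simp only [map_add, add_apply]; abel)
        (fun c Y Z => by
          rw [← map_smul]; congr 1
          simp only [map_smul, smul_apply, smul_sub])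
    have h := sum_frame_eq p (hx.immersion p) B (fun Y Z => hx.dtangProj_tang_left p Y _)
    refine Eq.trans h.symm (Finset.sum_eq_zero fun i _ => ?_)
    change P' (frame k x p i) (P' (frame k x p i) y - P' y (frame k x p i)) = 0
    have e := hx.dtangProj_symm p (frame k x p i) y
    rw [hx.tangProj_frame, ← hPdef, hy] at e
    rw [hP'def, e, sub_self, map_zero]
  have hsum : (∑ a, P'' (stdBasis n a) (stdBasis n a) y)
      - P (∑ a, P'' (stdBasis n a) (stdBasis n a) y) = 0 := by
    rw [map_sum, ← Finset.sum_sub_distrib]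
    simp_rw [hN]
    rw [Finset.sum_add_distrib, Finset.sum_sub_distrib, ← map_sum, hmin', ← Finset.smul_sum, hzero]
    simp
  exact (sub_eq_zero.1 hsum).symm

end Projection

end Pointwise

/-! ### The stability operator and the index form in ambient terms -/

section NormalFields

variable {k : ℕ} {n : ℕ} [NeZero k] {M : Type*} [TopologicalSpace M]
  [ChartedSpace (EuclideanHalfSpace k) M] {x : M → E n}

lemma inner_sub_tangProj {p : M} (hx : Function.Injective (differential k x p)) (Y Z : E n) :
    ⟪Y - tangProj k x p Y, Z - tangProj k x p Z⟫ = ⟪Y - tangProj k x p Y, Z⟫ := by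
  rw [inner_sub_right _ Z, sub_eq_self, ← inner_tangProj hx, map_sub, tangProj_idem hx, sub_self,
    inner_zero_left]

variable [IsManifold (𝓡∂ k) ∞ M]

variable (hx : IsSmoothImmersion k x) {W : M → E n} (hW : IsNormalField k x W) (p : M)
include hx

lemma IsSmoothImmersion.isNormalField (v : E n) :
    IsNormalField k x (fun p => normalPart k x p v) := by
  refine ⟨?_, fun p => Submodule.starProjection_apply_mem _ _⟩
  have h : (fun p => normalPart k x p v) = fun p => v - tangProj k x p v := by
    funext p; exact normalPart_eq (hx.immersion p) v
  rw [h]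
  exact contMDiff_const.sub (hx.contMDiff_tangProj.clm_apply contMDiff_const)

include hW

omit [IsManifold (𝓡∂ k) ∞ M] in
lemma IsSmoothImmersion.tangProj_normal : tangProj k x p (W p) = 0 :=
  tangProj_eq_zero (hx.immersion p) (hW.normal p)

lemma IsSmoothImmersion.tangProj_dnormal (Y : E n) :
    tangProj k x p (ambDeriv k x W p Y) = -ambDeriv k x (tangProj k x) p Y (W p) := by
  have hWd := hW.smooth.mdifferentiableAt (x := p) (by simp)
  have h := ambDeriv_clm_apply (x := x) (hx.mdiff_tangProj p) hWd Y
  have h0 : (fun q => tangProj k x q (W q)) = fun _ => 0 := by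
    funext q; exact hx.tangProj_normal hW q
  rw [h0, ambDeriv_const] at h
  exact (neg_eq_of_add_eq_zero_right h.symm).symm

/-- The tangential part of the second derivative of a normal field. -/
lemma IsSmoothImmersion.tangProj_ddnormal (Y : E n) :
    tangProj k x p (ambDeriv k x (ambDeriv k x W) p Y Y)
      = -ambDeriv k x (ambDeriv k x (tangProj k x)) p Y Y (W p)
        - (2 : ℝ) • ambDeriv k x (tangProj k x) p Y (ambDeriv k x W p Y) := by
  have hWd := hW.smooth.mdifferentiableAt (x := p) (by simp)
  have hDW := (hx.contMDiff_ambDeriv hW.smooth).mdifferentiableAt (x := p) (by simp)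
  have hP := hx.mdiff_tangProj p
  have hDP := hx.mdiff_dtangProj p
  have hY : MDifferentiableAt (𝓡∂ k) 𝓘(ℝ, E n) (fun _ : M => Y) p := mdifferentiableAt_const
  have h1 := ambDeriv_clm_apply (x := x) hP (hDW.clm_apply hY) Y
  have h2 := ambDeriv_clm_apply (x := x) (hDP.clm_apply hY) hWd Y
  rw [ambDeriv_clm_apply_const hDW] at h1
  rw [ambDeriv_clm_apply_const hDP] at h2
  have h3 : (fun q => tangProj k x q (ambDeriv k x W q Y))
      = fun q => 0 - ambDeriv k x (tangProj k x) q Y (W q) := by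
    funext q; rw [hx.tangProj_dnormal hW, zero_sub]
  rw [h3, ambDeriv_sub mdifferentiableAt_const ((hDP.clm_apply hY).clm_apply hWd), ambDeriv_const,
    h2] at h1
  rw [eq_sub_of_add_eq' h1.symm, two_smul, zero_apply]
  abel

omit [IsManifold (𝓡∂ k) ∞ M] hW in
lemma IsSmoothImmersion.normalDeriv_eq (Y : E n) :
    normalDeriv k x W p Y = ambDeriv k x W p Y - tangProj k x p (ambDeriv k x W p Y) := by
  unfold normalDeriv
  rw [dirDeriv_eq_ambDeriv (hx.immersion p), normalPart_eq (hx.immersion p)]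

/-- The normal Laplacian in ambient terms. The fields `q ↦ e_i^⊤(q)` extending the frame satisfy
`(D_{e_i} e_i)^⊤ = 0` at `p`, so that the second sum in the definition contributes nothing. -/
lemma IsSmoothImmersion.normalLaplacian_eq :
    normalLaplacian k x W p = -∑ a,
      ((ambDeriv k x (ambDeriv k x W) p (stdBasis n a) (stdBasis n a)
          - ambDeriv k x (tangProj k x) p (stdBasis n a) (ambDeriv k x W p (stdBasis n a)))
        - tangProj k x p (ambDeriv k x (ambDeriv k x W) p (stdBasis n a) (stdBasis n a)
          - ambDeriv k x (tangProj k x) p (stdBasis n a) (ambDeriv k x W p (stdBasis n a)))) := by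
  have hDW := (hx.contMDiff_ambDeriv hW.smooth).mdifferentiableAt (x := p) (by simp)
  have hP := hx.mdiff_tangProj p
  unfold normalLaplacian
  have h2 : ∀ i, normalDeriv k x W p (tangentPart k x p
      (dirDeriv k x (fun q => tangentPart k x q (frame k x p i)) p (frame k x p i))) = 0 := by
    intro i
    have e : (fun q => tangentPart k x q (frame k x p i))
        = fun q => tangProj k x q (frame k x p i) := by
      funext q; exact (tangProj_apply (hx.immersion q) _).symm
    rw [e, dirDeriv_eq_ambDeriv (hx.immersion p), ambDeriv_clm_apply_const hP,
      ← tangProj_apply (hx.immersion p)]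
    have h0 := hx.tangProj_dtangProj_tangProj p (frame k x p i) (frame k x p i)
    rw [hx.tangProj_frame] at h0
    rw [h0, hx.normalDeriv_eq, map_zero, map_zero, sub_zero]
  have h1 : ∀ i, normalDeriv k x (fun q => normalDeriv k x W q (tangentPart k x q (frame k x p i)))
      p (frame k x p i) =
      ((ambDeriv k x (ambDeriv k x W) p (frame k x p i) (frame k x p i)
          - ambDeriv k x (tangProj k x) p (frame k x p i) (ambDeriv k x W p (frame k x p i)))
        - tangProj k x p (ambDeriv k x (ambDeriv k x W) p (frame k x p i) (frame k x p i)
          - ambDeriv k x (tangProj k x) p (frame k x p i)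
              (ambDeriv k x W p (frame k x p i)))) := by
    intro i
    set e := frame k x p i
    have hY : MDifferentiableAt (𝓡∂ k) 𝓘(ℝ, E n) (fun _ : M => e) p := mdifferentiableAt_const
    have h : (fun q => normalDeriv k x W q (tangentPart k x q e))
        = fun q => ambDeriv k x W q e - tangProj k x q (ambDeriv k x W q e) := by
      funext q
      rw [hx.normalDeriv_eq, ← tangProj_apply (hx.immersion q), ambDeriv_tangProj (hx.immersion q)]
    rw [hx.normalDeriv_eq, h, ambDeriv_sub (hDW.clm_apply hY) (hP.clm_apply (hDW.clm_apply hY)),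
      ambDeriv_clm_apply hP (hDW.clm_apply hY), ambDeriv_clm_apply_const hDW]
    simp only [map_sub, map_add, tangProj_idem (hx.immersion p)]
    abel
  simp_rw [h1, h2]
  rw [Finset.sum_const_zero, add_zero]
  let A : E n →ₗ[ℝ] E n := LinearMap.id - (tangProj k x p : E n →ₗ[ℝ] E n)
  let B : E n →ₗ[ℝ] E n →ₗ[ℝ] E n :=
    LinearMap.mk₂ ℝ (fun Y Z => A (ambDeriv k x (ambDeriv k x W) p Y Z
          - ambDeriv k x (tangProj k x) p Y (ambDeriv k x W p Z)))
      (fun Y₁ Y₂ Z => by rw [← map_add]; congr 1; simp only [map_add, add_apply]; abel)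
      (fun c Y Z => by rw [← map_smul]; congr 1; simp only [map_smul, smul_apply, smul_sub])
      (fun Y Z₁ Z₂ => by rw [← map_add]; congr 1; simp only [map_add]; abel)
      (fun c Y Z => by rw [← map_smul]; congr 1; simp only [map_smul, smul_sub])
  have h := sum_frame_eq p (hx.immersion p) B (fun Y Z => by
    change A (ambDeriv k x (ambDeriv k x W) p (tangProj k x p Y) Z
          - ambDeriv k x (tangProj k x) p (tangProj k x p Y) (ambDeriv k x W p Z)) = _
    rw [ambDeriv_tangProj (hx.immersion p), ambDeriv_tangProj (hx.immersion p)]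
    rfl)
  exact congrArg Neg.neg h

/-- Contraction of the second fundamental form with a normal field `W`: the vector
`∑ⱼ (σ(Y, e_j), W) e_j` is the derivative of the tangential projection applied to `W`. -/
lemma IsSmoothImmersion.sum_secondFF_smul (Y : E n) :
    ∑ j, ⟪secondFF k x p Y (frame k x p j), W p⟫ • frame k x p j
      = ambDeriv k x (tangProj k x) p Y (W p) := by
  rw [← hx.tangProj_dtangProj_normal p Y (hx.tangProj_normal hW p),
    ← sum_inner_smul_frame p (hx.immersion p)]
  refine Finset.sum_congr rfl fun j _ => ?_
  rw [hx.secondFF_eq p _ (frame_mem p j), hx.inner_dtangProj]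

lemma IsSmoothImmersion.simons_eq :
    simons k x W p = ∑ a, ambDeriv k x (tangProj k x) p (stdBasis n a)
      (ambDeriv k x (tangProj k x) p (stdBasis n a) (W p)) := by
  let B : E n →ₗ[ℝ] E n →ₗ[ℝ] E n :=
    LinearMap.mk₂ ℝ (fun Y Z => ambDeriv k x (tangProj k x) p Y
        (ambDeriv k x (tangProj k x) p Z (W p)))
      (by simp) (by simp) (by simp) (by simp)
  have h := sum_frame_eq p (hx.immersion p) B (fun Y Z => hx.dtangProj_tang_left p Y _)
  refine Eq.trans (Finset.sum_congr rfl fun i _ => ?_) h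
  change _ = ambDeriv k x (tangProj k x) p (frame k x p i)
        (ambDeriv k x (tangProj k x) p (frame k x p i) (W p))
  conv_rhs => rw [← hx.sum_secondFF_smul hW p (frame k x p i), map_sum]
  refine Finset.sum_congr rfl fun j _ => ?_
  rw [map_smul, hx.secondFF_eq p _ (frame_mem p j)]

omit hW in
lemma IsSmoothImmersion.sum_secondFF_mul {U : M → E n} (hU : IsNormalField k x U) :
    ∑ i, ∑ j, ⟪secondFF k x p (frame k x p i) (frame k x p j), U p⟫ *
          ⟪secondFF k x p (frame k x p i) (frame k x p j), W p⟫
      = ∑ a, ⟪ambDeriv k x (tangProj k x) p (stdBasis n a) (U p),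
          ambDeriv k x (tangProj k x) p (stdBasis n a) (W p)⟫ := by
  let B : E n →ₗ[ℝ] E n →ₗ[ℝ] ℝ :=
    LinearMap.mk₂ ℝ (fun Y Z => ⟪ambDeriv k x (tangProj k x) p Y (U p),
        ambDeriv k x (tangProj k x) p Z (W p)⟫)
      (by simp [inner_add_left]) (by simp [inner_smul_left])
      (by simp [inner_add_right]) (by simp [inner_smul_right])
  have h := sum_frame_eq p (hx.immersion p) B (fun Y Z => by
    change ⟪ambDeriv k x (tangProj k x) p (tangProj k x p Y) (U p), _⟫ = _
    rw [hx.dtangProj_tang_left]; rfl)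
  refine Eq.trans (Finset.sum_congr rfl fun i _ => ?_) h
  change _ = ⟪ambDeriv k x (tangProj k x) p (frame k x p i) (U p),
        ambDeriv k x (tangProj k x) p (frame k x p i) (W p)⟫
  rw [← hx.sum_secondFF_smul hU p (frame k x p i), sum_inner]
  refine Finset.sum_congr rfl fun j _ => ?_
  rw [inner_smul_left, hx.secondFF_eq p _ (frame_mem p j), hx.inner_dtangProj p _ _ (W p)]
  rfl

omit [IsManifold (𝓡∂ k) ∞ M] hW in
lemma IsSmoothImmersion.sum_normalDeriv {U : M → E n} :
    ∑ i, ⟪normalDeriv k x U p (frame k x p i), normalDeriv k x W p (frame k x p i)⟫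
      = ∑ a, ⟪ambDeriv k x U p (stdBasis n a) - tangProj k x p (ambDeriv k x U p (stdBasis n a)),
          ambDeriv k x W p (stdBasis n a)⟫ := by
  let B : E n →ₗ[ℝ] E n →ₗ[ℝ] ℝ :=
    LinearMap.mk₂ ℝ (fun Y Z => ⟪ambDeriv k x U p Y - tangProj k x p (ambDeriv k x U p Y),
          ambDeriv k x W p Z⟫)
      (by intro a b c; simp only [map_add, inner_add_left, inner_sub_left]; ring)
      (by intro a b c; simp only [map_smul, inner_sub_left, inner_smul_left, smul_eq_mul]
          simp only [conj_trivial]; ring)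
      (by simp [inner_add_right]) (by simp [inner_smul_right])
  have h := sum_frame_eq p (hx.immersion p) B (fun Y Z => by
    change ⟪ambDeriv k x U p (tangProj k x p Y)
      - tangProj k x p (ambDeriv k x U p (tangProj k x p Y)), _⟫ = _
    rw [ambDeriv_tangProj (hx.immersion p)]; rfl)
  refine Eq.trans (Finset.sum_congr rfl fun i _ => ?_) h
  rw [hx.normalDeriv_eq, hx.normalDeriv_eq, inner_sub_tangProj (hx.immersion p)]
  rfl

end NormalFields

/-! ### The divergence identity -/

section DivergenceIdentity

variable {k : ℕ} {n : ℕ} [NeZero k] {M : Type*} [TopologicalSpace M]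
  [ChartedSpace (EuclideanHalfSpace k) M]

/-- The divergence `∑ᵢ (D_{e_i} X, e_i)` on `Σ` of a vector field along the immersion, written with
the standard basis of the ambient space. -/
def divergence (x : M → E n) (X : M → E n) (p : M) : ℝ :=
  ∑ a, ⟪ambDeriv k x X p (stdBasis n a), stdBasis n a⟫

/-- The conformal Killing field `(v, x) x + ½ (1 - |x|²) v` of the unit ball, along the immersion;
on the unit sphere it equals `(v, x) x`. -/
def conformalField (x : M → E n) (v : E n) (p : M) : E n :=
  ⟪v, x p⟫ • x p + ((1 / 2 : ℝ) * (1 - ‖x p‖ ^ 2)) • v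

variable (k) in
/-- The vector `v^⊤ - 2 Z^⊤ + Z` with `Z` the conformal field of `v`. -/
def fluxVector (x : M → E n) (v : E n) (p : M) : E n :=
  tangProj k x p v - (2 : ℝ) • tangProj k x p (conformalField x v p) + conformalField x v p

variable (k) in
/-- The tangent field `X` with `(X, Y) = (D_Y W, v^⊤ - 2Z^⊤ + Z) + (W, v)(x, Y) - (W, x)(v, Y)` for
tangent vectors `Y`, whose divergence is the difference of the integrands in the index identity. -/
def fluxField (x W : M → E n) (v : E n) (p : M) : E n :=
  (ambDeriv k x W p).adjoint (fluxVector k x v p) + ⟪W p, v⟫ • tangProj k x p (x p)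
    - ⟪W p, x p⟫ • tangProj k x p v

variable {x : M → E n}

lemma inner_fluxField {p : M} (hx : Function.Injective (differential k x p)) (W : M → E n)
    (v Y : E n) :
    ⟪fluxField k x W v p, Y⟫ = ⟪fluxVector k x v p, ambDeriv k x W p Y⟫
      + ⟪W p, v⟫ * ⟪x p, tangProj k x p Y⟫ - ⟪W p, x p⟫ * ⟪v, tangProj k x p Y⟫ := by
  unfold fluxField
  rw [inner_sub_left, inner_add_left, ContinuousLinearMap.adjoint_inner_left, real_inner_smul_left,
    real_inner_smul_left, inner_tangProj hx, inner_tangProj hx]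

lemma fluxField_mem {p : M} (hx : Function.Injective (differential k x p)) (W : M → E n)
    (v : E n) : fluxField k x W v p ∈ tangentPlane k x p := by
  have h : tangProj k x p (fluxField k x W v p) = fluxField k x W v p := by
    refine ext_inner_right ℝ fun Y => ?_
    rw [inner_tangProj hx, inner_fluxField hx, inner_fluxField hx, ambDeriv_tangProj hx,
      tangProj_idem hx]
  rw [← h]
  exact tangProj_mem hx _

lemma sum_inner_tangProj {p : M} (hx : Function.Injective (differential k x p)) :
    ∑ a, ⟪tangProj k x p (stdBasis n a), tangProj k x p (stdBasis n a)⟫ = (k : ℝ) := by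
  let B : E n →ₗ[ℝ] E n →ₗ[ℝ] ℝ :=
    LinearMap.mk₂ ℝ (fun Y Z => ⟪tangProj k x p Y, tangProj k x p Z⟫)
      (by simp [inner_add_left]) (by simp [inner_smul_left])
      (by simp [inner_add_right]) (by simp [inner_smul_right])
  have h := sum_frame_eq p hx B (fun Y Z => by
    change ⟪tangProj k x p (tangProj k x p Y), _⟫ = _
    rw [tangProj_idem hx]; rfl)
  refine Eq.trans h.symm ?_
  have h1 : ∀ i, B (frame k x p i) (frame k x p i) = 1 := by
    intro i
    change ⟪tangProj k x p (frame k x p i), tangProj k x p (frame k x p i)⟫ = 1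
    rw [tangProj_eq_self hx (frame_mem p i), real_inner_self_eq_norm_sq]
    have : ‖frame k x p i‖ = 1 := (stdOrthonormalBasis ℝ (tangentPlane k x p)).norm_eq_one i
    rw [this]; norm_num
  simp_rw [h1]
  rw [Finset.sum_const, Finset.card_univ, Fintype.card_fin]
  have h2 : Module.finrank ℝ (tangentPlane k x p) = k := by
    refine Eq.trans (LinearMap.finrank_range_of_inj hx) ?_
    rw [finrank_euclideanSpace_fin]
  rw [h2]; simp

/-- Expansion of a linear map in the standard basis, with tangential coefficients. -/
lemma sum_inner_tangProj_mul {F : Type*} [NormedAddCommGroup F] [NormedSpace ℝ F] {p : M}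
    (hx : Function.Injective (differential k x p)) (T : E n →L[ℝ] F) (Y : E n) :
    ∑ a, ⟪Y, tangProj k x p (stdBasis n a)⟫ • T (stdBasis n a) = T (tangProj k x p Y) := by
  conv_rhs => rw [← (EuclideanSpace.basisFun (Fin n) ℝ).sum_repr' (tangProj k x p Y), map_sum]
  refine Finset.sum_congr rfl fun a _ => ?_
  rw [map_smul, ← inner_tangProj hx, real_inner_comm]

lemma inner_symm_sum (f : Fin n → E n →L[ℝ] E n) (hf : ∀ a Y Z, ⟪f a Y, Z⟫ = ⟪Y, f a Z⟫)
    (Y Z : E n) : ∑ a, ⟪Y, f a Z⟫ = ⟪∑ a, f a Y, Z⟫ := by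
  rw [sum_inner]
  exact Finset.sum_congr rfl fun a _ => (hf a Y Z).symm

lemma contMDiff_inner {f g : M → E n}
    (hf : ContMDiff (𝓡∂ k) 𝓘(ℝ, E n) ∞ f) (hg : ContMDiff (𝓡∂ k) 𝓘(ℝ, E n) ∞ g) :
    ContMDiff (𝓡∂ k) 𝓘(ℝ, ℝ) ∞ (fun p => ⟪f p, g p⟫) := by
  have h : ContDiff ℝ ∞ (fun z : E n × E n => ⟪z.1, z.2⟫) := contDiff_fst.inner ℝ contDiff_snd
  exact h.comp_contMDiff (hf.prodMk_space hg)

variable [IsManifold (𝓡∂ k) ∞ M]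

variable (hx : IsSmoothImmersion k x) {W : M → E n} (hW : IsNormalField k x W) (v : E n)
include hx

omit [IsManifold (𝓡∂ k) ∞ M] in
lemma IsSmoothImmersion.contMDiff_conformalField :
    ContMDiff (𝓡∂ k) 𝓘(ℝ, E n) ∞ (conformalField x v) := by
  have h : ContDiff ℝ ∞ (fun y : E n => ⟪v, y⟫ • y + ((1 / 2 : ℝ) * (1 - ‖y‖ ^ 2)) • v) :=
    ((contDiff_const.inner ℝ contDiff_id).smul contDiff_id).add
      ((contDiff_const.mul (contDiff_const.sub (contDiff_norm_sq ℝ))).smul contDiff_const)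
  exact h.comp_contMDiff hx.smooth

lemma IsSmoothImmersion.contMDiff_fluxVector :
    ContMDiff (𝓡∂ k) 𝓘(ℝ, E n) ∞ (fluxVector k x v) := by
  have hP := hx.contMDiff_tangProj
  have hZ := hx.contMDiff_conformalField v
  have h2 : ContMDiff (𝓡∂ k) 𝓘(ℝ, ℝ) ∞ (fun _ : M => (2 : ℝ)) := contMDiff_const
  exact ((hP.clm_apply contMDiff_const).sub (h2.smul (hP.clm_apply hZ))).add hZ

omit [IsManifold (𝓡∂ k) ∞ M] in
lemma IsSmoothImmersion.ambDeriv_conformalField (p : M) (Y : E n) :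
    ambDeriv k x (conformalField x v) p Y = ⟪v, tangProj k x p Y⟫ • x p
      + ⟪v, x p⟫ • tangProj k x p Y - ⟪x p, tangProj k x p Y⟫ • v := by
  have hxd := hx.smooth.mdifferentiableAt (x := p) (by simp)
  have hv : MDifferentiableAt (𝓡∂ k) 𝓘(ℝ, E n) (fun _ : M => v) p := mdifferentiableAt_const
  have hc : ∀ c : ℝ, MDifferentiableAt (𝓡∂ k) 𝓘(ℝ, ℝ) (fun _ : M => c) p :=
    fun c => mdifferentiableAt_const
  have hi := (contMDiff_inner (contMDiff_const (c := v)) hx.smooth).mdifferentiableAt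
    (x := p) (by simp)
  have hn := (contMDiff_inner hx.smooth hx.smooth).mdifferentiableAt (x := p) (by simp)
  have hw : MDifferentiableAt (𝓡∂ k) 𝓘(ℝ, ℝ) (fun q => (1 / 2 : ℝ) • ((1 : ℝ) - ⟪x q, x q⟫)) p :=
    mdiffAt_smul (hc (1 / 2)) (mdiffAt_sub (hc 1) hn)
  have e : conformalField x v
      = fun q => ⟪v, x q⟫ • x q + ((1 / 2 : ℝ) • ((1 : ℝ) - ⟪x q, x q⟫)) • v := by
    funext q
    simp only [conformalField, real_inner_self_eq_norm_sq, smul_eq_mul]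
  rw [e, ambDeriv_add (mdiffAt_smul hi hxd) (mdiffAt_smul hw hv), ambDeriv_smul hi hxd,
    ambDeriv_smul hw hv, ambDeriv_inner hv hxd, ambDeriv_smul (hc _) (mdiffAt_sub (hc 1) hn),
    ambDeriv_sub (hc 1) hn,
    ambDeriv_inner hxd hxd, ambDeriv_const, ambDeriv_const, ambDeriv_const]
  change (⟪(0 : E n), _⟫ + ⟪v, tangProj k x p Y⟫) • x p + ⟪v, x p⟫ • tangProj k x p Y
    + (((0 : ℝ) • _ + (1 / 2 : ℝ) • ((0 : ℝ) - (⟪tangProj k x p Y, x p⟫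
      + ⟪x p, tangProj k x p Y⟫))) • v + _ • (0 : E n)) = _
  rw [real_inner_comm (x p) (tangProj k x p Y)]
  simp only [inner_zero_left, zero_add, smul_zero, add_zero, smul_eq_mul, zero_sub]
  module

include hW

lemma IsSmoothImmersion.contMDiff_fluxField :
    ContMDiff (𝓡∂ k) 𝓘(ℝ, E n) ∞ (fluxField k x W v) := by
  have hP := hx.contMDiff_tangProj
  have hadj : ContMDiff (𝓡∂ k) 𝓘(ℝ, E n →L[ℝ] E n) ∞ (fun p => (ambDeriv k x W p).adjoint) :=
    contDiff_adjoint.comp_contMDiff (hx.contMDiff_ambDeriv hW.smooth)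
  exact ((hadj.clm_apply (hx.contMDiff_fluxVector v)).add
    ((contMDiff_inner hW.smooth contMDiff_const).smul (hP.clm_apply hx.smooth))).sub
    ((contMDiff_inner hW.smooth hx.smooth).smul (hP.clm_apply contMDiff_const))

/-- One summand of the divergence of the flux field, expanded by the product rule. -/
lemma IsSmoothImmersion.inner_ambDeriv_fluxField (p : M) (Y : E n) :
    ⟪ambDeriv k x (fluxField k x W v) p Y, Y⟫ =
      ⟪ambDeriv k x (fluxVector k x v) p Y, ambDeriv k x W p Y⟫
      + ⟪fluxVector k x v p, ambDeriv k x (ambDeriv k x W) p Y Y⟫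
      + (⟪ambDeriv k x W p Y, v⟫ * ⟪x p, tangProj k x p Y⟫
        + ⟪W p, v⟫ * (⟪tangProj k x p Y, tangProj k x p Y⟫
          + ⟪x p, ambDeriv k x (tangProj k x) p Y Y⟫))
      - (⟪ambDeriv k x W p Y, x p⟫ * ⟪v, tangProj k x p Y⟫
        + ⟪W p, x p⟫ * ⟪v, ambDeriv k x (tangProj k x) p Y Y⟫) := by
  have hY : MDifferentiableAt (𝓡∂ k) 𝓘(ℝ, E n) (fun _ : M => Y) p := mdifferentiableAt_const
  have hv : MDifferentiableAt (𝓡∂ k) 𝓘(ℝ, E n) (fun _ : M => v) p := mdifferentiableAt_const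
  have hxd := hx.smooth.mdifferentiableAt (x := p) (by simp)
  have hWd := hW.smooth.mdifferentiableAt (x := p) (by simp)
  have hDW := (hx.contMDiff_ambDeriv hW.smooth).mdifferentiableAt (x := p) (by simp)
  have hu := (hx.contMDiff_fluxVector v).mdifferentiableAt (x := p) (by simp)
  have hP := hx.mdiff_tangProj p
  have hPY : ContMDiff (𝓡∂ k) 𝓘(ℝ, E n) ∞ (fun q => tangProj k x q Y) :=
    hx.contMDiff_tangProj.clm_apply contMDiff_const
  have hDWY : ContMDiff (𝓡∂ k) 𝓘(ℝ, E n) ∞ (fun q => ambDeriv k x W q Y) :=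
    (hx.contMDiff_ambDeriv hW.smooth).clm_apply contMDiff_const
  have hX := (hx.contMDiff_fluxField hW v).mdifferentiableAt (x := p) (by simp)
  have h1 := ambDeriv_inner (x := x) hX hY Y
  rw [ambDeriv_const, zero_apply, inner_zero_right, add_zero] at h1
  have e : (fun q => ⟪fluxField k x W v q, Y⟫)
      = fun q => (⟪fluxVector k x v q, ambDeriv k x W q Y⟫
      + ⟪W q, v⟫ • ⟪x q, tangProj k x q Y⟫) - ⟪W q, x q⟫ • ⟪v, tangProj k x q Y⟫ := by
    funext q
    rw [inner_fluxField (hx.immersion q)]; rfl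
  have d1 := (contMDiff_inner (hx.contMDiff_fluxVector v) hDWY).mdifferentiableAt
    (x := p) (by simp)
  have d2 := (contMDiff_inner hW.smooth (contMDiff_const (c := v))).mdifferentiableAt
    (x := p) (by simp)
  have d3 := (contMDiff_inner hx.smooth hPY).mdifferentiableAt (x := p) (by simp)
  have d4 := (contMDiff_inner hW.smooth hx.smooth).mdifferentiableAt (x := p) (by simp)
  have d5 := (contMDiff_inner (contMDiff_const (c := v)) hPY).mdifferentiableAt
    (x := p) (by simp)
  rw [← h1, e, ambDeriv_sub (mdiffAt_add d1 (mdiffAt_smul d2 d3)) (mdiffAt_smul d4 d5),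
    ambDeriv_add d1 (mdiffAt_smul d2 d3),
    ambDeriv_smul d2 d3, ambDeriv_smul d4 d5, ambDeriv_inner hu (hDW.clm_apply hY),
    ambDeriv_inner hWd hv, ambDeriv_inner hxd (hP.clm_apply hY), ambDeriv_inner hWd hxd,
    ambDeriv_inner hv (hP.clm_apply hY), ambDeriv_clm_apply_const hDW,
    ambDeriv_clm_apply_const hP, ambDeriv_const]
  have h0 : ⟪W p, ambDeriv k x x p Y⟫ = 0 := by
    change ⟪W p, tangProj k x p Y⟫ = 0
    rw [← inner_tangProj (hx.immersion p), hx.tangProj_normal hW, inner_zero_left]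
  rw [h0]
  simp only [smul_eq_mul, zero_apply, inner_zero_left, inner_zero_right, add_zero, zero_add]
  rfl

omit hW in
lemma IsSmoothImmersion.ambDeriv_fluxVector (p : M) (Y : E n) :
    ambDeriv k x (fluxVector k x v) p Y = ambDeriv k x (tangProj k x) p Y v
      - (2 : ℝ) • (ambDeriv k x (tangProj k x) p Y (conformalField x v p)
        + tangProj k x p (ambDeriv k x (conformalField x v) p Y))
      + ambDeriv k x (conformalField x v) p Y := by
  have hv : MDifferentiableAt (𝓡∂ k) 𝓘(ℝ, E n) (fun _ : M => v) p := mdifferentiableAt_const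
  have hZ := (hx.contMDiff_conformalField v).mdifferentiableAt (x := p) (by simp)
  have hP := hx.mdiff_tangProj p
  have h2 : MDifferentiableAt (𝓡∂ k) 𝓘(ℝ, ℝ) (fun _ : M => (2 : ℝ)) p := mdifferentiableAt_const
  have hPZ := hP.clm_apply hZ
  unfold fluxVector
  rw [ambDeriv_add (mdiffAt_sub (hP.clm_apply hv) (mdiffAt_smul h2 hPZ)) hZ,
    ambDeriv_sub (hP.clm_apply hv) (mdiffAt_smul h2 hPZ), ambDeriv_smul h2 hPZ,
    ambDeriv_clm_apply hP hZ, ambDeriv_clm_apply_const hP, ambDeriv_const, zero_apply, zero_smul,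
    zero_add]

/-- One summand of the divergence of the flux field, sorted. The first bracket holds the summands of
the index integrand and of the Jacobi operator paired with the conformal field. Summed over an
orthonormal basis, the second bracket reduces to the term with `|Y^⊤|²`: its first term vanishes by
the Codazzi equation, the three terms with `D_Y P Y` by minimality (`P` being the tangential
projection), and the last two cancel by the symmetry of the second fundamental form. -/
lemma IsSmoothImmersion.inner_ambDeriv_fluxField_eq (p : M) (Y : E n) :
    ⟪ambDeriv k x (fluxField k x W v) p Y, Y⟫ =
      (⟪-(ambDeriv k x (tangProj k x) p Y v) -
          tangProj k x p (-(ambDeriv k x (tangProj k x) p Y v)), ambDeriv k x W p Y⟫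
        - ⟪ambDeriv k x (tangProj k x) p Y (v - tangProj k x p v),
            ambDeriv k x (tangProj k x) p Y (W p)⟫
        + ⟪(ambDeriv k x (ambDeriv k x W) p Y Y
              - ambDeriv k x (tangProj k x) p Y (ambDeriv k x W p Y))
            - tangProj k x p (ambDeriv k x (ambDeriv k x W) p Y Y
              - ambDeriv k x (tangProj k x) p Y (ambDeriv k x W p Y)), conformalField x v p⟫
        + ⟪ambDeriv k x (tangProj k x) p Y (ambDeriv k x (tangProj k x) p Y (W p)),
            conformalField x v p⟫)
      + (-⟪tangProj k x p (v - conformalField x v p),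
            ambDeriv k x (ambDeriv k x (tangProj k x)) p Y Y (W p)⟫
        + ⟪W p, v⟫ * ⟪tangProj k x p Y, tangProj k x p Y⟫
        + ⟪W p, v⟫ * ⟪x p, ambDeriv k x (tangProj k x) p Y Y⟫
        - ⟪W p, x p⟫ * ⟪v, ambDeriv k x (tangProj k x) p Y Y⟫
        + ⟪v, x p⟫ * ⟪W p, ambDeriv k x (tangProj k x) p Y Y⟫
        + 2 * (⟪v, tangProj k x p Y⟫ * ⟪W p, ambDeriv k x (tangProj k x) p Y (x p)⟫)
        - 2 * (⟪x p, tangProj k x p Y⟫ * ⟪W p, ambDeriv k x (tangProj k x) p Y v⟫)) := by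
  rw [hx.inner_ambDeriv_fluxField hW, hx.ambDeriv_fluxVector, hx.ambDeriv_conformalField]
  unfold fluxVector
  set Z := conformalField x v p
  have hPsym := fun A B : E n => inner_tangProj (hx.immersion p) A B
  have hPid := fun A : E n => tangProj_idem (hx.immersion p) A
  have hDsym := fun A B : E n => hx.inner_dtangProj p Y A B
  have hPD := fun A : E n => hx.dtangProj_tangProj p Y A
  have hPw := hx.tangProj_dnormal hW p Y
  have hPL := hx.tangProj_ddnormal hW p Y
  set w := ambDeriv k x W p Y
  set Lw := ambDeriv k x (ambDeriv k x W) p Y Y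
  set q := ambDeriv k x (ambDeriv k x (tangProj k x)) p Y Y (W p)
  set D := ambDeriv k x (tangProj k x) p Y
  set P := tangProj k x p
  -- each pairing is reduced to the pairings of `w` with `D v`, `D (P v)`, `D Z`, `D (P Z)`
  have hDW : D (W p) = -P w := by rw [hPw, neg_neg]
  have a1 : ∀ A, ⟪P A, Lw⟫ = -⟪P A, q⟫ - 2 * ⟪D (P A), w⟫ := by
    intro A
    rw [← hPid A, hPsym (P A) Lw, hPL, hPid, inner_sub_right, inner_neg_right,
      real_inner_smul_right, ← hDsym]
  have a2 : ∀ A, ⟪P A, w⟫ = -⟪W p, D A⟫ := by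
    intro A
    rw [hPsym, hPw, inner_neg_right, ← hDsym, real_inner_comm]
  have a3 : ∀ A, ⟪P (D A), w⟫ = ⟪D A, w⟫ - ⟪D (P A), w⟫ := by
    intro A; rw [← inner_sub_left]; congr 1; rw [hPD]; abel
  have a4 : ⟪D (v - P v), D (W p)⟫ = -(⟪D v, w⟫ - ⟪D (P v), w⟫) := by
    rw [hDW, inner_neg_right, ← hPsym, map_sub, map_sub, inner_sub_left, a3, a3, hPid]
    ring
  have a5 : ⟪D (D (W p)), Z⟫ = -(⟪D Z, w⟫ - ⟪D (P Z), w⟫) := by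
    rw [hDsym, hDW, inner_neg_left, hPsym, real_inner_comm, a3]
  have a6 : ⟪(Lw - D w) - P (Lw - D w), Z⟫
      = ⟪Z, Lw⟫ - ⟪P Z, Lw⟫ - ⟪D Z, w⟫ + ⟪D (P Z), w⟫ := by
    rw [inner_sub_left, inner_sub_left, hPsym, inner_sub_left, real_inner_comm Z,
      real_inner_comm (P Z), hDsym, hDsym, real_inner_comm (D Z), real_inner_comm (D (P Z))]
    ring
  have a7 : ⟪P Y, w⟫ = -⟪W p, D Y⟫ := a2 Y
  rw [a4, a5, a6]
  simp only [map_sub, map_add, map_neg, map_smul, inner_sub_left, inner_add_left, inner_neg_left,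
    real_inner_smul_left, a1, a2 v, a2 (x p), a7, a3, hPid, smul_sub, smul_add]
  rw [real_inner_comm w v, real_inner_comm w (x p)]
  ring

omit hW in
lemma IsSmoothImmersion.ambDeriv_normalPart (p : M) (Y : E n) :
    ambDeriv k x (fun q => normalPart k x q v) p Y = -ambDeriv k x (tangProj k x) p Y v := by
  have h : (fun p => normalPart k x p v) = fun p => v - tangProj k x p v := by
    funext p; exact normalPart_eq (hx.immersion p) v
  rw [h, ambDeriv_sub mdifferentiableAt_const
    ((hx.mdiff_tangProj p).clm_apply mdifferentiableAt_const),
    ambDeriv_clm_apply_const (hx.mdiff_tangProj p), ambDeriv_const, zero_apply, zero_sub]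

/-- The divergence of the flux field is the difference of the integrands of the index identity. -/
lemma IsSmoothImmersion.divergence_fluxField (hmin : IsMinimal k x) (p : M) :
    divergence (k := k) x (fluxField k x W v) p =
      (∑ i, ⟪normalDeriv k x (fun q => normalPart k x q v) p (frame k x p i),
          normalDeriv k x W p (frame k x p i)⟫
        - ∑ i, ∑ j, ⟪secondFF k x p (frame k x p i) (frame k x p j), normalPart k x p v⟫ *
          ⟪secondFF k x p (frame k x p i) (frame k x p j), W p⟫)
      + (k : ℝ) * ⟪normalPart k x p v, W p⟫ - ⟪jacobi k x W p, conformalField x v p⟫ := by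
  have hU := hx.isNormalField v
  rw [hx.sum_normalDeriv p, hx.sum_secondFF_mul p hU, jacobi, hx.normalLaplacian_eq hW,
    hx.simons_eq hW]
  simp_rw [hx.ambDeriv_normalPart, normalPart_eq (hx.immersion p)]
  unfold divergence
  simp_rw [hx.inner_ambDeriv_fluxField_eq hW v p]
  have hmin' := hx.sum_dtangProj p hmin
  have e0 : ∑ a, ⟪tangProj k x p (v - conformalField x v p),
      ambDeriv k x (ambDeriv k x (tangProj k x)) p (stdBasis n a) (stdBasis n a) (W p)⟫ = 0 := by
    have hs : ∀ a Y Z, ⟪ambDeriv k x (ambDeriv k x (tangProj k x)) p (stdBasis n a)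
        (stdBasis n a) Y, Z⟫ = ⟪Y, ambDeriv k x (ambDeriv k x (tangProj k x)) p (stdBasis n a)
        (stdBasis n a) Z⟫ := fun a Y Z => hx.inner_ddtangProj p _ _ _ _
    rw [inner_symm_sum _ hs]
    have h := hx.codazzi p hmin (y := tangProj k x p (v - conformalField x v p))
      (tangProj_idem (hx.immersion p) _)
    rw [← h, inner_tangProj (hx.immersion p), hx.tangProj_normal hW, inner_zero_right]
  have e1 : ∀ Y : E n,
      ∑ a, ⟪Y, ambDeriv k x (tangProj k x) p (stdBasis n a) (stdBasis n a)⟫ = 0 := by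
    intro Y
    rw [← inner_sum, hmin', inner_zero_right]
  have e2 : ∀ Y Z : E n, ∑ a, ⟪Y, tangProj k x p (stdBasis n a)⟫ *
      ⟪W p, ambDeriv k x (tangProj k x) p (stdBasis n a) Z⟫
      = ⟪W p, ambDeriv k x (tangProj k x) p Y Z⟫ := by
    intro Y Z
    have h := sum_inner_tangProj_mul (hx.immersion p)
      ((innerSL ℝ (W p)) ∘L (ContinuousLinearMap.apply ℝ (E n) Z) ∘L
        (ambDeriv k x (tangProj k x) p)) Y
    have h' : ∑ a, ⟪Y, tangProj k x p (stdBasis n a)⟫ *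
      ⟪W p, ambDeriv k x (tangProj k x) p (stdBasis n a) Z⟫
      = ⟪W p, ambDeriv k x (tangProj k x) p (tangProj k x p Y) Z⟫ := h
    rw [h', hx.dtangProj_tang_left]
  have e3 : ⟪W p, ambDeriv k x (tangProj k x) p v (x p)⟫
      = ⟪W p, ambDeriv k x (tangProj k x) p (x p) v⟫ := by
    rw [← sub_eq_zero, ← inner_sub_right, ← hx.tangProj_bracket,
      ← inner_tangProj (hx.immersion p), hx.tangProj_normal hW, inner_zero_left]
  have e4 : ⟪v - tangProj k x p v, W p⟫ = ⟪W p, v⟫ := by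
    rw [inner_sub_left, inner_tangProj (hx.immersion p), hx.tangProj_normal hW, inner_zero_right,
      sub_zero, real_inner_comm]
  rw [e4, inner_sub_left, inner_neg_left, sum_inner, sum_inner]
  simp only [Finset.sum_add_distrib, Finset.sum_sub_distrib, Finset.sum_neg_distrib,
    ← Finset.mul_sum, e0, e1, e2, e3, sum_inner_tangProj (hx.immersion p)]
  ring

omit hW in
/-- Infinitesimal translations are Jacobi fields: `J (v^⊥) = 0` on a minimal submanifold. -/
lemma IsSmoothImmersion.jacobi_normalPart (hmin : IsMinimal k x) (p : M) :
    jacobi k x (fun q => normalPart k x q v) p = 0 := by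
  have hU := hx.isNormalField v
  have hP := hx.mdiff_tangProj p
  have hDP := hx.mdiff_dtangProj p
  have hc : ∀ Z : E n, MDifferentiableAt (𝓡∂ k) 𝓘(ℝ, E n) (fun _ : M => Z) p :=
    fun Z => mdifferentiableAt_const
  have hdd : ∀ Y, ambDeriv k x (ambDeriv k x (fun q => normalPart k x q v)) p Y Y
      = -ambDeriv k x (ambDeriv k x (tangProj k x)) p Y Y v := by
    intro Y
    have hDU := (hx.contMDiff_ambDeriv hU.smooth).mdifferentiableAt (x := p) (by simp)
    have e : (fun q => ambDeriv k x (fun q => normalPart k x q v) q Y)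
        = fun q => 0 - ambDeriv k x (tangProj k x) q Y v := by
      funext q; rw [hx.ambDeriv_normalPart, zero_sub]
    rw [← ambDeriv_clm_apply_const hDU, e,
      ambDeriv_sub (hc 0) ((hDP.clm_apply (hc Y)).clm_apply (hc v)),
      ambDeriv_clm_apply_const (hDP.clm_apply (hc Y)), ambDeriv_clm_apply_const hDP,
      ambDeriv_const, zero_apply, zero_sub]
  -- second derivative of `P ∘ P = P`
  have hPP : ∀ Y Z, ambDeriv k x (ambDeriv k x (tangProj k x)) p Y Y (tangProj k x p Z)
      + (2 : ℝ) • ambDeriv k x (tangProj k x) p Y (ambDeriv k x (tangProj k x) p Y Z)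
      + tangProj k x p (ambDeriv k x (ambDeriv k x (tangProj k x)) p Y Y Z)
      = ambDeriv k x (ambDeriv k x (tangProj k x)) p Y Y Z := by
    intro Y Z
    have d1 := hDP.clm_apply (hc Y)
    have d2 := hP.clm_apply (hc Z)
    have h : ambDeriv k x (fun q => ambDeriv k x (tangProj k x) q Y (tangProj k x q Z)
        + tangProj k x q (ambDeriv k x (tangProj k x) q Y Z)) p Y
        = ambDeriv k x (fun q => ambDeriv k x (tangProj k x) q Y Z) p Y := by
      congr 2
      funext q
      exact hx.dtangProj_add q Y Z
    rw [ambDeriv_add (d1.clm_apply d2) (hP.clm_apply (d1.clm_apply (hc Z))),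
      ambDeriv_clm_apply d1 d2, ambDeriv_clm_apply hP (d1.clm_apply (hc Z)),
      ambDeriv_clm_apply_const d1, ambDeriv_clm_apply_const hDP, ambDeriv_clm_apply_const hP] at h
    rw [two_smul]
    refine Eq.trans ?_ h
    abel
  have hcod := hx.codazzi p hmin (y := tangProj k x p v) (tangProj_idem (hx.immersion p) v)
  rw [map_sum] at hcod
  unfold jacobi
  rw [hx.normalLaplacian_eq hU, hx.simons_eq hU, ← Finset.sum_neg_distrib,
    ← Finset.sum_sub_distrib]
  rw [← sub_eq_zero, ← Finset.sum_sub_distrib] at hcod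
  rw [← neg_eq_zero, ← hcod, ← Finset.sum_neg_distrib]
  refine Finset.sum_congr rfl fun a _ => ?_
  rw [hdd, hx.ambDeriv_normalPart, normalPart_eq (hx.immersion p)]
  have h1 := hPP (stdBasis n a) v
  have h2 := hx.dtangProj_add p (stdBasis n a) v
  have h3 := hx.dtangProj_add p (stdBasis n a)
    (ambDeriv k x (tangProj k x) p (stdBasis n a) v)
  have h4 := congrArg (tangProj k x p) h1
  have h5 := congrArg (ambDeriv k x (tangProj k x) p (stdBasis n a)) h2
  simp only [map_add, map_sub, map_neg, map_smul, tangProj_idem (hx.immersion p)] at h4 h5 ⊢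
  set A := ambDeriv k x (ambDeriv k x (tangProj k x)) p (stdBasis n a) (stdBasis n a)
  set D := ambDeriv k x (tangProj k x) p (stdBasis n a)
  set P := tangProj k x p
  have h6 : P (A (P v)) = -((2 : ℝ) • P (D (D v))) := by
    rw [eq_neg_iff_add_eq_zero]; exact add_eq_right.1 h4
  have h7 : A v = A (P v) + (2 : ℝ) • D (D v) + P (A v) := h1.symm
  have h9 : D (D (P v)) = D (D v) - D (P (D v)) := by rw [← h5]; abel
  have h10 : A v - P (A v) = A (P v) + (2 : ℝ) • D (D v) := by nth_rewrite 1 [h7]; abel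
  rw [h6, h9]
  have h11 : D (P (D v)) = D (D v) - P (D (D v)) := eq_sub_of_add_eq h3
  rw [h11]
  have h12 : A (P v) = A v - P (A v) - (2 : ℝ) • D (D v) := by rw [h10]; abel
  rw [h12]
  module

/-- The flux through the boundary. On `∂Σ` the conformal field of `v` is `(v, x) x`, and the second
fundamental form does not mix the conormal `x` with tangent vectors `u` of `∂Σ`, because `x^⊤ = x`
along `∂Σ`. -/
lemma IsSmoothImmersion.inner_fluxField_boundary {p : M} (hp : ‖x p‖ = 1)
    (hxt : x p ∈ tangentPlane k x p)
    (hb : ∀ u ∈ tangentPlane k x p, ⟪u, x p⟫ = 0 →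
      ambDeriv k x (fun q => tangProj k x q (x q) - x q) p u = 0) :
    ⟪fluxField k x W v p, x p⟫ = ⟪normalPart k x p v, W p⟫ := by
  have hPx : tangProj k x p (x p) = x p := tangProj_eq_self (hx.immersion p) hxt
  have hxx : ⟪x p, x p⟫ = 1 := by rw [real_inner_self_eq_norm_sq, hp]; norm_num
  have hWx : ⟪W p, x p⟫ = 0 := by
    rw [← hPx, ← inner_tangProj (hx.immersion p), hx.tangProj_normal hW, inner_zero_left]
  have hZ : conformalField x v p = ⟪v, x p⟫ • x p := by
    unfold conformalField; rw [hp]; norm_num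
  have hu : fluxVector k x v p = tangProj k x p v - ⟪v, x p⟫ • x p := by
    unfold fluxVector
    rw [hZ, map_smul, hPx]
    module
  set u := fluxVector k x v p
  have hPu : tangProj k x p u = u := by
    rw [hu, map_sub, map_smul, hPx, tangProj_idem (hx.immersion p)]
  have hut : u ∈ tangentPlane k x p := by rw [← hPu]; exact tangProj_mem (hx.immersion p) _
  have hux : ⟪u, x p⟫ = 0 := by
    rw [hu, inner_sub_left, inner_tangProj (hx.immersion p), hPx, real_inner_smul_left, hxx]
    ring
  have hxd := hx.smooth.mdifferentiableAt (x := p) (by simp)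
  have hP := hx.mdiff_tangProj p
  have h := hb u hut hux
  rw [ambDeriv_sub (hP.clm_apply hxd) hxd, ambDeriv_clm_apply hP hxd] at h
  change ambDeriv k x (tangProj k x) p u (x p) + tangProj k x p (tangProj k x p u)
    - tangProj k x p u = 0 at h
  rw [hPu, hPu, add_sub_cancel_right] at h
  have h0 : ⟪u, ambDeriv k x W p (x p)⟫ = 0 := by
    rw [← hPu, inner_tangProj (hx.immersion p), hx.tangProj_dnormal hW, inner_neg_right,
      ← hx.inner_dtangProj, ← hPu, hx.dtangProj_symm, hPx, h, inner_zero_left, neg_zero]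
  rw [inner_fluxField (hx.immersion p), h0, hWx, hPx, hxx, normalPart_eq (hx.immersion p),
    inner_sub_left, inner_tangProj (hx.immersion p), hx.tangProj_normal hW, inner_zero_right,
    real_inner_comm]
  ring

omit hW in
lemma IsSmoothImmersion.continuous_divergence {X : M → E n}
    (hX : ContMDiff (𝓡∂ k) 𝓘(ℝ, E n) ∞ X) : Continuous (divergence (k := k) x X) := by
  unfold divergence
  exact continuous_finsetSum _ fun a _ => ((hx.contMDiff_ambDeriv hX).continuous.clm_apply
    continuous_const).inner continuous_const

lemma IsSmoothImmersion.continuous_jacobi : Continuous (jacobi k x W) := by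
  have hP := hx.contMDiff_tangProj.continuous
  have hDP := (hx.contMDiff_ambDeriv hx.contMDiff_tangProj).continuous
  have hDW := (hx.contMDiff_ambDeriv hW.smooth).continuous
  have hDDW := (hx.contMDiff_ambDeriv (hx.contMDiff_ambDeriv hW.smooth)).continuous
  have hWc := hW.smooth.continuous
  have e : jacobi k x W = fun p => normalLaplacian k x W p - simons k x W p := rfl
  rw [e]
  simp_rw [hx.normalLaplacian_eq hW, hx.simons_eq hW]
  fun_prop

end DivergenceIdentity

/-! ### Gluing of measures given in parametrizations -/

section Gluing

open MeasureTheory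

/-- The supremum of a family of measures that agree on the overlaps of their domains `U i`,
countably many of which cover the space, restricts to the given measure on each domain. -/
lemma restrict_iSup_eq_of_compatible {α ι : Type*} [MeasurableSpace α] (μ : ι → Measure α)
    (U : ι → Set α) (hU : ∀ i, MeasurableSet (U i)) (h0 : ∀ i, μ i (U i)ᶜ = 0)
    (hc : ∀ i j A, MeasurableSet A → A ⊆ U i → A ⊆ U j → μ i A = μ j A)
    (s : ℕ → ι) (hs : ⋃ m, U (s m) = Set.univ) (i : ι) :
    (⨆ j, μ j).restrict (U i) = μ i := by
  -- the cover is rearranged to start with `U i`, so that the glued measure is `μ i` on `U i`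
  let s' : ℕ → ι := fun m => Nat.casesOn m i s
  let D : ℕ → Set α := disjointed (fun m => U (s' m))
  have hDm : ∀ m, MeasurableSet (D m) := fun m => MeasurableSet.disjointed (fun m => hU (s' m)) m
  have hDU : ∀ m, D m ⊆ U (s' m) := fun m => disjointed_subset _ m
  have hDc : ⋃ m, D m = Set.univ := by
    rw [iUnion_disjointed, Set.eq_univ_iff_forall]
    intro a
    obtain ⟨m, hm⟩ := Set.mem_iUnion.1 (hs.symm ▸ Set.mem_univ a : a ∈ ⋃ m, U (s m))
    exact Set.mem_iUnion.2 ⟨m + 1, hm⟩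
  have hDd : Pairwise (Function.onFun Disjoint D) := disjoint_disjointed _
  have hsub : ∀ j A, μ j A = μ j (A ∩ U j) := by
    intro j A
    refine (measure_inter_conull (h0 j)).symm
  let ν : Measure α := Measure.sum fun m => (μ (s' m)).restrict (D m)
  have hν : ∀ j, μ j ≤ ν := by
    intro j
    refine Measure.le_iff.2 fun A hA => ?_
    have hdec : A ∩ U j = ⋃ m, (A ∩ U j) ∩ D m := by
      rw [← Set.inter_iUnion, hDc, Set.inter_univ]
    rw [hsub, hdec, measure_iUnion
      (fun m m' h => (hDd h).mono Set.inter_subset_right Set.inter_subset_right)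
      (fun m => (hA.inter (hU j)).inter (hDm m)), Measure.sum_apply _ hA]
    refine ENNReal.tsum_le_tsum fun m => ?_
    rw [Measure.restrict_apply hA, hc j (s' m) _ ((hA.inter (hU j)).inter (hDm m))
      (fun a ha => ha.1.2) (fun a ha => hDU m ha.2)]
    exact measure_mono fun a ha => ⟨ha.1.1, ha.2⟩
  refine Measure.ext fun A hA => ?_
  rw [Measure.restrict_apply hA]
  apply le_antisymm
  · refine ((iSup_le hν : (⨆ j, μ j) ≤ ν) (A ∩ U i)).trans ?_
    rw [Measure.sum_apply _ (hA.inter (hU i)), tsum_eq_single 0]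
    · rw [Measure.restrict_apply (hA.inter (hU i))]
      exact measure_mono fun a ha => ha.1.1
    · intro m hm
      rw [Measure.restrict_apply (hA.inter (hU i))]
      have hd : Disjoint (D 0) (D m) := hDd (Ne.symm hm)
      have h00 : D 0 = U i := disjointed_zero _
      rw [h00] at hd
      have : A ∩ U i ∩ D m = ∅ := by
        rw [Set.inter_assoc, hd.inter_eq, Set.inter_empty]
      rw [this, measure_empty]
  · rw [hsub]
    exact (le_iSup μ i : μ i ≤ _) _

variable {V α : Type*} [NormedAddCommGroup V] [MeasureSpace V] [BorelSpace V]
  [TopologicalSpace α] [MeasurableSpace α] [BorelSpace α]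

/-- The image under `γ` of the measure with density `J` on `s`. -/
def paramMeasure (s : Set V) (γ : V → α) (J : V → ℝ) : Measure α :=
  ((volume.restrict s).withDensity fun y => ENNReal.ofReal (J y)).map γ

variable {s : Set V} {γ : V → α} {J : V → ℝ}

lemma measurableSet_inter_preimage (hs : MeasurableSet s) (hγ : ContinuousOn γ s) {A : Set α}
    (hA : MeasurableSet A) : MeasurableSet (s ∩ γ ⁻¹' A) := by
  have h := hs.subtype_image ((continuousOn_iff_continuous_domRestrict.1 hγ).measurable hA)
  rw [show s ∩ γ ⁻¹' A = Subtype.val '' ((s.domRestrict γ) ⁻¹' A) from ?_]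
  · exact h
  · ext y
    simp [Set.domRestrict, and_comm]

lemma aemeasurable_param (hs : MeasurableSet s) (hγ : ContinuousOn γ s) :
    AEMeasurable γ ((volume.restrict s).withDensity fun y => ENNReal.ofReal (J y)) :=
  (hγ.aemeasurable hs).mono_ac (withDensity_absolutelyContinuous _ _)

lemma paramMeasure_apply (hs : MeasurableSet s) (hγ : ContinuousOn γ s) {A : Set α}
    (hA : MeasurableSet A) :
    paramMeasure s γ J A = ∫⁻ y in s ∩ γ ⁻¹' A, ENNReal.ofReal (J y) := by
  have hm := measurableSet_inter_preimage hs hγ hA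
  unfold paramMeasure
  rw [Measure.map_apply_of_aemeasurable (aemeasurable_param hs hγ) hA]
  have h1 : ((volume.restrict s).withDensity fun y => ENNReal.ofReal (J y)) sᶜ = 0 := by
    refine withDensity_absolutelyContinuous _ _ ?_
    rw [Measure.restrict_apply hs.compl, Set.compl_inter_self, measure_empty]
  rw [← measure_inter_conull h1, Set.inter_comm, withDensity_apply _ hm,
    Measure.restrict_restrict hm, Set.inter_right_comm, Set.inter_self]

lemma integral_paramMeasure (hs : MeasurableSet s) (hγ : ContinuousOn γ s)
    (hJ : ContinuousOn J s) (hJ0 : ∀ y, 0 ≤ J y) {f : α → ℝ} (hf : Measurable f) :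
    ∫ a, f a ∂(paramMeasure s γ J) = ∫ y in s, J y * f (γ y) := by
  unfold paramMeasure
  rw [integral_map (aemeasurable_param hs hγ) hf.aestronglyMeasurable]
  have hd : AEMeasurable (fun y => ENNReal.ofReal (J y)) (volume.restrict s) :=
    (hJ.aemeasurable hs).ennreal_ofReal
  rw [integral_withDensity_eq_integral_toReal_smul₀ hd (by simp)]
  refine integral_congr_ae (Filter.Eventually.of_forall fun y => ?_)
  simp only [smul_eq_mul, ENNReal.toReal_ofReal (hJ0 y)]

/-- Invariance under reparametrization: `ψ` is the change of parameters. -/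
lemma paramMeasure_apply_eq [NormedSpace ℝ V] [FiniteDimensional ℝ V]
    [(volume : Measure V).IsAddHaarMeasure]
    {s' : Set V} {γ' : V → α} {J' : V → ℝ} (hs : MeasurableSet s) (hγ : ContinuousOn γ s)
    (hs' : MeasurableSet s') (hγ' : ContinuousOn γ' s') {A : Set α} (hA : MeasurableSet A)
    (ψ : V → V) (ψ' : V → V →L[ℝ] V)
    (hψ : ∀ y ∈ s ∩ γ ⁻¹' A, HasFDerivWithinAt ψ (ψ' y) (s ∩ γ ⁻¹' A) y)
    (hinj : Set.InjOn ψ (s ∩ γ ⁻¹' A)) (himg : ψ '' (s ∩ γ ⁻¹' A) = s' ∩ γ' ⁻¹' A)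
    (hJ : ∀ y ∈ s ∩ γ ⁻¹' A, J y = |(ψ' y).det| * J' (ψ y)) :
    paramMeasure s γ J A = paramMeasure s' γ' J' A := by
  have hm := measurableSet_inter_preimage hs hγ hA
  rw [paramMeasure_apply hs hγ hA, paramMeasure_apply hs' hγ' hA, ← himg,
    lintegral_image_eq_lintegral_abs_det_fderiv_mul volume hm hψ hinj]
  refine setLIntegral_congr_fun hm fun y hy => ?_
  rw [hJ y hy, ENNReal.ofReal_mul (abs_nonneg _)]

end Gluing

/-! ### The area element -/

section AreaElement

variable {ι : Type*} [Fintype ι] [DecidableEq ι] {n : ℕ}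

lemma areaElement_nonneg (u : ι → E n) : 0 ≤ areaElement u := Real.sqrt_nonneg _

lemma gram_clm_comp (L : EuclideanSpace ℝ ι →L[ℝ] E n)
    (T : EuclideanSpace ℝ ι →L[ℝ] EuclideanSpace ℝ ι) :
    Matrix.gram ℝ (fun i => L (T (EuclideanSpace.single i 1)))
      = (LinearMap.toMatrix (EuclideanSpace.basisFun ι ℝ).toBasis
          (EuclideanSpace.basisFun ι ℝ).toBasis (T : _ →ₗ[ℝ] _)).transpose
        * Matrix.gram ℝ (fun i => L (EuclideanSpace.single i 1))
        * LinearMap.toMatrix (EuclideanSpace.basisFun ι ℝ).toBasis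
          (EuclideanSpace.basisFun ι ℝ).toBasis (T : _ →ₗ[ℝ] _) := by
  have hT : ∀ i, T (EuclideanSpace.single i 1)
      = ∑ a, (T (EuclideanSpace.single i 1)) a • EuclideanSpace.single a (1 : ℝ) := by
    intro i
    have h := (EuclideanSpace.basisFun ι ℝ).sum_repr (T (EuclideanSpace.single i 1))
    simp only [EuclideanSpace.basisFun_apply, EuclideanSpace.basisFun_repr] at h
    exact h.symm
  ext i j
  rw [Matrix.gram_apply]
  conv_lhs => rw [hT i, hT j]
  simp only [map_sum, map_smul, sum_inner, inner_sum, real_inner_smul_left, real_inner_smul_right,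
    Matrix.mul_apply, Matrix.transpose_apply, LinearMap.toMatrix_apply, Matrix.gram_apply,
    Finset.sum_mul, OrthonormalBasis.coe_toBasis, EuclideanSpace.basisFun_apply,
    OrthonormalBasis.coe_toBasis_repr_apply, EuclideanSpace.basisFun_repr]
  refine Finset.sum_congr rfl fun b _ => Finset.sum_congr rfl fun a _ => ?_
  simp only [ContinuousLinearMap.coe_coe]
  ring

/-- The area element is multiplied by `|det T|` under a linear change of parameters. -/
lemma areaElement_clm_comp (L : EuclideanSpace ℝ ι →L[ℝ] E n)
    (T : EuclideanSpace ℝ ι →L[ℝ] EuclideanSpace ℝ ι) :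
    areaElement (fun i => L (T (EuclideanSpace.single i 1)))
      = |T.det| * areaElement (fun i => L (EuclideanSpace.single i 1)) := by
  unfold areaElement
  rw [gram_clm_comp, Matrix.det_mul, Matrix.det_mul, Matrix.det_transpose, LinearMap.det_toMatrix]
  change √(T.det * _ * T.det) = _
  rw [mul_right_comm, Real.sqrt_mul (mul_self_nonneg _), Real.sqrt_mul_self_eq_abs]

lemma continuous_areaElement : Continuous (areaElement : (ι → E n) → ℝ) := by
  unfold areaElement
  refine Real.continuous_sqrt.comp (Continuous.matrix_det ?_)
  refine continuous_matrix fun i j => ?_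
  simp only [Matrix.gram_apply]
  fun_prop

end AreaElement

/-! ### The Riemannian volumes in charts -/

section ChartVolume

open MeasureTheory

variable (k : ℕ) {n : ℕ} [NeZero k]

/-- `boundaryIncl` as a continuous linear map. -/
def bdryIncl : EuclideanSpace ℝ {i : Fin k // i ≠ 0} →L[ℝ] E k :=
  LinearMap.toContinuousLinearMap
    { toFun := boundaryIncl k
      map_add' := fun z w => by
        ext i
        by_cases h : i = 0 <;> simp [boundaryIncl, h]
      map_smul' := fun c z => by
        ext i
        by_cases h : i = 0 <;> simp [boundaryIncl, h] }

/-- The projection of `ℝᵏ` onto the boundary hyperplane of the half-space. -/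
def bdryProj : E k →L[ℝ] EuclideanSpace ℝ {i : Fin k // i ≠ 0} :=
  LinearMap.toContinuousLinearMap
    { toFun := fun y => WithLp.toLp 2 fun i => y i
      map_add' := fun z w => by ext i; simp
      map_smul' := fun c z => by ext i; simp }

variable {k}

lemma bdryIncl_apply_zero (z : EuclideanSpace ℝ {i : Fin k // i ≠ 0}) : bdryIncl k z 0 = 0 := by
  change boundaryIncl k z 0 = 0
  simp [boundaryIncl]

lemma bdryIncl_apply (z : EuclideanSpace ℝ {i : Fin k // i ≠ 0}) (i : {i : Fin k // i ≠ 0}) :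
    bdryIncl k z i = z i := by
  change boundaryIncl k z i = z i
  simp [boundaryIncl, i.2]

lemma bdryProj_apply (y : E k) (i : {i : Fin k // i ≠ 0}) : bdryProj k y i = y i := rfl

lemma bdryProj_bdryIncl (z : EuclideanSpace ℝ {i : Fin k // i ≠ 0}) :
    bdryProj k (bdryIncl k z) = z := by
  ext i
  rw [bdryProj_apply, bdryIncl_apply]

lemma bdryIncl_bdryProj {y : E k} (hy : y 0 = 0) : bdryIncl k (bdryProj k y) = y := by
  ext i
  by_cases h : i = 0
  · subst h; rw [bdryIncl_apply_zero, hy]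
  · exact (bdryIncl_apply _ ⟨i, h⟩).trans (bdryProj_apply _ _)

lemma bdryIncl_single (i : {i : Fin k // i ≠ 0}) :
    bdryIncl k (EuclideanSpace.single i 1) = EuclideanSpace.single (i : Fin k) (1 : ℝ) := by
  ext j
  by_cases h : j = 0
  · subst h
    rw [bdryIncl_apply_zero]
    simp [Ne.symm i.2]
  · rw [bdryIncl_apply _ ⟨j, h⟩]
    simp [Subtype.ext_iff]

variable {M : Type*} [TopologicalSpace M] [ChartedSpace (EuclideanHalfSpace k) M]
  {F : Type*} [NormedAddCommGroup F] [NormedSpace ℝ F]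

lemma measurableSet_target (p : M) : MeasurableSet (extChartAt (𝓡∂ k) p).target := by
  rw [extChartAt_target]
  exact (((chartAt (EuclideanHalfSpace k) p).open_target.preimage
    (𝓡∂ k).continuous_symm).measurableSet).inter (𝓡∂ k).isClosed_range.measurableSet

/-- Whether a point lies on the boundary can be read off in any chart. -/
lemma boundaryPoint_symm_iff [IsManifold (𝓡∂ k) ∞ M] {p : M} {y : E k}
    (hy : y ∈ (extChartAt (𝓡∂ k) p).target) :
    (extChartAt (𝓡∂ k) p).symm y ∈ (𝓡∂ k).boundary M ↔ y 0 = 0 := by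
  have h := (𝓡∂ k).isInteriorPoint_iff_of_mem_atlas (n := ∞) (by simp)
    (chart_mem_atlas (EuclideanHalfSpace k) p) (x := (extChartAt (𝓡∂ k) p).symm y)
    (by rw [← extChartAt_source (𝓡∂ k)]; exact (extChartAt (𝓡∂ k) p).map_target hy)
  have e : ((chartAt (EuclideanHalfSpace k) p).extend (𝓡∂ k)) ((extChartAt (𝓡∂ k) p).symm y) = y :=
    (extChartAt (𝓡∂ k) p).right_inv hy
  have h2 : y ∈ interior ((chartAt (EuclideanHalfSpace k) p).extend (𝓡∂ k)).target ↔ 0 < y 0 := by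
    have h3 := extChartAt_target_eventuallyEq_of_mem hy
    have h4 : y ∈ interior (Set.range (𝓡∂ k)) ↔ 0 < y 0 := by
      rw [interior_range_modelWithCornersEuclideanHalfSpace]; rfl
    rw [← h4, mem_interior_iff_mem_nhds, mem_interior_iff_mem_nhds]
    exact ⟨fun h => (Filter.mem_of_superset (Filter.inter_mem h h3) fun z hz => hz.2.mp hz.1),
      fun h => (Filter.mem_of_superset (Filter.inter_mem h h3) fun z hz => hz.2.mpr hz.1)⟩
  rw [e, h2] at h
  have h0 := (range_mem_iff k).1 (extChartAt_target_subset_range p hy)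
  rw [← not_iff_not]
  refine (((𝓡∂ k).isInteriorPoint_iff_not_isBoundaryPoint _).symm.trans h).trans ?_
  exact ⟨fun h => h.ne', fun h => lt_of_le_of_ne h0 (Ne.symm h)⟩

/-- A function that vanishes on the boundary hyperplane has no derivative along it. -/
lemma fderivWithin_apply_eq_zero_of_boundary {g : E k → F} {y : E k} (hy0 : y 0 = 0)
    (hd : DifferentiableWithinAt ℝ g (Set.range (𝓡∂ k)) y)
    (h : ∀ᶠ z in nhdsWithin y (Set.range (𝓡∂ k)), z 0 = 0 → g z = 0) {w : E k} (hw : w 0 = 0) :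
    fderivWithin ℝ g (Set.range (𝓡∂ k)) y w = 0 := by
  have hc : HasDerivAt (fun t : ℝ => y + t • w) w 0 := by
    simpa using ((hasDerivAt_id (0 : ℝ)).smul_const w).const_add y
  have hc0 : ∀ t : ℝ, (y + t • w) 0 = 0 := fun t => by simp [hy0, hw]
  have hm : Set.MapsTo (fun t : ℝ => y + t • w) Set.univ (Set.range (𝓡∂ k)) := fun t _ =>
    (range_mem_iff k).2 (hc0 t).ge
  have hd' : HasFDerivWithinAt g (fderivWithin ℝ g (Set.range (𝓡∂ k)) y) (Set.range (𝓡∂ k))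
      (y + (0 : ℝ) • w) := by
    rw [zero_smul, add_zero]; exact hd.hasFDerivWithinAt
  have h1 := hasDerivWithinAt_univ.1 (hd'.comp_hasDerivWithinAt 0 hc.hasDerivWithinAt hm)
  have h2 : Filter.Tendsto (fun t : ℝ => y + t • w) (nhds 0) (nhdsWithin y (Set.range (𝓡∂ k))) := by
    refine tendsto_nhdsWithin_iff.2 ⟨?_, Filter.Eventually.of_forall fun t => hm (Set.mem_univ t)⟩
    simpa using hc.continuousAt.tendsto
  have h3 : g ∘ (fun t : ℝ => y + t • w) =ᶠ[nhds 0] fun _ => 0 := by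
    filter_upwards [h2.eventually h] with t ht
    exact ht (hc0 t)
  exact h1.unique ((hasDerivAt_const 0 (0 : F)).congr_of_eventuallyEq h3)

variable (k) in
/-- The change of coordinates from the preferred chart at `p` to the preferred chart at `q`. -/
def transition (p q : M) : E k → E k := extChartAt (𝓡∂ k) q ∘ (extChartAt (𝓡∂ k) p).symm

section Transition

variable {p q : M} {y : E k} (hy : y ∈ (extChartAt (𝓡∂ k) p).target)
  (hq : (extChartAt (𝓡∂ k) p).symm y ∈ (extChartAt (𝓡∂ k) q).source)
include hy hq

omit hy in
lemma transition_mem : transition k p q y ∈ (extChartAt (𝓡∂ k) q).target :=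
  (extChartAt (𝓡∂ k) q).map_source hq

omit hy in
lemma symm_transition :
    (extChartAt (𝓡∂ k) q).symm (transition k p q y) = (extChartAt (𝓡∂ k) p).symm y :=
  (extChartAt (𝓡∂ k) q).left_inv hq

lemma transition_transition : transition k q p (transition k p q y) = y := by
  unfold transition
  simp only [Function.comp_apply]
  rw [(extChartAt (𝓡∂ k) q).left_inv hq, (extChartAt (𝓡∂ k) p).right_inv hy]

lemma eventually_symm_mem_source :
    ∀ᶠ z in nhdsWithin y (Set.range (𝓡∂ k)), z ∈ (extChartAt (𝓡∂ k) p).target ∧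
      (extChartAt (𝓡∂ k) p).symm z ∈ (extChartAt (𝓡∂ k) q).source := by
  have h1 := extChartAt_target_mem_nhdsWithin_of_mem hy
  have h2 : ContinuousWithinAt (extChartAt (𝓡∂ k) p).symm (extChartAt (𝓡∂ k) p).target y :=
    continuousOn_extChartAt_symm p y hy
  have h3 := h2.eventually ((isOpen_extChartAt_source (I := 𝓡∂ k) q).mem_nhds hq)
  rw [nhdsWithin_extChartAt_target_eq_of_mem hy] at h3
  exact Filter.Eventually.and h1 h3

variable [IsManifold (𝓡∂ k) ∞ M]

lemma transition_apply_zero (h0 : y 0 = 0) : transition k p q y 0 = 0 := by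
  rw [← boundaryPoint_symm_iff (transition_mem hq), symm_transition hq]
  exact (boundaryPoint_symm_iff hy).2 h0

lemma differentiableWithinAt_transition :
    DifferentiableWithinAt ℝ (transition k p q) (Set.range (𝓡∂ k)) y := by
  have h1 : MDifferentiableAt (𝓡∂ k) 𝓘(ℝ, E k) (extChartAt (𝓡∂ k) q)
      ((extChartAt (𝓡∂ k) p).symm y) := by
    have : IsManifold (𝓡∂ k) 1 M := IsManifold.of_le (n := ∞) (by norm_num)
    exact mdifferentiableAt_extChartAt (by rwa [extChartAt_source] at hq)
  have : IsManifold (𝓡∂ k) 1 M := IsManifold.of_le (n := ∞) (by norm_num)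
  exact (h1.comp_mdifferentiableWithinAt y
    (mdifferentiableWithinAt_extChartAt_symm hy)).differentiableWithinAt

lemma fderivWithin_transition_apply_zero (h0 : y 0 = 0) {w : E k} (hw : w 0 = 0) :
    fderivWithin ℝ (transition k p q) (Set.range (𝓡∂ k)) y w 0 = 0 := by
  have hyr : y ∈ Set.range (𝓡∂ k) := extChartAt_target_subset_range p hy
  have hd := differentiableWithinAt_transition hy hq
  have hpr := (EuclideanSpace.proj (0 : Fin k) : E k →L[ℝ] ℝ).hasFDerivAt.comp_hasFDerivWithinAt y
    hd.hasFDerivWithinAt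
  have h := fderivWithin_apply_eq_zero_of_boundary h0 hpr.differentiableWithinAt (by
    filter_upwards [eventually_symm_mem_source hy hq] with z hz hz0
    exact transition_apply_zero hz.1 hz.2 hz0) hw
  rw [hpr.fderivWithin ((𝓡∂ k).uniqueDiffOn y hyr)] at h
  exact h

lemma chartDeriv_transition {f : M → F} (hf : ContMDiff (𝓡∂ k) 𝓘(ℝ, F) ∞ f) :
    chartDeriv k f p y = chartDeriv k f q (transition k p q y)
      ∘L fderivWithin ℝ (transition k p q) (Set.range (𝓡∂ k)) y := by
  have hyr : y ∈ Set.range (𝓡∂ k) := extChartAt_target_subset_range p hy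
  have hmaps : Set.MapsTo (transition k p q) (Set.range (𝓡∂ k)) (Set.range (𝓡∂ k)) := by
    intro z _
    exact ⟨_, rfl⟩
  have hd : DifferentiableWithinAt ℝ (chartRep k f q) (Set.range (𝓡∂ k)) (transition k p q y) := by
    have h := ((contDiffOn_chartRep hf q) _ (transition_mem hq)).differentiableWithinAt (by simp)
    exact h.mono_of_mem_nhdsWithin (extChartAt_target_mem_nhdsWithin_of_mem (transition_mem hq))
  rw [← fderivWithin_comp y hd (differentiableWithinAt_transition hy hq) hmaps
    ((𝓡∂ k).uniqueDiffOn y hyr)]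
  have he : chartRep k f p =ᶠ[nhdsWithin y (Set.range (𝓡∂ k))]
      chartRep k f q ∘ transition k p q := by
    filter_upwards [eventually_symm_mem_source hy hq] with z hz
    change f _ = f ((extChartAt (𝓡∂ k) q).symm (transition k p q z))
    rw [symm_transition hz.2]
  exact he.fderivWithin_eq (congrArg f (symm_transition hq).symm)

end Transition

variable [MeasurableSpace M] {x : M → E n}

lemma chartVolume_eq (p : M) : chartVolume k x p = paramMeasure (extChartAt (𝓡∂ k) p).target
    (extChartAt (𝓡∂ k) p).symm (fun y => areaElement fun i =>
      chartDeriv k x p y (EuclideanSpace.single i 1)) := rfl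

lemma chartBoundaryVolume_eq (p : M) : chartBoundaryVolume k x p =
    paramMeasure (bdryIncl k ⁻¹' (extChartAt (𝓡∂ k) p).target)
      ((extChartAt (𝓡∂ k) p).symm ∘ bdryIncl k) (fun z => areaElement fun i =>
        (chartDeriv k x p (bdryIncl k z) ∘L bdryIncl k) (EuclideanSpace.single i 1)) := by
  have h : ∀ z (i : {i : Fin k // i ≠ 0}),
      (chartDeriv k x p (bdryIncl k z) ∘L bdryIncl k) (EuclideanSpace.single i 1)
      = partialDeriv k x p (boundaryIncl k z) i := by
    intro z i
    rw [ContinuousLinearMap.comp_apply, bdryIncl_single]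
    rfl
  simp_rw [h]
  rfl

variable [BorelSpace M] [IsManifold (𝓡∂ k) ∞ M] (hx : IsSmoothImmersion k x)
include hx

lemma IsSmoothImmersion.chartVolume_compat (p q : M) {A : Set M} (hA : MeasurableSet A)
    (hp : A ⊆ (extChartAt (𝓡∂ k) p).source) (hq : A ⊆ (extChartAt (𝓡∂ k) q).source) :
    chartVolume k x p A = chartVolume k x q A := by
  rw [chartVolume_eq, chartVolume_eq]
  refine paramMeasure_apply_eq (measurableSet_target p) (continuousOn_extChartAt_symm p)
    (measurableSet_target q) (continuousOn_extChartAt_symm q) hA (transition k p q)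
    (fun y => fderivWithin ℝ (transition k p q) (Set.range (𝓡∂ k)) y) ?_ ?_ ?_ ?_
  · intro y hy
    exact (differentiableWithinAt_transition hy.1 (hq hy.2)).hasFDerivWithinAt.mono
      (fun z hz => extChartAt_target_subset_range p hz.1)
  · intro y hy z hz h
    rw [← transition_transition hy.1 (hq hy.2), h, transition_transition hz.1 (hq hz.2)]
  · ext w
    constructor
    · rintro ⟨y, hy, rfl⟩
      refine ⟨transition_mem (hq hy.2), ?_⟩
      rw [Set.mem_preimage, symm_transition (hq hy.2)]
      exact hy.2
    · rintro hw
      refine ⟨transition k q p w, ⟨transition_mem (hp hw.2), ?_⟩,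
        transition_transition hw.1 (hp hw.2)⟩
      rw [Set.mem_preimage, symm_transition (hp hw.2)]
      exact hw.2
  · intro y hy
    rw [chartDeriv_transition hy.1 (hq hy.2) hx.smooth]
    exact areaElement_clm_comp _ _

lemma IsSmoothImmersion.chartBoundaryVolume_compat (p q : M) {A : Set M} (hA : MeasurableSet A)
    (hp : A ⊆ (extChartAt (𝓡∂ k) p).source) (hq : A ⊆ (extChartAt (𝓡∂ k) q).source) :
    chartBoundaryVolume k x p A = chartBoundaryVolume k x q A := by
  rw [chartBoundaryVolume_eq, chartBoundaryVolume_eq]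
  have hcont : ∀ p : M, ContinuousOn ((extChartAt (𝓡∂ k) p).symm ∘ bdryIncl k)
      (bdryIncl k ⁻¹' (extChartAt (𝓡∂ k) p).target) := fun p =>
    (continuousOn_extChartAt_symm p).comp (bdryIncl k).continuous.continuousOn
      (fun z hz => hz)
  have hmeas : ∀ p : M, MeasurableSet (bdryIncl k ⁻¹' (extChartAt (𝓡∂ k) p).target) := fun p =>
    (bdryIncl k).continuous.measurable (measurableSet_target p)
  have hincl : ∀ p q : M, A ⊆ (extChartAt (𝓡∂ k) q).source →
      ∀ z ∈ bdryIncl k ⁻¹' (extChartAt (𝓡∂ k) p).target ∩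
      ((extChartAt (𝓡∂ k) p).symm ∘ bdryIncl k) ⁻¹' A,
      bdryIncl k (bdryProj k (transition k p q (bdryIncl k z))) = transition k p q (bdryIncl k z) :=
    fun p q hq z hz => bdryIncl_bdryProj
      (transition_apply_zero hz.1 (hq hz.2) (bdryIncl_apply_zero z))
  refine paramMeasure_apply_eq (hmeas p) (hcont p) (hmeas q) (hcont q) hA
    (fun z => bdryProj k (transition k p q (bdryIncl k z)))
    (fun z => bdryProj k ∘L fderivWithin ℝ (transition k p q) (Set.range (𝓡∂ k)) (bdryIncl k z)
      ∘L bdryIncl k) ?_ ?_ ?_ ?_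
  · intro z hz
    have h1 := (differentiableWithinAt_transition hz.1 (hq hz.2)).hasFDerivWithinAt
    have h2 : HasFDerivWithinAt (bdryIncl k) (bdryIncl k)
      (bdryIncl k ⁻¹' (extChartAt (𝓡∂ k) p).target ∩
      ((extChartAt (𝓡∂ k) p).symm ∘ bdryIncl k) ⁻¹' A) z := (bdryIncl k).hasFDerivWithinAt
    have h3 := h1.comp z h2 (fun w hw => extChartAt_target_subset_range p hw.1)
    exact (bdryProj k).hasFDerivAt.comp_hasFDerivWithinAt z h3
  · intro z hz w hw h
    have h' := congrArg (bdryIncl k) h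
    simp only at h'
    rw [hincl p q hq z hz, hincl p q hq w hw] at h'
    rw [← bdryProj_bdryIncl z, ← bdryProj_bdryIncl w,
      ← transition_transition hz.1 (hq hz.2), h', transition_transition hw.1 (hq hw.2)]
  · ext w
    constructor
    · rintro ⟨z, hz, rfl⟩
      refine ⟨?_, ?_⟩
      · rw [Set.mem_preimage, hincl p q hq z hz]
        exact transition_mem (hq hz.2)
      · rw [Set.mem_preimage, Function.comp_apply, hincl p q hq z hz, symm_transition (hq hz.2)]
        exact hz.2
    · intro hw
      refine ⟨bdryProj k (transition k q p (bdryIncl k w)), ⟨?_, ?_⟩, ?_⟩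
      · rw [Set.mem_preimage, hincl q p hp w hw]
        exact transition_mem (hp hw.2)
      · rw [Set.mem_preimage, Function.comp_apply, hincl q p hp w hw, symm_transition (hp hw.2)]
        exact hw.2
      · simp only
        rw [hincl q p hp w hw, transition_transition hw.1 (hp hw.2), bdryProj_bdryIncl]
  · intro z hz
    set L := chartDeriv k x q (bdryIncl k (bdryProj k (transition k p q (bdryIncl k z))))
            ∘L bdryIncl k with hL
    set T := bdryProj k ∘L fderivWithin ℝ (transition k p q)
              (Set.range (𝓡∂ k)) (bdryIncl k z) ∘L bdryIncl k with hT
    have h : chartDeriv k x p (bdryIncl k z) ∘L bdryIncl k = L ∘L T := by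
      rw [chartDeriv_transition hz.1 (hq hz.2) hx.smooth, hL, hT, hincl p q hq z hz]
      ext1 u
      have h0 := bdryIncl_bdryProj (fderivWithin_transition_apply_zero hz.1 (hq hz.2)
        (bdryIncl_apply_zero z) (bdryIncl_apply_zero u))
      exact congrArg _ h0.symm
    exact Eq.trans (congrArg (fun B : EuclideanSpace ℝ {i : Fin k // i ≠ 0} →L[ℝ] E n =>
      areaElement fun i => B (EuclideanSpace.single i 1)) h) (areaElement_clm_comp L T)

end ChartVolume

/-! ### Integration over the submanifold and its boundary -/

section Integration

open MeasureTheory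

lemma paramMeasure_lt_top {V α : Type*} [NormedAddCommGroup V] [MeasureSpace V] [BorelSpace V]
    [ProperSpace V] [IsFiniteMeasureOnCompacts (volume : Measure V)]
    [TopologicalSpace α] [MeasurableSpace α] [BorelSpace α] {s : Set V} {γ : V → α} {J : V → ℝ}
    (hs : MeasurableSet s) (hγ : ContinuousOn γ s) {A : Set α} (hA : MeasurableSet A) (c : V)
    (r C : ℝ) (h : ∀ y ∈ s ∩ γ ⁻¹' A, y ∈ Metric.closedBall c r ∧ J y ≤ C) :
    paramMeasure s γ J A < ⊤ := by
  rw [paramMeasure_apply hs hγ hA]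
  refine (setLIntegral_mono_ae' (measurableSet_inter_preimage hs hγ hA)
    (Filter.Eventually.of_forall fun y hy => ENNReal.ofReal_le_ofReal (h y hy).2)).trans_lt ?_
  rw [setLIntegral_const]
  refine ENNReal.mul_lt_top ENNReal.ofReal_lt_top ?_
  exact (measure_mono fun y hy => (h y hy).1).trans_lt
    (isCompact_closedBall c r).measure_lt_top

lemma paramMeasure_compl_eq_zero {V α : Type*} [NormedAddCommGroup V] [MeasureSpace V]
    [BorelSpace V] [TopologicalSpace α] [MeasurableSpace α] [BorelSpace α] {s : Set V} {γ : V → α}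
    {J : V → ℝ} (hs : MeasurableSet s) (hγ : ContinuousOn γ s) {U : Set α} (hU : MeasurableSet U)
    (h : ∀ y ∈ s, γ y ∈ U) : paramMeasure s γ J Uᶜ = 0 := by
  rw [paramMeasure_apply hs hγ hU.compl]
  have : s ∩ γ ⁻¹' Uᶜ = ∅ := by
    ext y
    simp only [Set.mem_inter_iff, Set.mem_preimage, Set.mem_compl_iff, Set.mem_empty_iff_false,
      iff_false, not_and, not_not]
    exact h y
  rw [this, Measure.restrict_empty, lintegral_zero_measure]

variable {k n : ℕ} [NeZero k] {M : Type*} [TopologicalSpace M]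
  [ChartedSpace (EuclideanHalfSpace k) M] [MeasurableSpace M] [BorelSpace M]
  {x : M → E n}

lemma measurableSet_source (p : M) : MeasurableSet (extChartAt (𝓡∂ k) p).source :=
  (isOpen_extChartAt_source p).measurableSet

omit [MeasurableSpace M] [BorelSpace M] in
lemma continuousOn_bdryParam (p : M) : ContinuousOn ((extChartAt (𝓡∂ k) p).symm ∘ bdryIncl k)
    (bdryIncl k ⁻¹' (extChartAt (𝓡∂ k) p).target) :=
  (continuousOn_extChartAt_symm p).comp (bdryIncl k).continuous.continuousOn (fun _ hz => hz)

omit [MeasurableSpace M] [BorelSpace M] in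
lemma measurableSet_bdryTarget (p : M) :
    MeasurableSet (bdryIncl k ⁻¹' (extChartAt (𝓡∂ k) p).target) :=
  (bdryIncl k).continuous.measurable (measurableSet_target p)

omit [BorelSpace M] [MeasurableSpace M] in
variable (k) in
lemma exists_seq_source_cover [CompactSpace M] [Nonempty M] :
    ∃ s : ℕ → M, ⋃ m, (extChartAt (𝓡∂ k) (s m)).source = Set.univ := by
  obtain ⟨t, ht, h⟩ := countable_cover_nhds (X := M)
    (U := fun p => (extChartAt (𝓡∂ k) p).source) (fun p => extChartAt_source_mem_nhds p)
  have hne : t.Nonempty := by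
    by_contra hne
    rw [Set.not_nonempty_iff_eq_empty.1 hne] at h
    simp only [Set.mem_empty_iff_false, Set.iUnion_of_empty, Set.iUnion_empty] at h
    exact (Set.empty_ne_univ h)
  obtain ⟨s, hs⟩ := ht.exists_eq_range hne
  refine ⟨s, ?_⟩
  rw [← h, hs, Set.biUnion_range]

variable [IsManifold (𝓡∂ k) ∞ M] (hx : IsSmoothImmersion k x)
include hx

lemma IsSmoothImmersion.vol_restrict [CompactSpace M] (p : M) :
    (vol k x).restrict (extChartAt (𝓡∂ k) p).source = chartVolume k x p := by
  have : Nonempty M := ⟨p⟩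
  obtain ⟨s, hs⟩ := exists_seq_source_cover (M := M) k
  refine restrict_iSup_eq_of_compatible (chartVolume k x)
    (fun p => (extChartAt (𝓡∂ k) p).source) measurableSet_source ?_
    (fun p q A hA hp hq => hx.chartVolume_compat p q hA hp hq) s hs p
  intro q
  rw [chartVolume_eq]
  exact paramMeasure_compl_eq_zero (measurableSet_target q) (continuousOn_extChartAt_symm q)
    (measurableSet_source q) (fun y hy => (extChartAt (𝓡∂ k) q).map_target hy)

lemma IsSmoothImmersion.boundaryVol_restrict [CompactSpace M] (p : M) :
    (boundaryVol k x).restrict (extChartAt (𝓡∂ k) p).source = chartBoundaryVolume k x p := by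
  have : Nonempty M := ⟨p⟩
  obtain ⟨s, hs⟩ := exists_seq_source_cover (M := M) k
  refine restrict_iSup_eq_of_compatible (chartBoundaryVolume k x)
    (fun p => (extChartAt (𝓡∂ k) p).source) measurableSet_source ?_
    (fun p q A hA hp hq => hx.chartBoundaryVolume_compat p q hA hp hq) s hs p
  intro q
  rw [chartBoundaryVolume_eq]
  exact paramMeasure_compl_eq_zero (measurableSet_bdryTarget q) (continuousOn_bdryParam q)
    (measurableSet_source q) (fun y hy => (extChartAt (𝓡∂ k) q).map_target hy)

omit [MeasurableSpace M] [BorelSpace M] in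
lemma IsSmoothImmersion.continuousOn_area {ι : Type*} [Fintype ι] [DecidableEq ι] (p : M)
    (w : ι → E k) : ContinuousOn (fun y => areaElement fun i => chartDeriv k x p y (w i))
      (extChartAt (𝓡∂ k) p).target := by
  have h := (contDiffOn_chartDeriv hx.smooth p).continuousOn
  exact continuous_areaElement.comp_continuousOn
    (continuousOn_pi.2 fun i => h.clm_apply continuousOn_const)

omit [MeasurableSpace M] [BorelSpace M] in
/-- A neighbourhood of `p` on which area elements in the chart at `p` are bounded. -/
lemma IsSmoothImmersion.exists_nhds_area_le {ι : Type*} [Fintype ι] [DecidableEq ι] (p : M)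
    (w : ι → E k) : ∃ A ∈ nhds p, IsOpen A ∧ A ⊆ (extChartAt (𝓡∂ k) p).source ∧
      ∃ C : ℝ, ∀ y ∈ (extChartAt (𝓡∂ k) p).target, (extChartAt (𝓡∂ k) p).symm y ∈ A →
        y ∈ Metric.closedBall (extChartAt (𝓡∂ k) p p) 1 ∧
        areaElement (fun i => chartDeriv k x p y (w i)) ≤ C := by
  set y₀ := extChartAt (𝓡∂ k) p p
  have h1 := hx.continuousOn_area p w y₀ (mem_extChartAt_target p)
  have h2 := h1.eventually (gt_mem_nhds (lt_add_one (areaElement fun i =>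
    chartDeriv k x p y₀ (w i))))
  obtain ⟨O, hO, hyO, hOsub⟩ := mem_nhdsWithin.1 h2
  refine ⟨(extChartAt (𝓡∂ k) p).source ∩ extChartAt (𝓡∂ k) p ⁻¹' (O ∩ Metric.ball y₀ 1), ?_, ?_,
    Set.inter_subset_left,
    (areaElement fun i => chartDeriv k x p y₀ (w i)) + 1, ?_⟩
  · exact ((continuousOn_extChartAt p).isOpen_inter_preimage (isOpen_extChartAt_source p)
      (hO.inter Metric.isOpen_ball)).mem_nhds ⟨mem_extChartAt_source p, hyO,
        Metric.mem_ball_self one_pos⟩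
  · exact (continuousOn_extChartAt p).isOpen_inter_preimage (isOpen_extChartAt_source p)
      (hO.inter Metric.isOpen_ball)
  · intro y hy hA
    have hA2 := hA.2
    rw [Set.mem_preimage, (extChartAt (𝓡∂ k) p).right_inv hy] at hA2
    exact ⟨Metric.ball_subset_closedBall hA2.2, (hOsub ⟨hA2.1, hy⟩).le⟩

lemma IsSmoothImmersion.isFiniteMeasure_vol [CompactSpace M] : IsFiniteMeasure (vol k x) := by
  refine ⟨isCompact_univ.measure_lt_top_of_nhdsWithin fun p _ => ?_⟩
  obtain ⟨A, hA, hAo, hAs, C, hC⟩ := hx.exists_nhds_area_le p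
    (fun i : Fin k => EuclideanSpace.single i (1 : ℝ))
  refine ⟨A, mem_nhdsWithin_of_mem_nhds hA, ?_⟩
  have h : vol k x A = chartVolume k x p A := by
    rw [← hx.vol_restrict p, Measure.restrict_apply hAo.measurableSet,
      Set.inter_eq_left.2 hAs]
  rw [h, chartVolume_eq]
  exact paramMeasure_lt_top (measurableSet_target p) (continuousOn_extChartAt_symm p)
    hAo.measurableSet _ _ C (fun y hy => hC y hy.1 hy.2)

lemma IsSmoothImmersion.isFiniteMeasure_boundaryVol [CompactSpace M] :
    IsFiniteMeasure (boundaryVol k x) := by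
  refine ⟨isCompact_univ.measure_lt_top_of_nhdsWithin fun p _ => ?_⟩
  obtain ⟨A, hA, hAo, hAs, C, hC⟩ := hx.exists_nhds_area_le p
    (fun i : {i : Fin k // i ≠ 0} => bdryIncl k (EuclideanSpace.single i (1 : ℝ)))
  refine ⟨A, mem_nhdsWithin_of_mem_nhds hA, ?_⟩
  have h : boundaryVol k x A = chartBoundaryVolume k x p A := by
    rw [← hx.boundaryVol_restrict p, Measure.restrict_apply hAo.measurableSet,
      Set.inter_eq_left.2 hAs]
  rw [h, chartBoundaryVolume_eq]
  refine paramMeasure_lt_top (measurableSet_bdryTarget p) (continuousOn_bdryParam p)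
    hAo.measurableSet (bdryProj k (extChartAt (𝓡∂ k) p p)) (‖bdryProj k‖ * 1) C (fun z hz => ?_)
  obtain ⟨h1, h2⟩ := hC (bdryIncl k z) hz.1 hz.2
  refine ⟨?_, h2⟩
  rw [Metric.mem_closedBall, dist_eq_norm] at h1 ⊢
  have h3 := (bdryProj k).le_opNorm (bdryIncl k z - extChartAt (𝓡∂ k) p p)
  rw [map_sub, bdryProj_bdryIncl] at h3
  exact h3.trans (mul_le_mul_of_nonneg_left h1 (norm_nonneg _))

lemma IsSmoothImmersion.integral_vol_eq [CompactSpace M] (p : M) {f : M → ℝ} (hf : Continuous f)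
    (h0 : ∀ q, q ∉ (extChartAt (𝓡∂ k) p).source → f q = 0) :
    ∫ q, f q ∂(vol k x) = ∫ y in (extChartAt (𝓡∂ k) p).target,
      (areaElement fun i => chartDeriv k x p y (EuclideanSpace.single i 1)) *
        f ((extChartAt (𝓡∂ k) p).symm y) := by
  rw [← setIntegral_eq_integral_of_forall_compl_eq_zero (s := (extChartAt (𝓡∂ k) p).source) h0,
    hx.vol_restrict p, chartVolume_eq]
  exact integral_paramMeasure (measurableSet_target p) (continuousOn_extChartAt_symm p)
    (hx.continuousOn_area p _) (fun y => areaElement_nonneg _) hf.measurable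

lemma IsSmoothImmersion.integral_boundaryVol_eq [CompactSpace M] (p : M) {f : M → ℝ}
    (hf : Continuous f) (h0 : ∀ q, q ∉ (extChartAt (𝓡∂ k) p).source → f q = 0) :
    ∫ q, f q ∂(boundaryVol k x) = ∫ z in bdryIncl k ⁻¹' (extChartAt (𝓡∂ k) p).target,
      (areaElement fun i : {i : Fin k // i ≠ 0} => chartDeriv k x p (bdryIncl k z)
        (bdryIncl k (EuclideanSpace.single i 1))) *
        f ((extChartAt (𝓡∂ k) p).symm (bdryIncl k z)) := by
  rw [← setIntegral_eq_integral_of_forall_compl_eq_zero (s := (extChartAt (𝓡∂ k) p).source) h0,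
    hx.boundaryVol_restrict p, chartBoundaryVolume_eq]
  exact integral_paramMeasure (measurableSet_bdryTarget p) (continuousOn_bdryParam p)
    ((hx.continuousOn_area p _).comp (bdryIncl k).continuous.continuousOn (fun _ hz => hz))
    (fun y => areaElement_nonneg _) hf.measurable

/-- The boundary volume is carried by the boundary. -/
lemma IsSmoothImmersion.ae_boundaryVol [CompactSpace M] :
    ∀ᵐ q ∂(boundaryVol k x), q ∈ (𝓡∂ k).boundary M := by
  rcases isEmpty_or_nonempty M with hM | hM
  · exact Filter.Eventually.of_forall fun q => (hM.false q).elim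
  obtain ⟨s, hs⟩ := exists_seq_source_cover (M := M) k
  rw [← Measure.restrict_univ (μ := boundaryVol k x), ← hs, ae_restrict_iUnion_iff]
  intro m
  have hb : MeasurableSet ((𝓡∂ k).boundary M) :=
    ((𝓡∂ k).isClosed_boundary (n := ∞) (by simp)).measurableSet
  rw [hx.boundaryVol_restrict, chartBoundaryVolume_eq]
  exact paramMeasure_compl_eq_zero (measurableSet_bdryTarget _) (continuousOn_bdryParam _) hb
    (fun z hz => (boundaryPoint_symm_iff hz).2 (bdryIncl_apply_zero z))

end Integration

/-! ### The divergence theorem in the half-space -/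

section HalfSpace

open MeasureTheory

variable {k : ℕ} [NeZero k]

lemma integral_bdry_eq {m : ℕ} (f : EuclideanSpace ℝ {i : Fin (m + 1) // i ≠ 0} → ℝ) :
    ∫ z, f z = ∫ u : Fin m → ℝ, f (WithLp.toLp 2 fun i => u ((finSuccAboveEquiv 0).symm i)) := by
  have h1 := (PiLp.volume_preserving_toLp {i : Fin (m + 1) // i ≠ 0}).integral_comp
    (MeasurableEquiv.toLp 2 ({i : Fin (m + 1) // i ≠ 0} → ℝ)).measurableEmbedding f
  have h2 := (volume_measurePreserving_piCongrLeft
    (fun _ : {i : Fin (m + 1) // i ≠ 0} => ℝ) (finSuccAboveEquiv 0)).integral_comp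
    (MeasurableEquiv.measurableEmbedding _) (fun w => f (WithLp.toLp 2 w))
  rw [← h1, ← h2]
  refine integral_congr_ae (Filter.Eventually.of_forall fun u => ?_)
  simp only
  congr 2
  funext i
  obtain ⟨j, rfl⟩ := (finSuccAboveEquiv (0 : Fin (m + 1))).surjective i
  rw [Equiv.symm_apply_apply]
  exact MeasurableEquiv.piCongrLeft_apply_apply (β := fun _ : {i : Fin (m + 1) // i ≠ 0} => ℝ)
    (finSuccAboveEquiv (0 : Fin (m + 1))) u j

/-- The divergence theorem in the half-space, for a vector field with compact support. -/
lemma integral_divergence_halfSpace_aux (G : E k → E k) (G' : E k → E k →L[ℝ] E k) {K : Set (E k)}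
    (hK : IsCompact K) (hG : ContinuousOn G (Set.range (𝓡∂ k)))
    (hG' : ContinuousOn G' (Set.range (𝓡∂ k)))
    (hd : ∀ y : E k, 0 < y 0 → HasFDerivAt G (G' y) y)
    (hKr : K ⊆ Set.range (𝓡∂ k)) (h0 : ∀ y, y ∉ K → G y = 0) (h0' : ∀ y, y ∉ K → G' y = 0) :
    ∫ y, ∑ i, (G' y (EuclideanSpace.single i 1)) i = -∫ z, G (bdryIncl k z) 0 := by
  obtain ⟨m, rfl⟩ := Nat.exists_eq_succ_of_ne_zero (NeZero.ne k)
  obtain ⟨R₀, hR₀⟩ := hK.isBounded.subset_closedBall 0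
  set R := |R₀| + 1
  have hRpos : 0 < R := by positivity
  have hKR : ∀ y ∈ K, ∀ i, |y i| < R := by
    intro y hy i
    have h1 := hR₀ hy
    rw [mem_closedBall_zero_iff] at h1
    have h2 := PiLp.norm_apply_le y i
    rw [Real.norm_eq_abs] at h2
    have := le_abs_self R₀
    linarith
  -- the box `[0, R] × [-R, R]ᵐ`, which contains `K`; the field vanishes on all its faces but the
  -- one in the boundary hyperplane
  let a : Fin (m + 1) → ℝ := fun i => if i = 0 then 0 else -R
  let b : Fin (m + 1) → ℝ := fun _ => R
  have hab : a ≤ b := by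
    intro i
    by_cases h : i = 0 <;> simp only [a, b, h, if_true, if_false] <;> linarith
  let c : (Fin (m + 1) → ℝ) ≃L[ℝ] E (m + 1) := (EuclideanSpace.equiv (Fin (m + 1)) ℝ).symm
  have hc : ∀ u i, c u i = u i := fun u i => rfl
  have ha0 : a 0 = 0 := if_pos rfl
  have hrange : ∀ u ∈ Set.Icc a b, c u ∈ Set.range (𝓡∂ (m + 1)) := by
    intro u hu
    refine (range_mem_iff _).2 ?_
    have h1 : a 0 ≤ u 0 := hu.1 0
    rw [ha0] at h1
    exact h1
  have hbox : ∀ u, c u ∈ K → u ∈ Set.Icc a b := by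
    intro u hu
    have h1 := hKR _ hu
    refine ⟨fun i => ?_, fun i => (le_abs_self _).trans (h1 i).le⟩
    by_cases h : i = 0
    · subst h
      have h2 : 0 ≤ u 0 := (range_mem_iff _).1 (hKr hu)
      rw [ha0]
      exact h2
    · simp only [a, h, if_false]
      have := neg_abs_le (u i)
      have := h1 i
      rw [hc] at this
      linarith
  let f : (Fin (m + 1) → ℝ) → Fin (m + 1) → ℝ := fun u => c.symm (G (c u))
  let f' : (Fin (m + 1) → ℝ) → (Fin (m + 1) → ℝ) →L[ℝ] (Fin (m + 1) → ℝ) :=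
    fun u => (c.symm : E (m + 1) →L[ℝ] (Fin (m + 1) → ℝ)) ∘L G' (c u) ∘L
      (c : (Fin (m + 1) → ℝ) →L[ℝ] E (m + 1))
  have hf : ∀ u i, f u i = G (c u) i := fun u i => rfl
  have hf0 : ∀ u, (∃ i, R ≤ |u i|) → f u = 0 := by
    rintro u ⟨i, hi⟩
    have : c u ∉ K := fun h => absurd (hKR _ h i) (not_lt.2 hi)
    simp only [f, h0 _ this, map_zero]
  have hcont' : ContinuousOn f' (Set.Icc a b) := by
    have h1 : ContinuousOn (fun u => G' (c u)) (Set.Icc a b) :=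
      hG'.comp c.continuous.continuousOn hrange
    exact continuousOn_const.clm_comp (h1.clm_comp continuousOn_const)
  have hint : IntegrableOn (fun u => ∑ i, f' u (Pi.single i 1) i) (Set.Icc a b) := by
    refine ContinuousOn.integrableOn_compact isCompact_Icc ?_
    refine continuousOn_finsetSum _ fun i _ => ?_
    exact (continuous_apply i).comp_continuousOn (hcont'.clm_apply continuousOn_const)
  have hmain := integral_divergence_of_hasFDerivAt_off_countable a b hab f f' ∅
    Set.countable_empty
    (c.symm.continuous.comp_continuousOn (hG.comp c.continuous.continuousOn hrange))
    (by
      intro u hu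
      have hpos : 0 < c u 0 := by
        have h1 : a 0 < u 0 := (hu.1 0 (Set.mem_univ _)).1
        rw [ha0] at h1
        exact h1
      have h1 := (hd (c u) hpos).comp u c.hasFDerivAt
      exact c.symm.hasFDerivAt.comp u h1) hint
  have hL : ∫ u in Set.Icc a b, ∑ i, f' u (Pi.single i 1) i
      = ∫ y, ∑ i, (G' y (EuclideanSpace.single i 1)) i := by
    rw [setIntegral_eq_integral_of_forall_compl_eq_zero]
    · exact (PiLp.volume_preserving_toLp (Fin (m + 1))).integral_comp
        (MeasurableEquiv.toLp 2 (Fin (m + 1) → ℝ)).measurableEmbedding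
        (fun y : E (m + 1) => ∑ i, (G' y (EuclideanSpace.single i 1)) i)
    · intro u hu
      have : c u ∉ K := fun h => hu (hbox u h)
      refine Finset.sum_eq_zero fun i _ => ?_
      simp only [f', h0' _ this]
      simp
  rw [hL] at hmain
  rw [hmain, Fin.sum_univ_succ]
  have hz : ∀ (i : Fin (m + 1)) (s : ℝ), R ≤ |s| →
      ∀ u : Fin m → ℝ, f (i.insertNth s u) i = 0 := by
    intro i s hs u
    rw [hf0 _ ⟨i, by rwa [Fin.insertNth_apply_same]⟩]
    rfl
  have hbR : ∀ i, R ≤ |b i| := fun i => le_abs_self _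
  have haR : ∀ i : Fin m, R ≤ |a i.succ| := fun i => by
    simp only [a, Fin.succ_ne_zero, if_false, abs_neg]
    exact le_abs_self R
  simp only [hz _ _ (hbR _), hz _ _ (haR _), integral_zero, sub_zero, Finset.sum_const_zero,
    add_zero, zero_sub]
  congr 1
  rw [integral_bdry_eq, setIntegral_eq_integral_of_forall_compl_eq_zero]
  · refine integral_congr_ae (Filter.Eventually.of_forall fun u => ?_)
    simp only [hf]
    refine congrArg (fun y : E (m + 1) => G y 0) ?_
    ext i
    rw [hc]
    refine Fin.cases ?_ (fun j => ?_) i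
    · rw [Fin.insertNth_apply_same]
      exact ha0.trans (bdryIncl_apply_zero (k := m + 1) _).symm
    · have h1 := bdryIncl_apply (k := m + 1)
        (WithLp.toLp 2 fun i => u ((finSuccAboveEquiv 0).symm i)) ⟨j.succ, Fin.succ_ne_zero j⟩
      refine Eq.trans ?_ h1.symm
      have h2 : (finSuccAboveEquiv (0 : Fin (m + 1))).symm ⟨j.succ, Fin.succ_ne_zero j⟩ = j := by
        rw [Equiv.symm_apply_eq]
        ext
        simp [finSuccAboveEquiv_apply]
      change _ = u ((finSuccAboveEquiv (0 : Fin (m + 1))).symm ⟨j.succ, Fin.succ_ne_zero j⟩)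
      rw [h2]
      simp
  · intro u hu
    rw [hf, h0, PiLp.zero_apply]
    intro hKu
    refine hu ⟨fun i => ?_, fun i => ?_⟩
    · have := (hbox _ hKu).1 ((0 : Fin (m + 1)).succAbove i)
      rwa [Fin.insertNth_apply_succAbove] at this
    · have := (hbox _ hKu).2 ((0 : Fin (m + 1)).succAbove i)
      rwa [Fin.insertNth_apply_succAbove] at this

/-- The divergence theorem for a vector field on a relatively open subset `t` of the half-space with
compact support in `t`. -/
lemma integral_divergence_halfSpace {t : Set (E k)} (htm : MeasurableSet t)
    (htr : t ⊆ Set.range (𝓡∂ k))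
    (ht : ∀ y ∈ t, t ∈ nhdsWithin y (Set.range (𝓡∂ k))) {g : E k → E k}
    (hg : ContDiffOn ℝ ∞ g t) {K : Set (E k)} (hK : IsCompact K) (hKt : K ⊆ t)
    (h0 : ∀ y ∈ t, y ∉ K → g y = 0) :
    ∫ y in t, ∑ i, (fderivWithin ℝ g t y (EuclideanSpace.single i 1)) i
      = -∫ z in bdryIncl k ⁻¹' t, g (bdryIncl k z) 0 := by
  classical
  have hu : UniqueDiffOn ℝ t := by
    intro y hy
    exact ((𝓡∂ k).uniqueDiffOn y (htr hy)).mono_nhds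
      (nhdsWithin_le_iff.2 (ht y hy))
  let G := t.indicator g
  let G' := t.indicator (fderivWithin ℝ g t)
  have hG0 : ∀ y, y ∉ K → G y = 0 := by
    intro y hy
    by_cases hyt : y ∈ t
    · simp only [G, Set.indicator_of_mem hyt, h0 y hyt hy]
    · simp only [G, Set.indicator_of_notMem hyt]
  have hG'0 : ∀ y, y ∉ K → G' y = 0 := by
    intro y hy
    by_cases hyt : y ∈ t
    · simp only [G', Set.indicator_of_mem hyt]
      have : g =ᶠ[nhdsWithin y t] fun _ => 0 := by
        filter_upwards [self_mem_nhdsWithin,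
          mem_nhdsWithin_of_mem_nhds (hK.isClosed.isOpen_compl.mem_nhds hy)] with z hz hz'
        exact h0 z hz hz'
      rw [this.fderivWithin_eq (h0 y hyt hy), fderivWithin_const_apply]
    · simp only [G', Set.indicator_of_notMem hyt]
  have hcont : ∀ {X : Type} [TopologicalSpace X] [Zero X] (φ : E k → X), ContinuousOn φ t →
      (∀ y, y ∉ K → t.indicator φ y = 0) →
      ContinuousOn (t.indicator φ) (Set.range (𝓡∂ k)) := by
    intro X _ _ φ hφ hφ0 y _
    by_cases hyt : y ∈ t
    · have h1 : ContinuousWithinAt (t.indicator φ) t y :=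
        (hφ y hyt).congr (fun z hz => Set.indicator_of_mem hz _) (Set.indicator_of_mem hyt _)
      exact h1.mono_of_mem_nhdsWithin (ht y hyt)
    · have hyK : y ∉ K := fun h => hyt (hKt h)
      have h1 : t.indicator φ =ᶠ[nhds y] fun _ => 0 := by
        filter_upwards [hK.isClosed.isOpen_compl.mem_nhds hyK] with z hz
        exact hφ0 z hz
      exact (continuousAt_const.congr h1.symm).continuousWithinAt
  have hmain := integral_divergence_halfSpace_aux G G' hK (hcont g hg.continuousOn hG0)
    (hcont (fderivWithin ℝ g t) (hg.continuousOn_fderivWithin hu (by simp)) hG'0)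
    (by
      intro y hy
      by_cases hyt : y ∈ t
      · have hnt : t ∈ nhds y := by
          have h1 := ht y hyt
          rwa [nhdsWithin_eq_nhds.2] at h1
          rw [← mem_interior_iff_mem_nhds, interior_range_modelWithCornersEuclideanHalfSpace]
          exact hy
        have h1 := ((hg.differentiableOn (by simp)) y hyt).hasFDerivWithinAt.hasFDerivAt hnt
        have h2 : G' y = fderivWithin ℝ g t y := Set.indicator_of_mem hyt _
        rw [h2]
        refine h1.congr_of_eventuallyEq ?_
        filter_upwards [hnt] with z hz
        exact Set.indicator_of_mem hz _
      · have hyK : y ∉ K := fun h => hyt (hKt h)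
        rw [hG'0 y hyK]
        refine (hasFDerivAt_const (0 : E k) y).congr_of_eventuallyEq ?_
        filter_upwards [hK.isClosed.isOpen_compl.mem_nhds hyK] with z hz
        exact hG0 z hz)
    (hKt.trans htr) hG0 hG'0
  have hL : ∫ y in t, ∑ i, (fderivWithin ℝ g t y (EuclideanSpace.single i 1)) i
      = ∫ y, ∑ i, (G' y (EuclideanSpace.single i 1)) i := by
    rw [← setIntegral_eq_integral_of_forall_compl_eq_zero (s := t)
      (f := fun y => ∑ i, (G' y (EuclideanSpace.single i 1)) i)]
    · refine setIntegral_congr_fun htm fun y hy => ?_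
      simp only [G', Set.indicator_of_mem hy]
    · intro y hy
      rw [hG'0 y fun h => hy (hKt h)]
      simp
  have hR : ∫ z in bdryIncl k ⁻¹' t, g (bdryIncl k z) 0 = ∫ z, G (bdryIncl k z) 0 := by
    rw [← setIntegral_eq_integral_of_forall_compl_eq_zero (s := bdryIncl k ⁻¹' t)
      (f := fun z => G (bdryIncl k z) 0)]
    · refine setIntegral_congr_fun ((bdryIncl k).continuous.measurable htm) fun z hz => ?_
      simp only [G]
      rw [Set.indicator_of_mem (show bdryIncl k z ∈ t from hz)]
    · intro z hz
      rw [hG0 _ fun h => hz (hKt h)]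
      rfl
  rw [hL, hR, hmain]

end HalfSpace

/-! ### The first variation of the area element -/

section AreaDerivative

variable {k n : ℕ}

/-- The determinant of the metric induced by a linear map. -/
def metricDet (L : E k →L[ℝ] E n) : ℝ :=
  (Matrix.gram ℝ fun i => L (EuclideanSpace.single i 1)).det

lemma areaElement_eq_sqrt (L : E k →L[ℝ] E n) :
    areaElement (fun i => L (EuclideanSpace.single i 1)) = Real.sqrt (metricDet L) := rfl

/-- The coefficients of the metric induced by a linear map. -/
def metricCoeff (L : E k →L[ℝ] E n) : Fin k → Fin k → ℝ :=
  fun i j => ⟪L (EuclideanSpace.single i 1), L (EuclideanSpace.single j 1)⟫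

lemma contDiff_det {m : WithTop ℕ∞} :
    ContDiff ℝ m (fun A : Fin k → Fin k → ℝ => (Matrix.of A).det) := by
  simp only [Matrix.det_apply', Matrix.of_apply]
  refine ContDiff.sum fun s _ => contDiff_const.mul (contDiff_prod fun i _ => ?_)
  fun_prop

lemma contDiff_metricCoeff {m : WithTop ℕ∞} :
    ContDiff ℝ m (metricCoeff : (E k →L[ℝ] E n) → Fin k → Fin k → ℝ) := by
  refine contDiff_pi.2 fun i => contDiff_pi.2 fun j => ?_
  exact (contDiff_id.clm_apply contDiff_const).inner ℝ (contDiff_id.clm_apply contDiff_const)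

lemma contDiff_metricDet {m : WithTop ℕ∞} :
    ContDiff ℝ m (metricDet : (E k →L[ℝ] E n) → ℝ) :=
  contDiff_det.comp contDiff_metricCoeff

lemma metricDet_pos {L : E k →L[ℝ] E n} (hL : Function.Injective L) : 0 < metricDet L := by
  refine (Matrix.posDef_gram_of_linearIndependent ?_).det_pos
  have h := (EuclideanSpace.basisFun (Fin k) ℝ).toBasis.linearIndependent.map' (L : E k →ₗ[ℝ] E n)
    (LinearMap.ker_eq_bot.2 hL)
  have e : (L : E k →ₗ[ℝ] E n) ∘ (EuclideanSpace.basisFun (Fin k) ℝ).toBasis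
      = fun i => L (EuclideanSpace.single i 1) := by
    funext i
    simp
  rwa [e] at h

lemma metricDet_comp (L : E k →L[ℝ] E n) (T : E k →L[ℝ] E k) :
    metricDet (L ∘L T) = T.det ^ 2 * metricDet L := by
  unfold metricDet
  simp only [ContinuousLinearMap.comp_apply]
  rw [gram_clm_comp, Matrix.det_mul, Matrix.det_mul, Matrix.det_transpose, LinearMap.det_toMatrix]
  change T.det * _ * T.det = _
  ring

lemma trace_eq_sum_apply (T : E k →L[ℝ] E k) :
    LinearMap.trace ℝ (E k) (T : E k →ₗ[ℝ] E k)
      = ∑ i, (T (EuclideanSpace.single i 1)) i := by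
  rw [LinearMap.trace_eq_sum_inner _ (EuclideanSpace.basisFun (Fin k) ℝ)]
  refine Finset.sum_congr rfl fun i _ => ?_
  rw [EuclideanSpace.basisFun_apply, EuclideanSpace.inner_single_left]
  simp

lemma hasDerivAt_det_one_add_smul (T : E k →L[ℝ] E k) :
    HasDerivAt (fun t : ℝ => (ContinuousLinearMap.id ℝ (E k) + t • T).det)
      (LinearMap.trace ℝ (E k) (T : E k →ₗ[ℝ] E k)) 0 := by
  let b := (EuclideanSpace.basisFun (Fin k) ℝ).toBasis
  let A := LinearMap.toMatrix b b (T : E k →ₗ[ℝ] E k)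
  have h1 : ∀ t : ℝ, (ContinuousLinearMap.id ℝ (E k) + t • T).det = (1 + t • A).det := by
    intro t
    have : LinearMap.toMatrix b b
        ((ContinuousLinearMap.id ℝ (E k) + t • T : E k →L[ℝ] E k) : E k →ₗ[ℝ] E k) = 1 + t • A := by
      rw [ContinuousLinearMap.toLinearMap_add, ContinuousLinearMap.toLinearMap_smul, map_add,
        map_smul]
      exact congrArg (· + t • A) (LinearMap.toMatrix_id b)
    rw [← this, LinearMap.det_toMatrix]
  simp_rw [h1]
  rw [funext fun t : ℝ => Matrix.det_one_add_smul t A]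
  rw [LinearMap.trace_eq_matrix_trace ℝ b]
  set P := (Matrix.det (1 + (Polynomial.X : Polynomial ℝ) • A.map Polynomial.C)).divX.divX
  have h2 := ((hasDerivAt_id (0 : ℝ)).const_mul A.trace).const_add 1
  have h3 := (P.hasDerivAt 0).mul ((hasDerivAt_id (0 : ℝ)).pow 2)
  refine HasDerivAt.congr_deriv (h2.add h3) ?_
  simp [A]

lemma hasDerivAt_metricCoeff (L H : E k →L[ℝ] E n) :
    HasDerivAt (fun t : ℝ => metricCoeff (L + t • H)) (fun i j =>
      ⟪L (EuclideanSpace.single i 1), H (EuclideanSpace.single j 1)⟫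
        + ⟪H (EuclideanSpace.single i 1), L (EuclideanSpace.single j 1)⟫) 0 := by
  refine hasDerivAt_pi.2 fun i => hasDerivAt_pi.2 fun j => ?_
  have h : ∀ w : E k, HasDerivAt (fun t : ℝ => (L + t • H) w) (H w) 0 := by
    intro w
    have := ((hasDerivAt_id (0 : ℝ)).smul_const (H w)).const_add (L w)
    simpa using this
  have := (h (EuclideanSpace.single i 1)).inner ℝ (h (EuclideanSpace.single j 1))
  simpa [metricCoeff] using this

/-- Jacobi's formula for the metric determinant. Only the tangential part `L ∘ pinv L ∘ H` of the
variation `H` matters to first order, and it amounts to a linear change of parameters. -/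
lemma fderiv_metricDet {L : E k →L[ℝ] E n} (hL : Function.Injective L) (H : E k →L[ℝ] E n) :
    fderiv ℝ metricDet L H
      = 2 * LinearMap.trace ℝ (E k) (pinv L ∘L H : E k →L[ℝ] E k) * metricDet L := by
  set T : E k →L[ℝ] E k := pinv L ∘L H with hT
  have hcoeff : ∀ H : E k →L[ℝ] E n, fderiv ℝ metricCoeff L H = fun i j =>
      ⟪L (EuclideanSpace.single i 1), H (EuclideanSpace.single j 1)⟫
        + ⟪H (EuclideanSpace.single i 1), L (EuclideanSpace.single j 1)⟫ := by
    intro H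
    have h1 : HasFDerivAt metricCoeff (fderiv ℝ metricCoeff L) (L + (0 : ℝ) • H) := by
      rw [show L + (0 : ℝ) • H = L by ext1 w; simp]
      exact ((contDiff_metricCoeff (m := 1)).differentiable (by simp) L).hasFDerivAt
    have h2 : HasDerivAt (fun t : ℝ => L + t • H) H 0 := by
      simpa using ((hasDerivAt_id (0 : ℝ)).smul_const H).const_add L
    have h3 := h1.comp_hasDerivAt 0 h2
    exact h3.unique (hasDerivAt_metricCoeff L H)
  have hTH : fderiv ℝ metricCoeff L H = fderiv ℝ metricCoeff L (L ∘L T) := by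
    rw [hcoeff, hcoeff]
    have key : ∀ u w : E k, ⟪L u, L (T w)⟫ = ⟪L u, H w⟫ := by
      intro u w
      rw [← ContinuousLinearMap.adjoint_inner_right, ← ContinuousLinearMap.adjoint_inner_right]
      exact congrArg (inner ℝ u) (adjoint_apply_pinv hL (H w))
    funext i j
    rw [ContinuousLinearMap.comp_apply L T, ContinuousLinearMap.comp_apply L T, key,
      real_inner_comm (L (EuclideanSpace.single j 1)) (L (T (EuclideanSpace.single i 1))), key,
      real_inner_comm (L (EuclideanSpace.single j 1)) (H (EuclideanSpace.single i 1))]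
  have hcomp : fderiv ℝ metricDet L = fderiv ℝ (fun A : Fin k → Fin k → ℝ => (Matrix.of A).det)
      (metricCoeff L) ∘L fderiv ℝ metricCoeff L :=
    fderiv_comp L ((contDiff_det (m := 1)).differentiable (by simp) _)
      ((contDiff_metricCoeff (m := 1)).differentiable (by simp) L)
  have hTH' : fderiv ℝ metricDet L H = fderiv ℝ metricDet L (L ∘L T) := by
    rw [hcomp, ContinuousLinearMap.comp_apply, ContinuousLinearMap.comp_apply, hTH]
  rw [hTH']
  have h1 : HasFDerivAt metricDet (fderiv ℝ metricDet L) (L + (0 : ℝ) • (L ∘L T)) := by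
    rw [show L + (0 : ℝ) • (L ∘L T) = L by ext1 w; simp]
    exact ((contDiff_metricDet (m := 1)).differentiable (by simp) L).hasFDerivAt
  have h2 : HasDerivAt (fun t : ℝ => L + t • (L ∘L T)) (L ∘L T) 0 := by
    simpa using ((hasDerivAt_id (0 : ℝ)).smul_const (L ∘L T)).const_add L
  have h3 := h1.comp_hasDerivAt 0 h2
  have h4 := ((hasDerivAt_det_one_add_smul T).pow 2).mul_const (metricDet L)
  have e : metricDet ∘ (fun t : ℝ => L + t • (L ∘L T))
      = fun t : ℝ => (ContinuousLinearMap.id ℝ (E k) + t • T).det ^ 2 * metricDet L := by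
    funext t
    rw [← metricDet_comp, Function.comp_apply]
    congr 1
    ext1 w
    simp
  rw [e] at h3
  rw [h3.unique h4]
  have h5 : (ContinuousLinearMap.id ℝ (E k) + (0 : ℝ) • T).det = 1 := by
    rw [show ContinuousLinearMap.id ℝ (E k) + (0 : ℝ) • T = ContinuousLinearMap.id ℝ (E k) by
      ext1 w; simp]
    exact LinearMap.det_id
  simp [h5]

lemma contDiffAt_area {L : E k →L[ℝ] E n} (hL : Function.Injective L) {m : WithTop ℕ∞} :
    ContDiffAt ℝ m (fun L : E k →L[ℝ] E n =>
      areaElement fun i => L (EuclideanSpace.single i 1)) L :=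
  contDiff_metricDet.contDiffAt.sqrt (metricDet_pos hL).ne'

lemma fderiv_area {L : E k →L[ℝ] E n} (hL : Function.Injective L) (H : E k →L[ℝ] E n) :
    fderiv ℝ (fun L : E k →L[ℝ] E n => areaElement fun i => L (EuclideanSpace.single i 1)) L H
      = LinearMap.trace ℝ (E k) (pinv L ∘L H : E k →L[ℝ] E k)
        * areaElement fun i => L (EuclideanSpace.single i 1) := by
  have h := (((contDiff_metricDet (m := 1)).differentiable (by simp) L).hasFDerivAt.sqrt
    (metricDet_pos hL).ne').fderiv
  have h' := congrArg (fun T : (E k →L[ℝ] E n) →L[ℝ] ℝ => T H) h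
  refine Eq.trans h' ?_
  have hs := Real.sqrt_pos.2 (metricDet_pos hL)
  rw [areaElement_eq_sqrt]
  change (1 / (2 * √(metricDet L))) * fderiv ℝ metricDet L H = _
  rw [fderiv_metricDet hL]
  conv_lhs => rw [← Real.mul_self_sqrt (metricDet_pos hL).le]
  rw [Real.sqrt_mul_self hs.le]
  field_simp

end AreaDerivative

/-! ### The divergence theorem in a chart -/

section LocalDivergence

variable {k n : ℕ} [NeZero k] {M : Type*} [TopologicalSpace M]
  [ChartedSpace (EuclideanHalfSpace k) M] [IsManifold (𝓡∂ k) ∞ M] {x : M → E n}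

variable (k) in
/-- The area density of the immersion in the chart at `p`. -/
def chartArea (x : M → E n) (p : M) (y : E k) : ℝ :=
  areaElement fun i => chartDeriv k x p y (EuclideanSpace.single i 1)

variable (k) in
/-- The components of a tangent field `X` in the chart at `p`. -/
def chartField (x X : M → E n) (p : M) (y : E k) : E k :=
  pinv (chartDeriv k x p y) (X ((extChartAt (𝓡∂ k) p).symm y))

variable (hx : IsSmoothImmersion k x) (p : M)
include hx

lemma IsSmoothImmersion.contDiffOn_chartArea :
    ContDiffOn ℝ ∞ (chartArea k x p) (extChartAt (𝓡∂ k) p).target := fun y hy =>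
  (contDiffAt_area (hx.chartDeriv_injective p hy)).comp_contDiffWithinAt y
    (contDiffOn_chartDeriv hx.smooth p y hy)

lemma IsSmoothImmersion.contDiffOn_chartField {X : M → E n}
    (hX : ContMDiff (𝓡∂ k) 𝓘(ℝ, E n) ∞ X) :
    ContDiffOn ℝ ∞ (chartField k x X p) (extChartAt (𝓡∂ k) p).target :=
  (hx.contDiffOn_pinv p).clm_apply (contDiffOn_chartRep hX p)

/-- Jacobi's formula for the area density. -/
lemma IsSmoothImmersion.fderivWithin_chartArea {y : E k}
    (hy : y ∈ (extChartAt (𝓡∂ k) p).target) (w : E k) :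
    fderivWithin ℝ (chartArea k x p) (extChartAt (𝓡∂ k) p).target y w
      = LinearMap.trace ℝ (E k) (pinv (chartDeriv k x p y) ∘L
          fderivWithin ℝ (chartDeriv k x p) (extChartAt (𝓡∂ k) p).target y w : E k →L[ℝ] E k)
        * chartArea k x p y := by
  have hinj := hx.chartDeriv_injective p hy
  have h1 := ((contDiffAt_area hinj (m := 1)).differentiableAt (by simp)).hasFDerivAt
  have h2 := ((contDiffOn_chartDeriv hx.smooth p y hy).differentiableWithinAt
    (by simp)).hasFDerivWithinAt
  have h3 := (h1.comp_hasFDerivWithinAt y h2).fderivWithin (uniqueDiffOn_extChartAt_target p y hy)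
  have h4 := congrArg (fun T : E k →L[ℝ] ℝ => T w) h3
  exact Eq.trans h4 (fderiv_area hinj _)

lemma IsSmoothImmersion.chartDeriv_chartField {X : M → E n}
    (hXt : ∀ q, X q ∈ tangentPlane k x q) {y : E k} (hy : y ∈ (extChartAt (𝓡∂ k) p).target) :
    chartDeriv k x p y (chartField k x X p y) = X ((extChartAt (𝓡∂ k) p).symm y) := by
  have h := hx.ambDeriv_eq p hy (hx.smooth.mdifferentiableAt (by simp))
  have h2 := tangProj_eq_self (hx.immersion _) (hXt ((extChartAt (𝓡∂ k) p).symm y))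
  unfold tangProj at h2
  rw [h] at h2
  exact h2

/-- The divergence of a tangent field in coordinates: `J div X = ∑ᵢ ∂ᵢ (J ξⁱ)`, where `J` is the
area density and `ξ` are the components of `X`. -/
lemma IsSmoothImmersion.sum_fderivWithin_eq {X : M → E n}
    (hX : ContMDiff (𝓡∂ k) 𝓘(ℝ, E n) ∞ X) (hXt : ∀ q, X q ∈ tangentPlane k x q) {y : E k}
    (hy : y ∈ (extChartAt (𝓡∂ k) p).target) :
    ∑ i, (fderivWithin ℝ (fun y => chartArea k x p y • chartField k x X p y)
        (extChartAt (𝓡∂ k) p).target y (EuclideanSpace.single i 1)) i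
      = chartArea k x p y * divergence (k := k) x X ((extChartAt (𝓡∂ k) p).symm y) := by
  set t := (extChartAt (𝓡∂ k) p).target
  have hu := uniqueDiffOn_extChartAt_target (I := 𝓡∂ k) p y hy
  have hinj := hx.chartDeriv_injective p hy
  have hJ := (hx.contDiffOn_chartArea p y hy).differentiableWithinAt (by simp)
  have hξ := (hx.contDiffOn_chartField p hX y hy).differentiableWithinAt (by simp)
  have hL := (contDiffOn_chartDeriv hx.smooth p y hy).differentiableWithinAt (by simp)
  set L := chartDeriv k x p y
  set L' := fderivWithin ℝ (chartDeriv k x p) t y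
  set ξ := chartField k x X p y
  set ξ' := fderivWithin ℝ (chartField k x X p) t y
  set X' := chartDeriv k X p y with hX'
  have hsum : ∀ u : E k, ∑ i, u i • EuclideanSpace.single i (1 : ℝ) = u := by
    intro u
    have h := (EuclideanSpace.basisFun (Fin k) ℝ).sum_repr u
    simpa only [EuclideanSpace.basisFun_apply, EuclideanSpace.basisFun_repr] using h
  -- the product rule
  have h1 : ∑ i, (fderivWithin ℝ (fun y => chartArea k x p y • chartField k x X p y) t y
      (EuclideanSpace.single i 1)) i
      = chartArea k x p y * LinearMap.trace ℝ (E k) (ξ' : E k →ₗ[ℝ] E k)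
        + fderivWithin ℝ (chartArea k x p) t y ξ := by
    rw [trace_eq_sum_apply, Finset.mul_sum]
    conv_rhs => rw [← hsum ξ, map_sum]
    rw [← Finset.sum_add_distrib]
    refine Finset.sum_congr rfl fun i _ => ?_
    rw [fderivWithin_fun_smul hu hJ hξ]
    simp only [add_apply, smul_apply, ContinuousLinearMap.smulRight_apply, PiLp.add_apply,
      PiLp.smul_apply, smul_eq_mul, map_smul]
    rw [mul_comm (ξ i)]
  -- the derivative of `X = L ξ`
  have h2 : ∀ w, X' w = L' w ξ + L (ξ' w) := by
    intro w
    have e : fderivWithin ℝ (chartRep k X p) t y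
        = fderivWithin ℝ (fun y => chartDeriv k x p y (chartField k x X p y)) t y :=
      fderivWithin_congr (fun z hz => (hx.chartDeriv_chartField p hXt hz).symm)
        (hx.chartDeriv_chartField p hXt hy).symm
    rw [hX', chartDeriv_eq_target X p hy, e, fderivWithin_clm_apply hu hL hξ]
    simp only [FunLike.coe_add, Pi.add_apply, ContinuousLinearMap.comp_apply,
      ContinuousLinearMap.flip_apply]
    exact add_comm _ _
  -- the symmetry of the second derivative of the immersion
  have h3 : (pinv L ∘L X' : E k →L[ℝ] E k) = pinv L ∘L L' ξ + ξ' := by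
    ext1 w
    change pinv L (X' w) = pinv L (L' ξ w) + ξ' w
    rw [h2, map_add, pinv_apply_self hinj]
    congr 2
    exact fderivWithin_chartDeriv_symm hx.smooth p hy w ξ
  have h4 : divergence (k := k) x X ((extChartAt (𝓡∂ k) p).symm y)
      = LinearMap.trace ℝ (E k) (pinv L ∘L X' : E k →L[ℝ] E k) := by
    unfold divergence
    rw [hx.ambDeriv_eq p hy (hX.mdifferentiableAt (by simp))]
    have h5 := LinearMap.trace_comp_comm' (R := ℝ) (pinv L : E n →ₗ[ℝ] E k) (X' : E k →ₗ[ℝ] E n)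
    refine Eq.trans ?_ h5
    rw [LinearMap.trace_eq_sum_inner _ (EuclideanSpace.basisFun (Fin n) ℝ)]
    refine Finset.sum_congr rfl fun a _ => ?_
    rw [real_inner_comm]
    rfl
  rw [h1, h4, h3, hx.fderivWithin_chartArea p hy, ContinuousLinearMap.toLinearMap_add, map_add]
  ring

end LocalDivergence

/-! ### The boundary flux in a chart -/

section BoundaryFlux

variable {k n : ℕ} [NeZero k]

lemma det_eq_mul_det_submatrix (A : Matrix (Fin k) (Fin k) ℝ) (h : ∀ j, j ≠ 0 → A 0 j = 0) :
    A.det = A 0 0 * (A.submatrix (Subtype.val : {i : Fin k // i ≠ 0} → Fin k) Subtype.val).det := by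
  rw [Matrix.twoBlockTriangular_det' A (fun i => i = 0) (by rintro _ rfl j hj; exact h j hj)]
  have : Subsingleton {i : Fin k // i = 0} := ⟨fun i j => Subtype.ext (i.2.trans j.2.symm)⟩
  refine congrArg₂ (· * ·) ?_ rfl
  convert Matrix.det_eq_elem_of_subsingleton (A.toSquareBlockProp fun i => i = 0) ⟨0, rfl⟩
  rfl

/-- The area elements of the submanifold and of its boundary: if the unit vector `ν = L u` is
orthogonal to the image of the hyperplane `{w 0 = 0}`, then the volume spanned by `L` is the volume
of the base, spanned by the image of the hyperplane, times the height `1 / |u 0|`. -/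
lemma areaElement_eq_of_conormal (L : E k →L[ℝ] E n) {u : E k} (hu : ‖L u‖ = 1)
    (h : ∀ w : E k, w 0 = 0 → ⟪L w, L u⟫ = 0) :
    areaElement (fun i : {i : Fin k // i ≠ 0} => L (EuclideanSpace.single (i : Fin k) 1))
      = |u 0| * areaElement (fun i => L (EuclideanSpace.single i 1)) := by
  -- the change of parameters that maps the first basis vector to `u` and fixes the others
  let T : E k →L[ℝ] E k := ContinuousLinearMap.id ℝ (E k)
    + (EuclideanSpace.proj (0 : Fin k) : E k →L[ℝ] ℝ).smulRight (u - EuclideanSpace.single 0 1)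
  have hT : ∀ w, T w = w + w 0 • (u - EuclideanSpace.single 0 1) := fun w => rfl
  have hT0 : T (EuclideanSpace.single 0 1) = u := by
    rw [hT]
    simp
  have hTi : ∀ i : Fin k, i ≠ 0 → T (EuclideanSpace.single i 1) = EuclideanSpace.single i 1 := by
    intro i hi
    rw [hT]
    simp [hi.symm]
  have hdet : T.det = u 0 := by
    let b := (EuclideanSpace.basisFun (Fin k) ℝ).toBasis
    have h1 : T.det = (LinearMap.toMatrix b b (T : E k →ₗ[ℝ] E k)).det :=
      (LinearMap.det_toMatrix b (T : E k →ₗ[ℝ] E k)).symm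
    have hA : ∀ i j, LinearMap.toMatrix b b (T : E k →ₗ[ℝ] E k) i j
        = T (EuclideanSpace.single j 1) i := by
      intro i j
      rw [LinearMap.toMatrix_apply]
      simp [b]
    rw [h1, det_eq_mul_det_submatrix _ (fun j hj => by rw [hA, hTi j hj]; simp [hj.symm]), hA, hT0]
    have h2 : (LinearMap.toMatrix b b (T : E k →ₗ[ℝ] E k)).submatrix
        (Subtype.val : {i : Fin k // i ≠ 0} → Fin k)
        (Subtype.val : {i : Fin k // i ≠ 0} → Fin k) = 1 := by
      ext i j
      rw [Matrix.submatrix_apply, hA, hTi j j.2, Matrix.one_apply]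
      simp [Subtype.ext_iff]
    rw [h2, Matrix.det_one, mul_one]
  rw [← hdet, ← areaElement_clm_comp]
  unfold areaElement
  congr 1
  rw [det_eq_mul_det_submatrix (Matrix.gram ℝ fun i => L (T (EuclideanSpace.single i 1)))]
  · rw [Matrix.gram_apply, hT0, real_inner_self_eq_norm_sq, hu, one_pow, one_mul]
    congr 1
    ext i j
    rw [Matrix.submatrix_apply, Matrix.gram_apply, Matrix.gram_apply, hTi i i.2, hTi j j.2]
  · intro j hj
    rw [Matrix.gram_apply, hT0, hTi j hj, real_inner_comm]
    exact h _ (by simp [hj.symm])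

variable {M : Type*} [TopologicalSpace M]
  [ChartedSpace (EuclideanHalfSpace k) M] [IsManifold (𝓡∂ k) ∞ M] {x : M → E n}

lemma range_halfSpace_segment {y : E k} (hy : y ∈ Set.range (𝓡∂ k)) :
    segment ℝ y (y + EuclideanSpace.single 0 1) ⊆ Set.range (𝓡∂ k) := by
  refine (𝓡∂ k).convex_range.segment_subset hy ?_
  rw [range_mem_iff] at hy ⊢
  simpa using add_nonneg hy zero_le_one

/-- The first derivative at the boundary of an immersion into the unit ball that maps the boundary
to the unit sphere, and is tangent to the position vector there. -/
lemma IsSmoothImmersion.conormal_of_boundary (hx : IsSmoothImmersion k x) (hb : ∀ q, ‖x q‖ ≤ 1)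
    (hs : ∀ q ∈ (𝓡∂ k).boundary M, ‖x q‖ = 1) (p : M) {y : E k}
    (hy : y ∈ (extChartAt (𝓡∂ k) p).target) (hy0 : y 0 = 0)
    (ht : x ((extChartAt (𝓡∂ k) p).symm y)
      ∈ tangentPlane k x ((extChartAt (𝓡∂ k) p).symm y)) :
    (∀ w : E k, w 0 = 0 → ⟪chartDeriv k x p y w, chartRep k x p y⟫ = 0) ∧
      ∃ u : E k, u 0 < 0 ∧ chartDeriv k x p y u = chartRep k x p y := by
  have hyr := extChartAt_target_subset_range p hy
  have hbd := (boundaryPoint_symm_iff hy).2 hy0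
  have hy1 : ‖chartRep k x p y‖ = 1 := hs _ hbd
  have hd : HasFDerivWithinAt (chartRep k x p) (chartDeriv k x p y) (Set.range (𝓡∂ k)) y :=
    (((contDiffOn_chartRep hx.smooth p y hy).differentiableWithinAt
      (by simp)).mono_of_mem_nhdsWithin
        (extChartAt_target_mem_nhdsWithin_of_mem hy)).hasFDerivWithinAt
  have hg : HasFDerivWithinAt (fun z => ‖chartRep k x p z‖ ^ 2 - 1)
      ((2 : ℝ) • (innerSL ℝ (chartRep k x p y)) ∘L chartDeriv k x p y) (Set.range (𝓡∂ k)) y := by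
    have h := hd.norm_sq.sub_const 1
    rwa [two_nsmul, ← two_smul ℝ] at h
  have h1 : ∀ w : E k, w 0 = 0 → ⟪chartDeriv k x p y w, chartRep k x p y⟫ = 0 := by
    intro w hw
    have h := fderivWithin_apply_eq_zero_of_boundary hy0 hg.differentiableWithinAt (by
      filter_upwards [extChartAt_target_mem_nhdsWithin_of_mem hy] with z hz hz0
      have : ‖chartRep k x p z‖ = 1 := hs _ ((boundaryPoint_symm_iff hz).2 hz0)
      rw [this]
      norm_num) hw
    rw [hg.fderivWithin ((𝓡∂ k).uniqueDiffOn y hyr)] at h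
    have h' : (2 : ℝ) * ⟪chartRep k x p y, chartDeriv k x p y w⟫ = 0 := h
    rw [real_inner_comm]
    linarith
  have h2 : ⟪chartRep k x p y, chartDeriv k x p y (EuclideanSpace.single 0 1)⟫ ≤ 0 := by
    have hmax : IsLocalMaxOn (fun z => ‖chartRep k x p z‖ ^ 2 - 1) (Set.range (𝓡∂ k)) y := by
      refine Filter.Eventually.of_forall fun z => ?_
      have : ‖chartRep k x p z‖ ≤ 1 := hb _
      change ‖chartRep k x p z‖ ^ 2 - 1 ≤ ‖chartRep k x p y‖ ^ 2 - 1
      rw [hy1]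
      nlinarith [norm_nonneg (chartRep k x p z)]
    have h := hmax.hasFDerivWithinAt_nonpos hg
      (mem_posTangentConeAt_of_segment_subset (range_halfSpace_segment hyr))
    have h' : (2 : ℝ) * ⟪chartRep k x p y, chartDeriv k x p y (EuclideanSpace.single 0 1)⟫ ≤ 0 := h
    linarith
  refine ⟨h1, ?_⟩
  let u := chartField k x (fun q => tangProj k x q (x q)) p y
  have hu : chartDeriv k x p y u = chartRep k x p y := by
    refine (hx.chartDeriv_chartField p (fun q => tangProj_mem (hx.immersion q) _) hy).trans ?_
    exact tangProj_eq_self (hx.immersion _) ht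
  refine ⟨u, ?_, hu⟩
  have hdec : u = (u - u 0 • EuclideanSpace.single 0 1) + u 0 • EuclideanSpace.single 0 1 := by abel
  have h3 : ⟪chartRep k x p y, chartDeriv k x p y u⟫ = 1 := by
    rw [hu, real_inner_self_eq_norm_sq, hy1, one_pow]
  rw [hdec, map_add, inner_add_right, real_inner_comm, h1 _ (by simp), zero_add, map_smul,
    real_inner_smul_right] at h3
  by_contra hneg
  nlinarith [mul_nonneg (not_lt.1 hneg) (neg_nonneg.2 h2)]

/-- The flux of a tangent field through the boundary in coordinates. -/
lemma IsSmoothImmersion.boundary_flux_eq (hx : IsSmoothImmersion k x) (hb : ∀ q, ‖x q‖ ≤ 1)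
    (hs : ∀ q ∈ (𝓡∂ k).boundary M, ‖x q‖ = 1) {X : M → E n}
    (hXt : ∀ q, X q ∈ tangentPlane k x q) (p : M) {y : E k}
    (hy : y ∈ (extChartAt (𝓡∂ k) p).target) (hy0 : y 0 = 0)
    (ht : x ((extChartAt (𝓡∂ k) p).symm y)
      ∈ tangentPlane k x ((extChartAt (𝓡∂ k) p).symm y)) :
    areaElement (fun i : {i : Fin k // i ≠ 0} =>
        chartDeriv k x p y (EuclideanSpace.single (i : Fin k) 1))
      * ⟪X ((extChartAt (𝓡∂ k) p).symm y), x ((extChartAt (𝓡∂ k) p).symm y)⟫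
      = -(chartArea k x p y • chartField k x X p y) 0 := by
  obtain ⟨h1, u, hu0, hu⟩ := hx.conormal_of_boundary hb hs p hy hy0 ht
  have hy1 : ‖chartRep k x p y‖ = 1 := hs _ ((boundaryPoint_symm_iff hy).2 hy0)
  rw [areaElement_eq_of_conormal (chartDeriv k x p y) (by rw [hu, hy1]) (by rwa [hu]),
    ← hx.chartDeriv_chartField p hXt hy, abs_of_neg hu0]
  set ξ := chartField k x X p y
  have h2 : u 0 * ⟪chartDeriv k x p y ξ, chartRep k x p y⟫ = ξ 0 := by
    have h3 := h1 (u 0 • ξ - ξ 0 • u) (by simp [mul_comm])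
    rw [map_sub, map_smul, map_smul, hu, inner_sub_left, real_inner_smul_left,
      real_inner_smul_left, real_inner_self_eq_norm_sq, hy1] at h3
    linarith
  rw [PiLp.smul_apply, smul_eq_mul, ← h2]
  change _ * ⟪_, chartRep k x p y⟫ = _
  unfold chartArea
  ring

end BoundaryFlux

/-! ### The divergence theorem -/

section DivergenceTheorem

open MeasureTheory

variable {k n : ℕ} [NeZero k] {M : Type*} [TopologicalSpace M]
  [ChartedSpace (EuclideanHalfSpace k) M] {x : M → E n}

lemma divergence_eq_zero_of_notMem_tsupport {X : M → E n} {q : M} (hq : q ∉ tsupport X) :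
    divergence (k := k) x X q = 0 := by
  have h1 : X =ᶠ[nhds q] fun _ => 0 := notMem_tsupport_iff_eventuallyEq.1 hq
  have h2 : ambDeriv k x X q = 0 := by
    refine Eq.trans ?_ (ambDeriv_const (k := k) (x := x) (0 : E n) q)
    exact congrArg (fun T : E k →L[ℝ] E n => T ∘L pinv (differential k x q))
      (h1.mfderiv_eq (I := 𝓡∂ k) (I' := 𝓘(ℝ, E n)))
  unfold divergence
  rw [h2]
  simp

lemma divergence_add {X Y : M → E n} (hX : ContMDiff (𝓡∂ k) 𝓘(ℝ, E n) ∞ X)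
    (hY : ContMDiff (𝓡∂ k) 𝓘(ℝ, E n) ∞ Y) (q : M) :
    divergence (k := k) x (fun p => X p + Y p) q
      = divergence (k := k) x X q + divergence (k := k) x Y q := by
  unfold divergence
  rw [← Finset.sum_add_distrib]
  refine Finset.sum_congr rfl fun a _ => ?_
  rw [ambDeriv_add (hX.mdifferentiableAt (by simp)) (hY.mdifferentiableAt (by simp)),
    inner_add_left]

variable [CompactSpace M] [MeasurableSpace M] [BorelSpace M] [IsManifold (𝓡∂ k) ∞ M]
  (hx : IsSmoothImmersion k x)
include hx

lemma IsSmoothImmersion.integrable_vol {f : M → ℝ} (hf : Continuous f) :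
    Integrable f (vol k x) := by
  have := hx.isFiniteMeasure_vol
  exact hf.integrable_of_hasCompactSupport (HasCompactSupport.of_compactSpace f)

lemma IsSmoothImmersion.integrable_boundaryVol {f : M → ℝ} (hf : Continuous f) :
    Integrable f (boundaryVol k x) := by
  have := hx.isFiniteMeasure_boundaryVol
  exact hf.integrable_of_hasCompactSupport (HasCompactSupport.of_compactSpace f)

variable (hb : ∀ q, ‖x q‖ ≤ 1) (hs : ∀ q ∈ (𝓡∂ k).boundary M, ‖x q‖ = 1)
  (ht : ∀ q ∈ (𝓡∂ k).boundary M, x q ∈ tangentPlane k x q)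
include hb hs ht

/-- The divergence theorem for a tangent field supported in the domain of a chart. -/
lemma IsSmoothImmersion.integral_divergence_of_tsupport_subset {X : M → E n}
    (hX : ContMDiff (𝓡∂ k) 𝓘(ℝ, E n) ∞ X) (hXt : ∀ q, X q ∈ tangentPlane k x q) (p : M)
    (hXp : tsupport X ⊆ (extChartAt (𝓡∂ k) p).source) :
    ∫ q, divergence (k := k) x X q ∂(vol k x) = ∫ q, ⟪X q, x q⟫ ∂(boundaryVol k x) := by
  rw [hx.integral_vol_eq p (hx.continuous_divergence hX) (fun q hq =>
      divergence_eq_zero_of_notMem_tsupport fun h => hq (hXp h)),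
    hx.integral_boundaryVol_eq p (contMDiff_inner hX hx.smooth).continuous (fun q hq => by
      rw [image_eq_zero_of_notMem_tsupport fun h => hq (hXp h), inner_zero_left])]
  have hK : IsCompact (extChartAt (𝓡∂ k) p '' tsupport X) :=
    (isClosed_tsupport X).isCompact.image_of_continuousOn
      ((continuousOn_extChartAt p).mono hXp)
  have hKt : extChartAt (𝓡∂ k) p '' tsupport X ⊆ (extChartAt (𝓡∂ k) p).target := by
    rintro _ ⟨q, hq, rfl⟩
    exact (extChartAt (𝓡∂ k) p).map_source (hXp hq)
  have h0 : ∀ y ∈ (extChartAt (𝓡∂ k) p).target, y ∉ extChartAt (𝓡∂ k) p '' tsupport X →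
      chartArea k x p y • chartField k x X p y = 0 := by
    intro y hy hyK
    have h1 : (extChartAt (𝓡∂ k) p).symm y ∉ tsupport X := fun h =>
      hyK ⟨_, h, (extChartAt (𝓡∂ k) p).right_inv hy⟩
    unfold chartField
    rw [image_eq_zero_of_notMem_tsupport h1, map_zero, smul_zero]
  have hg : ContDiffOn ℝ ∞ (fun y => chartArea k x p y • chartField k x X p y)
      (extChartAt (𝓡∂ k) p).target :=
    (hx.contDiffOn_chartArea p).smul (hx.contDiffOn_chartField p hX)
  have h := integral_divergence_halfSpace (measurableSet_target p)
    (extChartAt_target_subset_range p) (fun y hy => extChartAt_target_mem_nhdsWithin_of_mem hy)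
    hg hK hKt h0
  rw [setIntegral_congr_fun (measurableSet_target p)
    (fun y hy => hx.sum_fderivWithin_eq p hX hXt hy)] at h
  refine h.trans ?_
  rw [← integral_neg]
  refine setIntegral_congr_fun (measurableSet_bdryTarget p) fun z hz => ?_
  have hbd := (boundaryPoint_symm_iff hz).2 (bdryIncl_apply_zero z)
  have h2 := hx.boundary_flux_eq hb hs hXt p hz (bdryIncl_apply_zero z) (ht _ hbd)
  simp only [bdryIncl_single]
  exact h2.symm

/-- The divergence theorem for a tangent field, on a submanifold of the unit ball that meets the
unit sphere orthogonally along its boundary. -/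
theorem IsSmoothImmersion.integral_divergence [T2Space M] {X : M → E n}
    (hX : ContMDiff (𝓡∂ k) 𝓘(ℝ, E n) ∞ X) (hXt : ∀ q, X q ∈ tangentPlane k x q) :
    ∫ q, divergence (k := k) x X q ∂(vol k x) = ∫ q, ⟪X q, x q⟫ ∂(boundaryVol k x) := by
  obtain ⟨f, hf⟩ := SmoothPartitionOfUnity.exists_isSubordinate_chartAt_source (𝓡∂ k) M
  have hfin := f.locallyFinite'.finite_nonempty_of_compact
  have hsum : ∀ q, ∑ i ∈ hfin.toFinset, f i q = 1 := by
    intro q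
    refine f.sum_finsupport' q (Set.mem_univ q) fun i hi => ?_
    rw [Set.Finite.mem_toFinset]
    exact ⟨q, (f.mem_finsupport q).1 hi⟩
  have hXi : ∀ i, ContMDiff (𝓡∂ k) 𝓘(ℝ, E n) ∞ (fun q => f i q • X q) := fun i =>
    (f i).contMDiff.smul hX
  have key : ∀ s : Finset M, ContMDiff (𝓡∂ k) 𝓘(ℝ, E n) ∞ (fun q => ∑ i ∈ s, f i q • X q) ∧
      ∫ q, divergence (k := k) x (fun q => ∑ i ∈ s, f i q • X q) q ∂(vol k x)
        = ∫ q, ⟪∑ i ∈ s, f i q • X q, x q⟫ ∂(boundaryVol k x) := by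
    classical
    intro s
    induction s using Finset.induction_on with
    | empty =>
      refine ⟨by simpa using contMDiff_const, ?_⟩
      simp only [Finset.sum_empty, inner_zero_left, integral_zero]
      simp [divergence, ambDeriv_const]
    | insert i s his ih =>
      obtain ⟨ih1, ih2⟩ := ih
      simp only [Finset.sum_insert his]
      refine ⟨(hXi i).add ih1, ?_⟩
      have h1 := hx.integral_divergence_of_tsupport_subset hb hs ht (hXi i)
        (fun q => (tangentPlane k x q).smul_mem _ (hXt q)) i
        ((tsupport_smul_subset_left (f i) X).trans (by
          rw [extChartAt_source]
          exact hf i))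
      simp_rw [divergence_add (hXi i) ih1, inner_add_left]
      rw [integral_add (hx.integrable_vol (hx.continuous_divergence (hXi i)))
          (hx.integrable_vol (hx.continuous_divergence ih1)),
        integral_add (hx.integrable_boundaryVol (contMDiff_inner (hXi i) hx.smooth).continuous)
          (hx.integrable_boundaryVol (contMDiff_inner ih1 hx.smooth).continuous), h1, ih2]
  have h := (key hfin.toFinset).2
  have e : (fun q => ∑ i ∈ hfin.toFinset, f i q • X q) = X := by
    funext q
    rw [← Finset.sum_smul, hsum, one_smul]
  have e' : ∀ q, ∑ i ∈ hfin.toFinset, f i q • X q = X q := fun q => congrFun e q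
  rw [e] at h
  simp_rw [e'] at h
  exact h

end DivergenceTheorem

/-! ### Free boundary minimal submanifolds -/

section FreeBoundaryMinimal

open MeasureTheory

variable {k n : ℕ} [NeZero k] {M : Type*} [TopologicalSpace M]
  [ChartedSpace (EuclideanHalfSpace k) M] {x : M → E n}

lemma IsFreeBoundaryMinimal.isSmoothImmersion (hx : IsFreeBoundaryMinimal k x) :
    IsSmoothImmersion k x := ⟨hx.smooth, hx.immersion⟩

lemma IsFreeBoundaryMinimal.mem_tangentPlane (hx : IsFreeBoundaryMinimal k x) {p : M}
    (hp : p ∈ (𝓡∂ k).boundary M) : x p ∈ tangentPlane k x p := by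
  obtain ⟨-, -, u, -, hu⟩ := hx.orthogonal p hp
  exact ⟨u, hu⟩

variable [IsManifold (𝓡∂ k) ∞ M]

/-- The free boundary condition `x^⊤ = x` can be differentiated along the boundary, whose tangent
vectors are those orthogonal to `x`. It says that `σ(x, u) = 0` for `u` tangent to the boundary. -/
lemma IsFreeBoundaryMinimal.ambDeriv_tangProj_boundary (hx : IsFreeBoundaryMinimal k x) {p : M}
    (hp : p ∈ (𝓡∂ k).boundary M) {u : E n} (hu : u ∈ tangentPlane k x p) (hux : ⟪u, x p⟫ = 0) :
    ambDeriv k x (fun q => tangProj k x q (x q) - x q) p u = 0 := by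
  have hxi := hx.isSmoothImmersion
  have hf : ContMDiff (𝓡∂ k) 𝓘(ℝ, E n) ∞ (fun q => tangProj k x q (x q) - x q) :=
    (hxi.contMDiff_tangProj.clm_apply hx.smooth).sub hx.smooth
  have hf0 : ∀ q ∈ (𝓡∂ k).boundary M, tangProj k x q (x q) - x q = 0 := fun q hq =>
    sub_eq_zero.2 (tangProj_eq_self (hx.immersion q) (hx.mem_tangentPlane hq))
  have hy := mem_extChartAt_target (I := 𝓡∂ k) p
  set y := extChartAt (𝓡∂ k) p p
  have hpy : (extChartAt (𝓡∂ k) p).symm y = p := extChartAt_to_inv p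
  have hy0 : y 0 = 0 := (boundaryPoint_symm_iff hy).1 (by rwa [hpy])
  have e := hxi.ambDeriv_eq p hy (hf.mdifferentiableAt (by simp))
  rw [hpy] at e
  rw [e]
  set w := pinv (chartDeriv k x p y) u
  have hwu : chartDeriv k x p y w = u := by
    have e2 := hxi.ambDeriv_eq p hy (hx.smooth.mdifferentiableAt (by simp))
    rw [hpy] at e2
    have h := tangProj_eq_self (hx.immersion p) hu
    unfold tangProj at h
    rw [e2] at h
    exact h
  have hxy : chartRep k x p y = x p := congrArg x hpy
  obtain ⟨h1, u', hu'0, hu'⟩ := hxi.conormal_of_boundary hx.mem_ball hx.boundary_mem_sphere p hy hy0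
    (by rw [hpy]; exact hx.mem_tangentPlane hp)
  have hw0 : w 0 = 0 := by
    have h2 := h1 (u' 0 • w - w 0 • u') (by simp [mul_comm])
    rw [map_sub, map_smul, map_smul, hu', hwu, hxy, inner_sub_left, real_inner_smul_left,
      real_inner_smul_left, hux, real_inner_self_eq_norm_sq, hx.boundary_mem_sphere p hp] at h2
    linarith
  have hd := ((contDiffOn_chartRep hf p y hy).differentiableWithinAt
    (by simp)).mono_of_mem_nhdsWithin (extChartAt_target_mem_nhdsWithin_of_mem hy)
  refine fderivWithin_apply_eq_zero_of_boundary hy0 hd ?_ hw0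
  filter_upwards [extChartAt_target_mem_nhdsWithin_of_mem hy] with z hz hz0
  exact hf0 _ ((boundaryPoint_symm_iff hz).2 hz0)

variable [T2Space M] [CompactSpace M] [MeasurableSpace M] [BorelSpace M]

theorem IsFreeBoundaryMinimal.indexForm_normalPart (hx : IsFreeBoundaryMinimal k x) (v : E n)
    {W : M → E n} (hW : IsNormalField k x W) :
    indexForm k x (fun p => normalPart k x p v) W
      = -(k : ℝ) * (∫ p, ⟪normalPart k x p v, W p⟫ ∂(vol k x))
        + ∫ p, ⟪jacobi k x W p, conformalField x v p⟫ ∂(vol k x) := by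
  have hxi := hx.isSmoothImmersion
  have hX := hxi.contMDiff_fluxField hW v
  have hdiv := hxi.integral_divergence hx.mem_ball hx.boundary_mem_sphere
    (fun q hq => hx.mem_tangentPlane hq) hX (fun q => fluxField_mem (hx.immersion q) W v)
  have hbdry : ∫ q, ⟪fluxField k x W v q, x q⟫ ∂(boundaryVol k x)
      = ∫ q, ⟪normalPart k x q v, W q⟫ ∂(boundaryVol k x) := by
    refine integral_congr_ae ?_
    filter_upwards [hxi.ae_boundaryVol] with q hq
    exact hxi.inner_fluxField_boundary hW v (hx.boundary_mem_sphere q hq) (hx.mem_tangentPlane hq)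
      (fun u hu hux => hx.ambDeriv_tangProj_boundary hq hu hux)
  have hI1 := hxi.integrable_vol (hxi.continuous_divergence hX)
  have hI2 := (hxi.integrable_vol
    (contMDiff_inner (hxi.isNormalField v).smooth hW.smooth).continuous).const_mul (k : ℝ)
  have hI3 := hxi.integrable_vol
    ((hxi.continuous_jacobi hW).inner (hxi.contMDiff_conformalField v).continuous)
  have hI12 : Integrable (fun p => divergence (k := k) x (fluxField k x W v) p
      - (k : ℝ) * ⟪normalPart k x p v, W p⟫) (vol k x) := hI1.sub hI2
  unfold indexForm
  have e : ∀ p, (∑ i, ⟪normalDeriv k x (fun q => normalPart k x q v) p (frame k x p i),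
          normalDeriv k x W p (frame k x p i)⟫
        - ∑ i, ∑ j, ⟪secondFF k x p (frame k x p i) (frame k x p j), normalPart k x p v⟫ *
          ⟪secondFF k x p (frame k x p i) (frame k x p j), W p⟫)
      = divergence (k := k) x (fluxField k x W v) p - (k : ℝ) * ⟪normalPart k x p v, W p⟫
        + ⟪jacobi k x W p, conformalField x v p⟫ := by
    intro p
    rw [hxi.divergence_fluxField hW v hx.minimal p]
    ring
  simp_rw [e]
  rw [integral_add hI12 hI3, integral_sub hI1 hI2, integral_const_mul, hdiv, hbdry]
  ring

end FreeBoundaryMinimal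

end FreeBoundary

end

theorem mainTheorem2 {k n : ℕ} [NeZero k] (hk : 2 ≤ k) (hkn : k + 1 ≤ n)
    {M : Type*} [TopologicalSpace M] [T2Space M] [CompactSpace M]
    [ChartedSpace (EuclideanHalfSpace k) M] [IsManifold (𝓡∂ k) ∞ M]
    [MeasurableSpace M] [BorelSpace M]
    (x : M → FreeBoundary.E n) (hx : FreeBoundary.IsFreeBoundaryMinimal k x) :
    (∀ (v : FreeBoundary.E n) (W : M → FreeBoundary.E n), FreeBoundary.IsNormalField k x W →
      FreeBoundary.indexForm k x (fun p => FreeBoundary.normalPart k x p v) W =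
        -(k : ℝ) * (∫ p, ⟪FreeBoundary.normalPart k x p v, W p⟫ ∂(FreeBoundary.vol k x))
        + ∫ p, ⟪FreeBoundary.jacobi k x W p,
            ⟪v, x p⟫ • x p + ((1 / 2 : ℝ) * (1 - ‖x p‖ ^ 2)) • v⟫ ∂(FreeBoundary.vol k x)) ∧
    (∀ v : FreeBoundary.E n,
      FreeBoundary.indexForm k x (fun p => FreeBoundary.normalPart k x p v)
          (fun p => FreeBoundary.normalPart k x p v) =
        -(k : ℝ) * ∫ p, ‖FreeBoundary.normalPart k x p v‖ ^ 2 ∂(FreeBoundary.vol k x)) := by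
  have hxi := hx.isSmoothImmersion
  refine ⟨fun v W hW => hx.indexForm_normalPart v hW, fun v => ?_⟩
  rw [hx.indexForm_normalPart v (hxi.isNormalField v)]
  simp_rw [hxi.jacobi_normalPart v hx.minimal, inner_zero_left, real_inner_self_eq_norm_sq]
  rw [MeasureTheory.integral_zero, add_zero]
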